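/- Let $\Sigma$ be a closed (compact, without boundary, not necessarily connected) smooth manifold of dimension $d$, smoothly embedded in $\mathbb{R}^N$; identify $\Sigma$ with its image. Let $g$ be the Riemannian metric on $\Sigma$ induced by the embedding, $\mathrm{vol}_\Sigma$ its Riemannian volume measure, $\nabla$ its Levi-Civita connection, and $\Delta_g f=g^{ij}\nabla_i\nabla_j f$ its Laplace–Beltrami operator. For $t>0$ and a function $f$ on $\Sigma$ put $$\theta_t(x)=\int_\Sigma e^{-\|x-z\|^2/(2t)}\,d\mathrm{vol}_\Sigma(z),\qquad L_tf(x)=\frac{2}{t\,\theta_t(x)}\int_\Sigma \bigl(f(z)-f(x)\bigr)e^{-\|x-z\|^2/(2t)}\,d\mathrm{vol}_\Sigma(z),$$ where $\|\cdot\|$ is the Euclidean norm of $\mathbb{R}^N$. For an operator $L$ on functions on $\Sigma$ put $$\Gamma(L,u,v)=\tfrac12\bigl(L(uv)-L(u)v-uL(v)\bigr),\qquad \Gamma_2(L,u,v)=\tfrac12\bigl(L(\Gamma(L,u,v))-\Gamma(L,Lu,v)-\Gamma(L,u,Lv)\bigr),$$ and for $x,y\in\Sigma$ let $f_{x,y}(z)=\langle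 y-x,z\rangle$ and $\mathrm{Ric}_L(x,y)=\Gamma_2(L,f_{x,y},f_{x,y})(x)$. Then for all $x,y\in\Sigma$ $$\mathrm{Ric}_{\Delta_g}(x,y)=\lim_{t\to0^+}\Gamma_2(L_t,f_{x,y},f_{x,y})(x);$$ that is, the limit exists and equals $\Gamma_2(\Delta_g,f_{x,y},f_{x,y})(x)$. -/

import Mathlib

open Set Filter Topology MeasureTheory
open scoped Manifold ContDiff Matrix

noncomputable section

namespace CoarseRicci

/-! ### Carré du champ and its iterate, for an arbitrary operator on functions -/

/-- `Γ(L,u,v) = (1/2) (L(uv) - L(u) v - u L(v))`. -/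
def Gamma {X : Type*} (L : (X → ℝ) → (X → ℝ)) (u v : X → ℝ) : X → ℝ :=
  fun x => (1 / 2 : ℝ) * (L (fun z => u z * v z) x - L u x * v x - u x * L v x)

/-- `Γ₂(L,u,v) = (1/2) (L(Γ(L,u,v)) - Γ(L,Lu,v) - Γ(L,u,Lv))`. -/
def Gamma2 {X : Type*} (L : (X → ℝ) → (X → ℝ)) (u v : X → ℝ) : X → ℝ :=
  fun x => (1 / 2 : ℝ) * (L (Gamma L u v) x - Gamma L (L u) v x - Gamma L u (L v) x)

/-! ### The approximate Laplacian of a space with distance function `d` and measure `μ` -/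

/-- `θ_t(x) = ∫ exp(-d(x,y)² / 2t) dμ(y)`. -/
def theta {X : Type*} [MeasurableSpace X] (d : X → X → ℝ) (μ : Measure X) (t : ℝ) (x : X) : ℝ :=
  ∫ y, Real.exp (-(d x y) ^ 2 / (2 * t)) ∂μ

/-- `L_t f(x) = 2 / (t θ_t(x)) ∫ (f(y) - f(x)) exp(-d(x,y)² / 2t) dμ(y)`. -/
def approxLaplacian {X : Type*} [MeasurableSpace X] (d : X → X → ℝ) (μ : Measure X) (t : ℝ)
    (f : X → ℝ) : X → ℝ :=
  fun x => 2 / (t * theta d μ t x) *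
    ∫ y, (f y - f x) * Real.exp (-(d x y) ^ 2 / (2 * t)) ∂μ

/-! ### Riemannian geometry of the metric induced by a map `F : M → ℝᴺ`

`M` is a manifold modelled on `ℝᵈ`. For `p : M`, "the chart at `p`" is `chartAt _ p`, and its
inverse `(chartAt _ p).symm` is a local parametrization of `M`, defined on an open subset of `ℝᵈ`. -/

/-- The `i`-th partial derivative of a function on `ℝᵈ`. -/
def partialDeriv {d : ℕ} {V : Type*} [NormedAddCommGroup V] [NormedSpace ℝ V] (i : Fin d)
    (h : EuclideanSpace ℝ (Fin d) → V) (u : EuclideanSpace ℝ (Fin d)) : V :=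
  fderiv ℝ h u (EuclideanSpace.single i 1)

section Induced

variable {d N : ℕ} {M : Type*} [TopologicalSpace M] [ChartedSpace (EuclideanSpace ℝ (Fin d)) M]

/-- The coefficients `g_ij = ⟨∂_i F, ∂_j F⟩` of the metric induced by `F`, in the chart at `p`. -/
def metricCoeff (F : M → EuclideanSpace ℝ (Fin N)) (p : M) (u : EuclideanSpace ℝ (Fin d)) :
    Matrix (Fin d) (Fin d) ℝ :=
  Matrix.of fun i j => inner ℝ
    (partialDeriv i (F ∘ (chartAt (EuclideanSpace ℝ (Fin d)) p).symm) u)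
    (partialDeriv j (F ∘ (chartAt (EuclideanSpace ℝ (Fin d)) p).symm) u)

/-- The Christoffel symbols of the Levi-Civita connection of the induced metric in the chart at `p`,
`Γ^k_ij = (1/2) g^{kl} (∂_i g_jl + ∂_j g_il - ∂_l g_ij)`. -/
def christoffel (F : M → EuclideanSpace ℝ (Fin N)) (p : M) (k i j : Fin d)
    (u : EuclideanSpace ℝ (Fin d)) : ℝ :=
  (1 / 2 : ℝ) * ∑ l, (metricCoeff F p u)⁻¹ k l *
    (partialDeriv i (fun w => metricCoeff F p w j l) u
      + partialDeriv j (fun w => metricCoeff F p w i l) u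
      - partialDeriv l (fun w => metricCoeff F p w i j) u)

/-- The coordinates `∇_i ∇_j f = ∂_i ∂_j f - Γ^k_ij ∂_k f` of the Hessian of `f` with respect to the
induced metric, in the chart at `p`. -/
def hessianCoeff (F : M → EuclideanSpace ℝ (Fin N)) (p : M) (f : M → ℝ) (i j : Fin d)
    (u : EuclideanSpace ℝ (Fin d)) : ℝ :=
  partialDeriv i (partialDeriv j (f ∘ (chartAt (EuclideanSpace ℝ (Fin d)) p).symm)) u
    - ∑ k, christoffel F p k i j u *
        partialDeriv k (f ∘ (chartAt (EuclideanSpace ℝ (Fin d)) p).symm) u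

variable (d) in
/-- The Laplace-Beltrami operator `Δ_g f = g^{ij} ∇_i ∇_j f` of the induced metric. Its value at `x`
is computed in the chart at `x` (it is the same in every chart, for `f` of class `C²`). -/
def laplaceBeltrami (F : M → EuclideanSpace ℝ (Fin N)) (f : M → ℝ) : M → ℝ :=
  fun x => ∑ i : Fin d, ∑ j : Fin d,
    (metricCoeff F x (chartAt (EuclideanSpace ℝ (Fin d)) x x))⁻¹ i j *
      hessianCoeff F x f i j (chartAt (EuclideanSpace ℝ (Fin d)) x x)

variable (d) in
/-- The measure `√(det g) du` in the chart at `p`, transported to `M`. It is concentrated on the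
domain of this chart. -/
def chartVolume [MeasurableSpace M] (F : M → EuclideanSpace ℝ (Fin N)) (p : M) : Measure M :=
  Measure.map (chartAt (EuclideanSpace ℝ (Fin d)) p).symm
    (((volume : Measure (EuclideanSpace ℝ (Fin d))).withDensity
        fun u => ENNReal.ofReal √(metricCoeff F p u).det).restrict
      (chartAt (EuclideanSpace ℝ (Fin d)) p).target)

variable (d) in
/-- The Riemannian volume measure of the induced metric: the measure on `M` that is `√(det g) du` in
every chart. The measures `chartVolume d F p` agree on the overlaps of the chart domains, by the
change of variables formula, and the Riemannian volume is the measure glued from them, that is,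
their least upper bound among the measures on `M`. -/
def riemannianVolume [MeasurableSpace M] (F : M → EuclideanSpace ℝ (Fin N)) : Measure M :=
  ⨆ p : M, chartVolume d F p

end Induced

/-! ### Coarse Ricci curvature for a space mapped into `ℝᴺ` -/

/-- The ambient (chordal) distance `‖x - y‖`. -/
def chordalDist {M : Type*} {N : ℕ} (F : M → EuclideanSpace ℝ (Fin N)) (x y : M) : ℝ :=
  ‖F x - F y‖

/-- The function `f_{x,y}(z) = ⟨y - x, z⟩`. -/
def linearFn {M : Type*} {N : ℕ} (F : M → EuclideanSpace ℝ (Fin N)) (x y : M) : M → ℝ :=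
  fun z => inner ℝ (F y - F x) (F z)

/-- The coarse Ricci curvature `Ric_L(x,y) = Γ₂(L, f_{x,y}, f_{x,y})(x)` of an operator `L`. -/
def coarseRic {M : Type*} {N : ℕ} (F : M → EuclideanSpace ℝ (Fin N)) (L : (M → ℝ) → (M → ℝ))
    (x y : M) : ℝ :=
  Gamma2 L (linearFn F x y) (linearFn F x y) x

end CoarseRicci

end

/-! Expanding `Γ₂(L, f, f)(x)` leaves only terms `L(L a)`, `L(b L a)` and products of `f` and `L f`
at `x`. It therefore suffices that `L_t a → Δ a` and `L_t (b L_t a) → Δ (b Δ a)` pointwise for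
smooth `a`, `b`. Pointwise convergence alone does not give the second limit, because `L_t` carries a
factor `1/t`. What is needed is `L_t a = Δ a + t r_t`, with `r_t(z)` converging as `(t, z) → (0, x)`
jointly (`exists_expansion`).

Then `L_t (b L_t a)(x) = L_t (b Δ a)(x) + 2 (average of b r_t - b(x) r_t(x))`, the average being
against the normalized kernel at `x`. This average and the value at `x` have the same limit, so the
bracket tends to zero (`tendsto_approxLaplacian_mul_approxLaplacian`).

For the expansion, the kernel is exponentially small away from `x`, so one chart suffices
(`exists_local_model`). There the immersion is replaced by a globally defined map `Ψ`, bi-Lipschitz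
from below. The substitution `v = u + s w` with `s = √t` turns the heat integral into `s^d W(u, s)`,
where `W(u, s) = ∫ f(u + s w) exp(-‖Ψ(u + s w) - Ψ u‖² / (2 s²)) dw`. The difference quotient `(Ψ(u
+ s w) - Ψ u) / s` extends smoothly across `s = 0` and grows at least linearly in `w`, so `W` is
smooth in `(u, s)`. The change `w ↦ -w` shows that `W` is even in `s`. Hence the expansions proceed
in powers of `s² = t`, and two divisions by `s²` yield the limit and the remainder.

The limit is a Gaussian integral involving second derivatives of the function and of the immersion.
Integration by parts, the identity `⟨∂_l Φ, ∂_i ∂_j Φ⟩ = g_lk Γ^k_ij` and `∂_i √det g = √det g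
Γ^k_ki` reduce it to `g^ij ∇_i ∇_j a` (`integral_gaussWeight_eq_trace`). This is done only at the
centre of the chart. Smoothness of `Δ a`, whose definition uses a different chart at each point,
then follows from uniqueness of limits. -/

namespace CoarseRicci

open Function

/-! ### Functions of temperate growth defined by integrals -/

section ParametricIntegral

variable {P W V : Type} [NormedAddCommGroup P] [NormedSpace ℝ P]
  [NormedAddCommGroup W] [NormedSpace ℝ W] [MeasurableSpace W] [BorelSpace W]
  [SecondCountableTopology W]
  [NormedAddCommGroup V] [NormedSpace ℝ V]

/-- The smooth functions of two variables all of whose derivatives are bounded by a polynomial in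
the first variable times an integrable function of the second one. -/
def IntegrableGrowth (ν : Measure W) (f : P × W → V) : Prop :=
  ContDiff ℝ ∞ f ∧ ∀ n : ℕ, ∃ (k : ℕ) (g : W → ℝ), Integrable g ν ∧
    ∀ p w, ‖iteratedFDeriv ℝ n f (p, w)‖ ≤ (1 + ‖p‖) ^ k * g w

/-- The derivative in the direction of the first variable. -/
noncomputable def fderivFst (f : P × W → V) (x : P × W) : P →L[ℝ] V :=
  (fderiv ℝ f x).comp (ContinuousLinearMap.inl ℝ P W)

omit [BorelSpace W] [SecondCountableTopology W] in
lemma IntegrableGrowth.fderivFst {ν : Measure W} {f : P × W → V} (hf : IntegrableGrowth ν f) :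
    IntegrableGrowth ν (fderivFst f) := by
  have h1 : ContDiff ℝ ∞ (fderiv ℝ f) := hf.1.fderiv_right (by simp)
  let T : (P × W →L[ℝ] V) →L[ℝ] (P →L[ℝ] V) :=
    (ContinuousLinearMap.compL ℝ P (P × W) V).flip (ContinuousLinearMap.inl ℝ P W)
  have h2 : CoarseRicci.fderivFst f = T ∘ fderiv ℝ f := by ext; rfl
  refine ⟨by rw [h2]; exact T.contDiff.comp h1, fun n => ?_⟩
  obtain ⟨k, g, hg, hb⟩ := hf.2 (n + 1)
  refine ⟨k, fun w => ‖T‖ * g w, hg.const_mul _, fun p w => ?_⟩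
  rw [h2]
  refine (T.norm_iteratedFDeriv_comp_left (N := ∞) h1.contDiffAt (mod_cast le_top)).trans ?_
  rw [norm_iteratedFDeriv_fderiv]
  calc ‖T‖ * ‖iteratedFDeriv ℝ (n + 1) f (p, w)‖ ≤ ‖T‖ * ((1 + ‖p‖) ^ k * g w) := by
        gcongr; exact hb p w
    _ = _ := by ring

lemma IntegrableGrowth.integrable {ν : Measure W} {f : P × W → V} (hf : IntegrableGrowth ν f)
    (p : P) : Integrable (fun w => f (p, w)) ν := by
  obtain ⟨k, g, hg, hb⟩ := hf.2 0
  refine (hg.const_mul ((1 + ‖p‖) ^ k)).mono' ?_ (ae_of_all _ fun w => by simpa using hb p w)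
  exact (hf.1.continuous.comp (by fun_prop)).aestronglyMeasurable

lemma IntegrableGrowth.hasFDerivAt {ν : Measure W} {f : P × W → V} (hf : IntegrableGrowth ν f)
    (p : P) : HasFDerivAt (fun p => ∫ w, f (p, w) ∂ν)
      (∫ w, CoarseRicci.fderivFst f (p, w) ∂ν) p := by
  obtain ⟨k, g, hg, hb⟩ := hf.fderivFst.2 0
  have hb' : ∀ p w, ‖CoarseRicci.fderivFst f (p, w)‖ ≤ (1 + ‖p‖) ^ k * g w := fun p w => by
    simpa using hb p w
  have hg0 : ∀ w, 0 ≤ g w := fun w => by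
    have := (norm_nonneg _).trans (hb' 0 w)
    simpa using this
  refine hasFDerivAt_integral_of_dominated_of_fderiv_le
    (F' := fun p w => CoarseRicci.fderivFst f (p, w))
    (bound := fun w => (2 + ‖p‖) ^ k * g w) (Metric.ball_mem_nhds p one_pos) ?_ (hf.integrable p) ?_ ?_
    (hg.const_mul _) ?_
  · exact Eventually.of_forall fun q => (hf.integrable q).aestronglyMeasurable
  · exact (hf.fderivFst.integrable p).aestronglyMeasurable
  · refine ae_of_all _ fun w q hq => (hb' q w).trans ?_
    have : ‖q‖ ≤ 1 + ‖p‖ := by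
      have h1 : ‖q - p‖ < 1 := by simpa [dist_eq_norm] using hq
      have h2 := norm_add_le (q - p) p
      rw [sub_add_cancel] at h2
      linarith
    have h0 := hg0 w
    gcongr ?_ ^ k * g w
    linarith
  · refine ae_of_all _ fun w q _ => ?_
    have h1 := (hf.1.differentiable (by simp) (q, w)).hasFDerivAt
    exact h1.comp q (hasFDerivAt_prodMk_left q w)

/-- The hypothesis is inherited by the derivative in `p`, and the derivative of the integral is the
integral of that derivative; induction on the order does the rest. -/
lemma IntegrableGrowth.hasTemperateGrowth {ν : Measure W} {f : P × W → V}
    (hf : IntegrableGrowth ν f) : HasTemperateGrowth (fun p => ∫ w, f (p, w) ∂ν) := by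
  -- The derivative takes values in `P →L[ℝ] V`, so the codomain varies in the induction. This is
  -- why all the spaces lie in the single universe `Type`.
  have main : ∀ n : ℕ, ∀ (V : Type) [NormedAddCommGroup V] [NormedSpace ℝ V] (f : P × W → V),
      IntegrableGrowth ν f → ContDiff ℝ n (fun p => ∫ w, f (p, w) ∂ν) ∧ ∃ (k : ℕ) (C : ℝ),
        ∀ p, ‖iteratedFDeriv ℝ n (fun p => ∫ w, f (p, w) ∂ν) p‖ ≤ C * (1 + ‖p‖) ^ k := by
    intro n
    induction n with
    | zero =>
      intro V _ _ f hf
      constructor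
      · simpa using continuous_iff_continuousAt.2 fun p => (hf.hasFDerivAt p).continuousAt
      · obtain ⟨k, g, hg, hb⟩ := hf.2 0
        refine ⟨k, ∫ w, g w ∂ν, fun p => ?_⟩
        rw [norm_iteratedFDeriv_zero, mul_comm, ← integral_const_mul]
        exact norm_integral_le_of_norm_le (hg.const_mul _)
          (ae_of_all _ fun w => by simpa using hb p w)
    | succ n ih =>
      intro V _ _ f hf
      have h1 : fderiv ℝ (fun p => ∫ w, f (p, w) ∂ν) =
          fun p => ∫ w, CoarseRicci.fderivFst f (p, w) ∂ν :=
        funext fun p => (hf.hasFDerivAt p).fderiv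
      obtain ⟨h2, k, C, h3⟩ := ih _ _ hf.fderivFst
      constructor
      · have : ((n + 1 : ℕ) : ℕ∞ω) = (n : ℕ∞ω) + 1 := by simp
        rw [this, contDiff_succ_iff_fderiv]
        refine ⟨fun p => (hf.hasFDerivAt p).differentiableAt, by simp, ?_⟩
        rw [h1]; exact h2
      · refine ⟨k, C, fun p => ?_⟩
        rw [← norm_iteratedFDeriv_fderiv, h1]
        exact h3 p
  exact ⟨contDiff_infty.2 fun n => (main n V f hf).1, fun n => (main n V f hf).2⟩

/-- Serves the integral over `τ ∈ [0, 1]` that defines `hadamard`. -/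
lemma _root_.Function.HasTemperateGrowth.integrableGrowth_restrict_Icc {f : P × ℝ → V}
    (hf : HasTemperateGrowth f) : IntegrableGrowth (volume.restrict (Icc (0 : ℝ) 1)) f := by
  refine ⟨hf.1, fun n => ?_⟩
  obtain ⟨k, C, hC⟩ := hf.2 n
  have hC0 : 0 ≤ C := by
    have := (norm_nonneg _).trans (hC 0)
    simpa using this
  refine ⟨k, fun w => C * (1 + ‖w‖) ^ k, ?_, fun p w => (hC (p, w)).trans ?_⟩
  · exact (Continuous.continuousOn (by fun_prop)).integrableOn_compact isCompact_Icc
  · calc C * (1 + ‖(p, w)‖) ^ k ≤ C * ((1 + ‖p‖) * (1 + ‖w‖)) ^ k := by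
          gcongr
          rw [Prod.norm_def]
          have h1 := norm_nonneg p
          have h2 := norm_nonneg w
          have h3 := mul_nonneg h1 h2
          rcases le_total ‖p‖ ‖w‖ with h | h <;> simp only [h, sup_of_le_left, sup_of_le_right] <;> linarith
      _ = _ := by rw [mul_pow]; ring

end ParametricIntegral

/-! ### Derivatives of `exp (-R)` times a function of temperate growth. -/

section ExpNeg

variable {X V : Type} [NormedAddCommGroup X] [NormedSpace ℝ X]
  [NormedAddCommGroup V] [NormedSpace ℝ V]

lemma contDiff_exp_neg {R : X → ℝ} (hR : HasTemperateGrowth R) :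
    ContDiff ℝ ∞ fun x => Real.exp (-R x) := hR.1.neg.exp

/-- The derivatives of `exp (-R)` are bounded by a polynomial times `exp (-R)`. -/
lemma norm_iteratedFDeriv_exp_neg_le {R : X → ℝ} (hR : HasTemperateGrowth R) (n : ℕ) :
    ∃ (k : ℕ) (C : ℝ), 0 ≤ C ∧ ∀ x,
      ‖iteratedFDeriv ℝ n (fun x => Real.exp (-R x)) x‖ ≤ C * (1 + ‖x‖) ^ k * Real.exp (-R x) := by
  induction n using Nat.strong_induction_on with
  | _ n ih =>
    rcases n with _ | n
    · exact ⟨0, 1, zero_le_one, fun x => by simp⟩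
    have hdR : ContDiff ℝ ∞ (fun x => -fderiv ℝ R x) := (hR.1.fderiv_right (by simp)).neg
    have h1 : fderiv ℝ (fun x => Real.exp (-R x)) =
        fun x => Real.exp (-R x) • -fderiv ℝ R x := by
      funext x
      exact ((hR.1.differentiable (by simp) x).hasFDerivAt.neg.exp).fderiv
    choose! k C hC0 hC using ih
    choose l D hD using hR.2
    have hD0 : ∀ i, 0 ≤ D i := fun i => by
      have := (norm_nonneg _).trans (hD i 0)
      simpa using this
    -- The sum of all exponents occurring in the Leibniz formula for `exp (-R) • -DR`; it dominates
    -- each of them.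
    let K := ∑ i ∈ Finset.range (n + 1), (k i + l (n - i + 1))
    refine ⟨K, ∑ i ∈ Finset.range (n + 1), (n.choose i : ℝ) * C i * D (n - i + 1),
      Finset.sum_nonneg fun i hi => ?_, fun x => ?_⟩
    · have := hC0 i (by simpa using hi)
      have := hD0 (n - i + 1)
      positivity
    rw [← norm_iteratedFDeriv_fderiv, h1]
    refine (norm_iteratedFDeriv_smul_le (n := n) (N := ∞) (contDiff_exp_neg hR)
      hdR x (mod_cast le_top)).trans ?_
    rw [Finset.sum_mul, Finset.sum_mul]
    refine Finset.sum_le_sum fun i hi => ?_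
    have e1 : ‖iteratedFDeriv ℝ (n - i) (fun x => -fderiv ℝ R x) x‖ ≤
        D (n - i + 1) * (1 + ‖x‖) ^ l (n - i + 1) := by
      have : (fun x => -fderiv ℝ R x) = -fderiv ℝ R := rfl
      rw [this, iteratedFDeriv_neg_apply, norm_neg, norm_iteratedFDeriv_fderiv]
      exact hD _ x
    have e2 := hC i (by simpa using hi) x
    have e3 := hC0 i (by simpa using hi)
    have e4 := hD0 (n - i + 1)
    have e5 : (1 + ‖x‖) ^ (k i + l (n - i + 1)) ≤ (1 + ‖x‖) ^ K := by
      refine pow_le_pow_right₀ (by simp) ?_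
      exact Finset.single_le_sum (f := fun i => k i + l (n - i + 1)) (fun _ _ => Nat.zero_le _) hi
    calc _ ≤ (n.choose i : ℝ) * (C i * (1 + ‖x‖) ^ k i * Real.exp (-R x)) *
          (D (n - i + 1) * (1 + ‖x‖) ^ l (n - i + 1)) := by gcongr
      _ = (n.choose i : ℝ) * C i * D (n - i + 1) * (1 + ‖x‖) ^ (k i + l (n - i + 1)) *
          Real.exp (-R x) := by rw [pow_add]; ring
      _ ≤ _ := by gcongr

lemma norm_iteratedFDeriv_exp_neg_smul_le {R : X → ℝ} {T : X → V} (hR : HasTemperateGrowth R)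
    (hT : HasTemperateGrowth T) (n : ℕ) :
    ∃ (k : ℕ) (C : ℝ), 0 ≤ C ∧ ∀ x,
      ‖iteratedFDeriv ℝ n (fun x => Real.exp (-R x) • T x) x‖ ≤
        C * (1 + ‖x‖) ^ k * Real.exp (-R x) := by
  choose k C hC0 hC using norm_iteratedFDeriv_exp_neg_le hR
  choose l D hD using hT.2
  have hD0 : ∀ i, 0 ≤ D i := fun i => by
    have := (norm_nonneg _).trans (hD i 0)
    simpa using this
  let K := ∑ i ∈ Finset.range (n + 1), (k i + l (n - i))
  refine ⟨K, ∑ i ∈ Finset.range (n + 1), (n.choose i : ℝ) * C i * D (n - i),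
    Finset.sum_nonneg fun i hi => ?_, fun x => ?_⟩
  · have := hC0 i
    have := hD0 (n - i)
    positivity
  refine (norm_iteratedFDeriv_smul_le (n := n) (N := ∞) (contDiff_exp_neg hR)
    hT.1 x (mod_cast le_top)).trans ?_
  rw [Finset.sum_mul, Finset.sum_mul]
  refine Finset.sum_le_sum fun i hi => ?_
  have e1 := hD (n - i) x
  have e2 := hC i x
  have e3 := hC0 i
  have e4 := hD0 (n - i)
  have e5 : (1 + ‖x‖) ^ (k i + l (n - i)) ≤ (1 + ‖x‖) ^ K := by
    refine pow_le_pow_right₀ (by simp) ?_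
    exact Finset.single_le_sum (f := fun i => k i + l (n - i)) (fun _ _ => Nat.zero_le _) hi
  calc _ ≤ (n.choose i : ℝ) * (C i * (1 + ‖x‖) ^ k i * Real.exp (-R x)) *
        (D (n - i) * (1 + ‖x‖) ^ l (n - i)) := by gcongr
    _ = (n.choose i : ℝ) * C i * D (n - i) * (1 + ‖x‖) ^ (k i + l (n - i)) *
        Real.exp (-R x) := by rw [pow_add]; ring
    _ ≤ _ := by gcongr

end ExpNeg

/-! ### Integrability when the exponent dominates a positive quadratic form. -/

section Gaussian

variable {E : Type} [NormedAddCommGroup E] [InnerProductSpace ℝ E] [FiniteDimensional ℝ E]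
  [MeasurableSpace E] [BorelSpace E]
  {P V : Type} [NormedAddCommGroup P] [NormedSpace ℝ P] [NormedAddCommGroup V] [NormedSpace ℝ V]

lemma integrable_exp_neg_mul_norm_sq {c : ℝ} (hc : 0 < c) :
    Integrable fun w : E => Real.exp (-(c * ‖w‖ ^ 2)) := by
  have h := (GaussianFourier.integrable_cexp_neg_mul_sq_norm_add (V := E) (b := (c : ℂ))
    (by simpa using hc) 0 0).norm
  refine h.congr (ae_of_all _ fun w => ?_)
  simp only [Complex.norm_exp]
  congr 1
  simp [← Complex.ofReal_pow]

lemma exists_one_add_pow_mul_exp_le {c : ℝ} (hc : 0 < c) (k : ℕ) :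
    ∃ C : ℝ, ∀ r : ℝ, 0 ≤ r → (1 + r) ^ k * Real.exp (-(c * r ^ 2)) ≤ C := by
  -- From `x ^ k ≤ k! exp x` at `x = 1 + r` and `r - c r² ≤ 1 / (4 c)`, by completing the square.
  refine ⟨k.factorial * Real.exp (1 + 1 / (4 * c)), fun r hr => ?_⟩
  have h1 := Real.pow_div_factorial_le_exp (1 + r) (by linarith) k
  rw [div_le_iff₀ (by positivity)] at h1
  calc (1 + r) ^ k * Real.exp (-(c * r ^ 2))
      ≤ Real.exp (1 + r) * k.factorial * Real.exp (-(c * r ^ 2)) := by gcongr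
    _ = k.factorial * Real.exp (1 + r - c * r ^ 2) := by
        rw [mul_comm (Real.exp _), mul_assoc, ← Real.exp_add]; ring_nf
    _ ≤ _ := by
        gcongr 2
        have : r - c * r ^ 2 = 1 / (4 * c) - c * (r - 1 / (2 * c)) ^ 2 := by field_simp; ring
        have h2 : 0 ≤ c * (r - 1 / (2 * c)) ^ 2 := by positivity
        linarith

lemma integrable_one_add_norm_pow_mul_exp {c : ℝ} (hc : 0 < c) (k : ℕ) :
    Integrable fun w : E => (1 + ‖w‖) ^ k * Real.exp (-(c * ‖w‖ ^ 2)) := by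
  obtain ⟨C, hC⟩ := exists_one_add_pow_mul_exp_le (half_pos hc) k
  refine ((integrable_exp_neg_mul_norm_sq (E := E) (half_pos hc)).const_mul C).mono'
    (Continuous.aestronglyMeasurable (by fun_prop)) (ae_of_all _ fun w => ?_)
  rw [Real.norm_of_nonneg (by positivity)]
  -- One half of the exponent absorbs the polynomial, the other half remains integrable.
  have : Real.exp (-(c * ‖w‖ ^ 2)) =
      Real.exp (-(c / 2 * ‖w‖ ^ 2)) * Real.exp (-(c / 2 * ‖w‖ ^ 2)) := by
    rw [← Real.exp_add]; congr 1; ring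
  rw [this, ← mul_assoc]
  gcongr
  exact hC _ (norm_nonneg _)

/-- The lower bound on `R` is uniform in `p`, so the parameter enters only polynomially while the
Gaussian factor absorbs every power of `w`. This gives smooth dependence of the heat integrals on
their parameters. -/
lemma integrableGrowth_exp_neg_smul {R : P × E → ℝ} {T : P × E → V} (hR : HasTemperateGrowth R)
    (hT : HasTemperateGrowth T) {c : ℝ} (hc : 0 < c) (hRc : ∀ p w, c * ‖w‖ ^ 2 ≤ R (p, w)) :
    IntegrableGrowth volume fun x => Real.exp (-R x) • T x := by
  refine ⟨(contDiff_exp_neg hR).smul hT.1, fun n => ?_⟩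
  obtain ⟨k, C, hC0, hC⟩ := norm_iteratedFDeriv_exp_neg_smul_le hR hT n
  refine ⟨k, fun w => C * ((1 + ‖w‖) ^ k * Real.exp (-(c * ‖w‖ ^ 2))),
    (integrable_one_add_norm_pow_mul_exp hc k).const_mul _, fun p w => (hC (p, w)).trans ?_⟩
  have h1 : 1 + ‖(p, w)‖ ≤ (1 + ‖p‖) * (1 + ‖w‖) := by
    rw [Prod.norm_def]
    have h1 := norm_nonneg p
    have h2 := norm_nonneg w
    have h3 := mul_nonneg h1 h2
    rcases le_total ‖p‖ ‖w‖ with h | h <;> simp only [h, sup_of_le_left, sup_of_le_right] <;>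
      linarith
  calc C * (1 + ‖(p, w)‖) ^ k * Real.exp (-R (p, w))
      ≤ C * ((1 + ‖p‖) * (1 + ‖w‖)) ^ k * Real.exp (-(c * ‖w‖ ^ 2)) := by
        gcongr
        exact hRc p w
    _ = _ := by rw [mul_pow]; ring

lemma integrable_exp_neg_smul {R : E → ℝ} {T : E → V} (hR : HasTemperateGrowth R)
    (hT : HasTemperateGrowth T) {c : ℝ} (hc : 0 < c) (hRc : ∀ w, c * ‖w‖ ^ 2 ≤ R w) :
    Integrable fun w => Real.exp (-R w) • T w := by
  have := integrableGrowth_exp_neg_smul (P := ℝ) (R := fun x => R x.2) (T := fun x => T x.2)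
    (hR.comp (ContinuousLinearMap.snd ℝ ℝ E).hasTemperateGrowth)
    (hT.comp (ContinuousLinearMap.snd ℝ ℝ E).hasTemperateGrowth) hc (fun _ w => hRc w)
  exact this.integrable 0

end Gaussian

/-! ### Difference quotients -/

section Hadamard

variable {E F V : Type} [NormedAddCommGroup E] [NormedSpace ℝ E] [NormedAddCommGroup F]
  [NormedSpace ℝ F] [NormedAddCommGroup V] [NormedSpace ℝ V]

lemma hasTemperateGrowth_fst : HasTemperateGrowth (fun x : E × F => x.1) :=
  (ContinuousLinearMap.fst ℝ E F).hasTemperateGrowth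

lemma hasTemperateGrowth_snd : HasTemperateGrowth (fun x : E × F => x.2) :=
  (ContinuousLinearMap.snd ℝ E F).hasTemperateGrowth

lemma _root_.Function.HasTemperateGrowth.prodMk {X : Type} [NormedAddCommGroup X] [NormedSpace ℝ X]
    {f : X → E} {g : X → F} (hf : HasTemperateGrowth f) (hg : HasTemperateGrowth g) :
    HasTemperateGrowth fun x => (f x, g x) := by
  have h1 := (ContinuousLinearMap.inl ℝ E F).hasTemperateGrowth.comp hf
  have h2 := (ContinuousLinearMap.inr ℝ E F).hasTemperateGrowth.comp hg
  convert h1.add h2 using 1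
  ext x <;> simp

lemma _root_.Function.HasTemperateGrowth.fderiv {a : E → V} (ha : HasTemperateGrowth a) :
    HasTemperateGrowth (fderiv ℝ a) := by
  refine ⟨ha.1.fderiv_right (by simp), fun n => ?_⟩
  obtain ⟨k, C, h⟩ := ha.2 (n + 1)
  exact ⟨k, C, fun x => by rw [norm_iteratedFDeriv_fderiv]; exact h x⟩

/-- The difference quotient `(a (u + s w) - a u) / s`, extended by `D a(u) w` to `s = 0`, as a
function of `((u, s), w)`. -/
noncomputable def hadamard (a : E → V) (x : (E × ℝ) × E) : V :=
  ∫ τ in Icc (0 : ℝ) 1, fderiv ℝ a (x.1.1 + (τ * x.1.2) • x.2) x.2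

/-- The integral formula, unlike the quotient itself, is visibly smooth across `s = 0`. -/
lemma _root_.Function.HasTemperateGrowth.hadamard {a : E → V} (ha : HasTemperateGrowth a) :
    HasTemperateGrowth (hadamard a) := by
  let X := ((E × ℝ) × E) × ℝ
  have h1 : HasTemperateGrowth fun x : X => x.1 := hasTemperateGrowth_fst
  have hτ : HasTemperateGrowth fun x : X => x.2 := hasTemperateGrowth_snd
  have hw : HasTemperateGrowth fun x : X => x.1.2 := hasTemperateGrowth_snd.comp h1
  have h2 : HasTemperateGrowth fun x : X => x.1.1 := hasTemperateGrowth_fst.comp h1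
  have hu : HasTemperateGrowth fun x : X => x.1.1.1 := hasTemperateGrowth_fst.comp h2
  have hs : HasTemperateGrowth fun x : X => x.1.1.2 := hasTemperateGrowth_snd.comp h2
  have h3 : HasTemperateGrowth fun x : X => fderiv ℝ a (x.1.1.1 + (x.2 * x.1.1.2) • x.1.2) :=
    ha.fderiv.comp (hu.add ((hτ.mul hs).smul hw))
  have h4 := (ContinuousLinearMap.id ℝ (E →L[ℝ] V)).bilinear_hasTemperateGrowth h3 hw
  exact h4.integrableGrowth_restrict_Icc.hasTemperateGrowth

lemma hadamard_zero [CompleteSpace V] (a : E → V) (u w : E) :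
    hadamard a ((u, 0), w) = fderiv ℝ a u w := by
  simp [hadamard, integral_const]

lemma smul_hadamard [CompleteSpace V] {a : E → V} (ha : ContDiff ℝ ∞ a) (u w : E) (s : ℝ) :
    s • hadamard a ((u, s), w) = a (u + s • w) - a u := by
  have h1 : ∀ τ ∈ uIcc (0 : ℝ) 1, HasDerivAt (fun τ : ℝ => a (u + (τ * s) • w))
      (s • fderiv ℝ a (u + (τ * s) • w) w) τ := fun τ _ => by
    have h2 := (ha.differentiable (by simp) (u + (τ * s) • w)).hasFDerivAt
    have h3 : HasDerivAt (fun τ : ℝ => u + (τ * s) • w) (s • w) τ := by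
      have := (((hasDerivAt_id τ).mul_const s).smul_const w).const_add u
      simpa using this
    exact (h2.comp_hasDerivAt τ h3).congr_deriv (by simp)
  have hc : Continuous (fderiv ℝ a) := ha.continuous_fderiv (by simp)
  have h5 := intervalIntegral.integral_eq_sub_of_hasDerivAt h1
    (Continuous.intervalIntegrable (by fun_prop) _ _)
  simp only [one_mul, zero_mul, zero_smul, add_zero] at h5
  rw [← h5, intervalIntegral.integral_of_le zero_le_one, integral_smul, hadamard,
    integral_Icc_eq_integral_Ioc]

lemma hadamard_eq_of_ne [CompleteSpace V] {a : E → V} (ha : ContDiff ℝ ∞ a) (u w : E) {s : ℝ}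
    (hs : s ≠ 0) : hadamard a ((u, s), w) = s⁻¹ • (a (u + s • w) - a u) := by
  rw [← smul_hadamard ha, smul_smul, inv_mul_cancel₀ hs, one_smul]

/-- The product `s w` is unchanged and only the division by `s` sees the sign. This symmetry is what
makes the heat integrals even in `s`. -/
lemma hadamard_neg_neg [CompleteSpace V] {a : E → V} (ha : ContDiff ℝ ∞ a) (u w : E) (s : ℝ) :
    hadamard a ((u, -s), -w) = -hadamard a ((u, s), w) := by
  rcases eq_or_ne s 0 with rfl | hs
  · simp [hadamard_zero]
  · rw [hadamard_eq_of_ne ha _ _ hs, hadamard_eq_of_ne ha _ _ (neg_ne_zero.2 hs)]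
    simp [inv_neg, neg_smul]

/-- With `β(s)` the difference quotient, `s β(s) = a(u + s w) - a(u)`. One differentiation gives `s
β' + β = Da(u + s w) w`, and a second one at `s = 0` gives `2 β'(0) = D²a(u)(w, w)`. -/
lemma hasDerivAt_hadamard [CompleteSpace V] {a : E → V} (ha : HasTemperateGrowth a) (u w : E) :
    HasDerivAt (fun s : ℝ => hadamard a ((u, s), w))
      ((2⁻¹ : ℝ) • fderiv ℝ (fderiv ℝ a) u w w) 0 := by
  set β := fun s : ℝ => hadamard a ((u, s), w)
  have hβ : ContDiff ℝ ∞ β := ha.hadamard.1.comp (by fun_prop)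
  have hβd : Differentiable ℝ β := hβ.differentiable (by simp)
  have hβ2 : ContDiff ℝ ∞ (deriv β) := hβ.deriv'
  have h1 : ∀ s, HasDerivAt (fun s : ℝ => s • β s) (s • deriv β s + β s) s := fun s => by
    exact ((hasDerivAt_id s).smul (hβd s).hasDerivAt).congr_deriv (by simp)
  have h2 : ∀ s, HasDerivAt (fun s : ℝ => s • β s) (fderiv ℝ a (u + s • w) w) s := fun s => by
    have e : (fun s : ℝ => s • β s) = fun s => a (u + s • w) - a u :=
      funext fun s => smul_hadamard ha.1 u w s
    rw [e]
    have h3 : HasDerivAt (fun s : ℝ => u + s • w) w s := by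
      simpa using ((hasDerivAt_id s).smul_const w).const_add u
    exact ((ha.1.differentiable (by simp) _).hasFDerivAt.comp_hasDerivAt s h3).sub_const _
  have h4 : (fun s => s • deriv β s + β s) = fun s => fderiv ℝ a (u + s • w) w :=
    funext fun s => (h1 s).unique (h2 s)
  have h5 : HasDerivAt (fun s => s • deriv β s + β s) (deriv β 0 + deriv β 0) 0 := by
    exact (((hasDerivAt_id (0 : ℝ)).smul
      (hβ2.differentiable (by simp) 0).hasDerivAt).add (hβd 0).hasDerivAt).congr_deriv (by simp)
  have h6 : HasDerivAt (fun s : ℝ => fderiv ℝ a (u + s • w) w) (fderiv ℝ (fderiv ℝ a) u w w) 0 := by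
    have h3 : HasDerivAt (fun s : ℝ => u + s • w) w 0 := by
      simpa using ((hasDerivAt_id (0 : ℝ)).smul_const w).const_add u
    have h7 : HasFDerivAt (fderiv ℝ a) (fderiv ℝ (fderiv ℝ a) u) u :=
      (ha.fderiv.1.differentiable (by simp) u).hasFDerivAt
    have h8 : HasDerivAt (fun s : ℝ => fderiv ℝ a (u + s • w)) (fderiv ℝ (fderiv ℝ a) u w) 0 :=
      h7.comp_hasDerivAt_of_eq 0 h3 (by simp)
    exact (h8.clm_apply (hasDerivAt_const 0 w)).congr_deriv (by simp)
  rw [h4] at h5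
  have h8 := h5.unique h6
  have h9 : (2⁻¹ : ℝ) • fderiv ℝ (fderiv ℝ a) u w w = deriv β 0 := by
    rw [← h8, ← two_smul ℝ (deriv β 0), smul_smul]; norm_num
  rw [h9]
  exact (hβd 0).hasDerivAt

/-- A function which is even in `s` and vanishes for `s = 0` is divisible by `s ^ 2`. -/
lemma exists_eq_sq_mul {S : E × ℝ → ℝ} (hS : HasTemperateGrowth S)
    (heven : ∀ u s, S (u, -s) = S (u, s)) (h0 : ∀ u, S (u, 0) = 0) :
    ∃ G : E × ℝ → ℝ, HasTemperateGrowth G ∧ (∀ u s, S (u, s) = s ^ 2 * G (u, s)) ∧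
      ∀ u s, G (u, -s) = G (u, s) := by
  have key : ∀ {S : E × ℝ → ℝ}, HasTemperateGrowth S → (∀ u, S (u, 0) = 0) →
      ∃ G : E × ℝ → ℝ, HasTemperateGrowth G ∧ ∀ u s, S (u, s) = s * G (u, s) := by
    intro S hS h0
    -- `S(u, s) / s` is the difference quotient of `S` at `(u, 0)` in the direction `(0, 1)`.
    refine ⟨fun x => hadamard S (((x.1, 0), x.2), (0, 1)), ?_, fun u s => ?_⟩
    · refine hS.hadamard.comp (HasTemperateGrowth.prodMk (HasTemperateGrowth.prodMk
        (HasTemperateGrowth.prodMk hasTemperateGrowth_fst (.const 0)) hasTemperateGrowth_snd)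
        (.const _))
    · have := smul_hadamard hS.1 (u, 0) (0, 1) s
      simp [h0] at this
      exact this.symm
  obtain ⟨G₁, hG₁, hS₁⟩ := key hS h0
  have dense : ∀ {f g : ℝ → ℝ}, Continuous f → Continuous g → (∀ s ≠ 0, f s = g s) → f = g :=
    fun hf hg h => hf.ext_on (dense_compl_singleton (0 : ℝ)) hg fun s hs => h s hs
  -- The quotient of an even function by `s` is odd, first for `s ≠ 0` and then by density. Being
  -- odd, it vanishes at `s = 0`, which permits the second division.
  have hodd : ∀ u s, G₁ (u, -s) = -G₁ (u, s) := fun u s => by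
    have hc := hG₁.1.continuous
    refine congrFun (dense (f := fun s => G₁ (u, -s)) (g := fun s => -G₁ (u, s))
      (by fun_prop) (by fun_prop) fun s hs => ?_) s
    have h1 := heven u s
    rw [hS₁, hS₁] at h1
    refine mul_left_cancel₀ hs ?_
    linarith
  have hG0 : ∀ u, G₁ (u, 0) = 0 := fun u => by
    have := hodd u 0
    rw [neg_zero] at this
    linarith
  obtain ⟨G, hG, hG₂⟩ := key hG₁ hG0
  refine ⟨G, hG, fun u s => by rw [hS₁, hG₂]; ring, fun u s => ?_⟩
  have hc := hG.1.continuous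
  refine congrFun (dense (f := fun s => G (u, -s)) (g := fun s => G (u, s))
    (by fun_prop) (by fun_prop) fun s hs => ?_) s
  have h1 := hodd u s
  rw [hG₂, hG₂] at h1
  refine mul_left_cancel₀ hs ?_
  linarith

end Hadamard

/-! ### The heat-type integrals in a parametrized neighbourhood -/

section LocalHeat

variable {E V : Type} [NormedAddCommGroup E] [InnerProductSpace ℝ E] [FiniteDimensional ℝ E]
  [MeasurableSpace E] [BorelSpace E]
  [NormedAddCommGroup V] [InnerProductSpace ℝ V] [CompleteSpace V]

/-- `‖Ψ (u + s w) - Ψ u‖² / (2 s²)`, as a smooth function of `((u, s), w)`. -/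
noncomputable def phase (Ψ : E → V) (x : (E × ℝ) × E) : ℝ := 2⁻¹ * ‖hadamard Ψ x‖ ^ 2

/-- The integral `∫ f (u + s w) exp (-‖Ψ (u + s w) - Ψ u‖² / (2 s²)) dw`, as a function of
`(u, s)`. -/
noncomputable def localHeat (Ψ : E → V) (f : E → ℝ) (p : E × ℝ) : ℝ :=
  ∫ w, Real.exp (-phase Ψ (p, w)) • f (p.1 + p.2 • w)

omit [FiniteDimensional ℝ E] [MeasurableSpace E] [BorelSpace E] [CompleteSpace V] in
lemma hasTemperateGrowth_phase {Ψ : E → V} (hΨ : HasTemperateGrowth Ψ) :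
    HasTemperateGrowth (phase Ψ) :=
  (HasTemperateGrowth.const _).mul ((hasTemperateGrowth_norm_sq V).comp hΨ.hadamard)

variable {Ψ : E → V} (hΨ : HasTemperateGrowth Ψ) {c : ℝ} (hc : 0 < c)
  (hcΨ : ∀ u v, c * ‖v - u‖ ≤ ‖Ψ v - Ψ u‖) {f : E → ℝ} (hf : HasTemperateGrowth f)

include hΨ hc hcΨ

-- For `s ≠ 0` this is the lower Lipschitz bound divided by `|s|`; it persists at `s = 0` because it
-- is a closed condition.
omit [FiniteDimensional ℝ E] [MeasurableSpace E] [BorelSpace E] hc in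
lemma mul_norm_le_norm_hadamard (p : E × ℝ) (w : E) : c * ‖w‖ ≤ ‖hadamard Ψ (p, w)‖ := by
  obtain ⟨u, s⟩ := p
  have hcont : Continuous fun s : ℝ => ‖hadamard Ψ ((u, s), w)‖ :=
    (hΨ.hadamard.1.continuous.comp (by fun_prop)).norm
  have hcl : IsClosed {s : ℝ | c * ‖w‖ ≤ ‖hadamard Ψ ((u, s), w)‖} :=
    isClosed_le continuous_const hcont
  have hsub : ({0}ᶜ : Set ℝ) ⊆ {s : ℝ | c * ‖w‖ ≤ ‖hadamard Ψ ((u, s), w)‖} := fun s hs => by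
    have hs : s ≠ 0 := hs
    show c * ‖w‖ ≤ _
    rw [hadamard_eq_of_ne hΨ.1 u w hs, norm_smul]
    have := hcΨ u (u + s • w)
    rw [add_sub_cancel_left, norm_smul] at this
    rw [norm_inv, ← div_eq_inv_mul, le_div_iff₀ (norm_pos_iff.2 hs)]
    linarith
  have := hcl.closure_subset_iff.2 hsub
  rw [(dense_compl_singleton (0 : ℝ)).closure_eq] at this
  exact this (mem_univ s)

omit [FiniteDimensional ℝ E] [MeasurableSpace E] [BorelSpace E] in
lemma mul_norm_sq_le_phase (p : E × ℝ) (w : E) : 2⁻¹ * c ^ 2 * ‖w‖ ^ 2 ≤ phase Ψ (p, w) := by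
  have := mul_norm_le_norm_hadamard hΨ hcΨ p w
  rw [phase, mul_assoc, ← mul_pow]
  gcongr

include hf

/-- The phase is bounded below by a multiple of `‖w‖²` uniformly in `(u, s)`, including `s = 0`, so
differentiation under the integral is legitimate there too. -/
lemma hasTemperateGrowth_localHeat : HasTemperateGrowth (localHeat Ψ f) := by
  have h1 : HasTemperateGrowth fun x : (E × ℝ) × E => f (x.1.1 + x.1.2 • x.2) :=
    hf.comp ((hasTemperateGrowth_fst.comp hasTemperateGrowth_fst).add
      ((hasTemperateGrowth_snd.comp hasTemperateGrowth_fst).smul hasTemperateGrowth_snd))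
  exact (integrableGrowth_exp_neg_smul (hasTemperateGrowth_phase hΨ) h1
    (c := 2⁻¹ * c ^ 2) (by positivity) (mul_norm_sq_le_phase hΨ hc hcΨ)).hasTemperateGrowth

omit hc hcΨ hf [FiniteDimensional ℝ E] [MeasurableSpace E] [BorelSpace E] in
lemma phase_neg_neg (u w : E) (s : ℝ) : phase Ψ ((u, -s), -w) = phase Ψ ((u, s), w) := by
  rw [phase, hadamard_neg_neg hΨ.1, norm_neg, phase]

-- Substitute `w ↦ -w`. Evenness removes the odd powers of `√t` from all expansions.
omit hc hcΨ hf in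
lemma localHeat_neg (u : E) (s : ℝ) : localHeat Ψ f (u, -s) = localHeat Ψ f (u, s) := by
  rw [localHeat, ← integral_neg_eq_self]
  simp [phase_neg_neg hΨ, localHeat]

omit hΨ hc hcΨ hf in
lemma localHeat_zero (u : E) : localHeat Ψ f (u, 0) =
    f u * ∫ w, Real.exp (-(2⁻¹ * ‖fderiv ℝ Ψ u w‖ ^ 2)) := by
  simp only [localHeat, phase, hadamard_zero, zero_smul, add_zero, smul_eq_mul]
  rw [integral_mul_const, mul_comm]

-- The substitution `v = u + s w`, whose Jacobian is the power of `s`.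
omit hc hcΨ hf in
lemma integral_eq_localHeat (u : E) {s : ℝ} (hs : 0 < s) :
    ∫ v, f v * Real.exp (-‖Ψ v - Ψ u‖ ^ 2 / (2 * s ^ 2)) =
      s ^ Module.finrank ℝ E * localHeat Ψ f (u, s) := by
  set g := fun v => f v * Real.exp (-‖Ψ v - Ψ u‖ ^ 2 / (2 * s ^ 2))
  have h1 : ∫ v, g v = ∫ v, g (u + v) := (integral_add_left_eq_self g u).symm
  have h2 := Measure.integral_comp_smul volume (fun v => g (u + v)) s
  rw [h1]
  have h3 : localHeat Ψ f (u, s) = ∫ w, g (u + s • w) := by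
    rw [localHeat]
    refine integral_congr_ae (ae_of_all _ fun w => ?_)
    simp only [g, phase, smul_eq_mul]
    rw [hadamard_eq_of_ne hΨ.1 u w hs.ne', norm_smul, mul_pow, mul_comm]
    congr 3
    rw [norm_inv, Real.norm_of_nonneg hs.le]
    field_simp
  rw [h3, h2, abs_of_pos (by positivity), smul_eq_mul, ← mul_assoc,
    mul_inv_cancel₀ (by positivity), one_mul]

omit hf in
/-- The coefficient of `s²` in the expansion of `localHeat` for a function vanishing at `u`. -/
lemma tendsto_localHeat_div_sq {m : E → ℝ} (hm : HasTemperateGrowth m) {u : E} (hmu : m u = 0) :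
    Tendsto (fun s : ℝ => localHeat Ψ m (u, s) / s ^ 2) (𝓝[≠] 0)
      (𝓝 (∫ w, Real.exp (-(2⁻¹ * ‖fderiv ℝ Ψ u w‖ ^ 2)) *
        (2⁻¹ * fderiv ℝ (fderiv ℝ m) u w w - fderiv ℝ m u w *
          (2⁻¹ * inner ℝ (fderiv ℝ Ψ u w) (fderiv ℝ (fderiv ℝ Ψ) u w w))))) := by
  have hemb : HasTemperateGrowth fun x : ℝ × E => ((u, x.1), x.2) :=
    ((HasTemperateGrowth.const u).prodMk hasTemperateGrowth_fst).prodMk hasTemperateGrowth_snd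
  set R : ℝ × E → ℝ := fun x => phase Ψ ((u, x.1), x.2)
  set T : ℝ × E → ℝ := fun x => hadamard m ((u, x.1), x.2)
  have hR : HasTemperateGrowth R := (hasTemperateGrowth_phase hΨ).comp hemb
  have hT : HasTemperateGrowth T := hm.hadamard.comp hemb
  have hI := integrableGrowth_exp_neg_smul hR hT (c := 2⁻¹ * c ^ 2) (by positivity)
    (fun s w => mul_norm_sq_le_phase hΨ hc hcΨ (u, s) w)
  -- Since `m u = 0`, one has `m(u + s w) = s T(s, w)` and `localHeat Ψ m (u, s) = s k(s)`. Moreover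
  -- `k(0) = 0`, its integrand being odd in `w`. So the ratio to `s²` is the slope of `k` at `0`,
  -- and the limit is `k'(0)`, computed under the integral sign.
  set k : ℝ → ℝ := fun s => ∫ w, Real.exp (-R (s, w)) • T (s, w)
  have hk0 : k 0 = 0 := by
    have : k 0 = -k 0 := by
      conv_lhs => rw [show k 0 = ∫ w, Real.exp (-R (0, w)) • T (0, w) from rfl,
        ← integral_neg_eq_self]
      simp only [k, R, T, phase, hadamard_zero, map_neg, norm_neg, smul_neg, integral_neg]
    linarith
  have hk : HasDerivAt k (∫ w, Real.exp (-(2⁻¹ * ‖fderiv ℝ Ψ u w‖ ^ 2)) *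
        (2⁻¹ * fderiv ℝ (fderiv ℝ m) u w w - fderiv ℝ m u w *
          (2⁻¹ * inner ℝ (fderiv ℝ Ψ u w) (fderiv ℝ (fderiv ℝ Ψ) u w w)))) 0 := by
    have h1 := (hI.hasFDerivAt 0).hasDerivAt
    refine h1.congr_deriv ?_
    rw [ContinuousLinearMap.integral_apply (hI.fderivFst.integrable 0)]
    refine integral_congr_ae (ae_of_all _ fun w => ?_)
    have h2 : HasDerivAt (fun s : ℝ => Real.exp (-R (s, w)) • T (s, w))
        (fderivFst (fun x => Real.exp (-R x) • T x) (0, w) 1) 0 := by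
      have h3 := (hI.1.differentiable (by simp) ((0 : ℝ), w)).hasFDerivAt
      exact (h3.comp (0 : ℝ) (hasFDerivAt_prodMk_left (0 : ℝ) w)).hasDerivAt
    have h4 : HasDerivAt (fun s : ℝ => R (s, w))
        (2⁻¹ * inner ℝ (fderiv ℝ Ψ u w) (fderiv ℝ (fderiv ℝ Ψ) u w w)) 0 := by
      have h5 := ((hasDerivAt_hadamard hΨ u w).norm_sq).const_mul (2⁻¹ : ℝ)
      rw [hadamard_zero, inner_smul_right, ← mul_assoc 2, mul_inv_cancel₀ two_ne_zero, one_mul] at h5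
      exact h5
    have h6 : HasDerivAt (fun s : ℝ => T (s, w)) (2⁻¹ * fderiv ℝ (fderiv ℝ m) u w w) 0 :=
      hasDerivAt_hadamard hm u w
    have h8 := h2.unique (h4.neg.exp.mul h6)
    simp only [Pi.neg_apply, R, T, phase, hadamard_zero] at h8 ⊢
    rw [h8]
    ring
  have h9 := hasDerivAt_iff_tendsto_slope.1 hk
  refine h9.congr' (eventually_nhdsWithin_of_forall fun s hs => ?_)
  have hs : s ≠ 0 := hs
  rw [slope_def_field, hk0, sub_zero, sub_zero]
  have : localHeat Ψ m (u, s) = s * k s := by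
    simp only [localHeat, k]
    rw [← integral_const_mul]
    refine integral_congr_ae (ae_of_all _ fun w => ?_)
    have := smul_hadamard hm.1 u w s
    rw [hmu, sub_zero] at this
    simp only [← this, R, T, smul_eq_mul]
    ring
  simp only [this]
  field_simp

end LocalHeat

/-! ### Gaussian integrals -/

section GaussianMoments

variable {d : ℕ} {V : Type} [NormedAddCommGroup V] [InnerProductSpace ℝ V]
  (A : EuclideanSpace ℝ (Fin d) →L[ℝ] V)

/-- The Gaussian weight `exp (-‖A w‖² / 2)`. -/
noncomputable def gaussWeight (w : EuclideanSpace ℝ (Fin d)) : ℝ :=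
  Real.exp (-(2⁻¹ * ‖A w‖ ^ 2))

/-- The Gram matrix `⟨A e_i, A e_j⟩`. -/
noncomputable def gramMatrix : Matrix (Fin d) (Fin d) ℝ :=
  Matrix.of fun i j =>
    inner ℝ (A (EuclideanSpace.single i 1)) (A (EuclideanSpace.single j 1))

lemma hasTemperateGrowth_coord (i : Fin d) :
    HasTemperateGrowth fun w : EuclideanSpace ℝ (Fin d) => w i :=
  (EuclideanSpace.proj (𝕜 := ℝ) i).hasTemperateGrowth

lemma eq_sum_single (w : EuclideanSpace ℝ (Fin d)) :
    w = ∑ i, w i • EuclideanSpace.single i (1 : ℝ) := by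
  ext j
  simp [Finset.sum_apply, Pi.single_apply]

lemma clm_eq_sum {F : Type} [NormedAddCommGroup F] [NormedSpace ℝ F]
    (T : EuclideanSpace ℝ (Fin d) →L[ℝ] F) (w : EuclideanSpace ℝ (Fin d)) :
    T w = ∑ i, w i • T (EuclideanSpace.single i 1) := by
  conv_lhs => rw [eq_sum_single w]
  simp

lemma hasTemperateGrowth_norm_sq_clm :
    HasTemperateGrowth fun w => 2⁻¹ * ‖A w‖ ^ 2 := by
  have h := (hasTemperateGrowth_norm_sq V).comp A.hasTemperateGrowth
  exact (HasTemperateGrowth.const _).mul h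

variable {A} {c : ℝ} (hc : 0 < c) (hA : ∀ w, c * ‖w‖ ≤ ‖A w‖)

include hc hA

lemma integrable_gaussWeight_mul {T : EuclideanSpace ℝ (Fin d) → ℝ} (hT : HasTemperateGrowth T) :
    Integrable fun w => gaussWeight A w * T w := by
  refine integrable_exp_neg_smul (hasTemperateGrowth_norm_sq_clm A) hT
    (c := 2⁻¹ * c ^ 2) (by positivity) fun w => ?_
  rw [mul_assoc, ← mul_pow]
  gcongr
  exact hA w

lemma integral_gaussWeight_pos : 0 < ∫ w, gaussWeight A w := by
  have h := integrable_gaussWeight_mul hc hA (.const 1)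
  simp only [mul_one] at h
  rw [integral_pos_iff_support_of_nonneg (f := gaussWeight A) (fun w => (Real.exp_pos _).le) h]
  have : support (gaussWeight A) = univ := by
    ext w
    simp [gaussWeight]
  rw [this]
  exact isOpen_univ.measure_pos _ univ_nonempty

/-- Integration by parts: the derivative of the weight in the direction `v` is `-⟨A v, A w⟩` times
the weight. -/
lemma integral_gaussWeight_mul_inner {T : EuclideanSpace ℝ (Fin d) → ℝ}
    (hT : HasTemperateGrowth T) (v : EuclideanSpace ℝ (Fin d)) :
    ∫ w, gaussWeight A w * (inner ℝ (A v) (A w) * T w) =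
      ∫ w, gaussWeight A w * fderiv ℝ T w v := by
  have hd : ∀ w, HasFDerivAt (gaussWeight A)
      (gaussWeight A w • -((2⁻¹ : ℝ) • ((2 : ℕ) • (innerSL ℝ (A w)).comp A) :
        EuclideanSpace ℝ (Fin d) →L[ℝ] ℝ)) w := fun w => by
    have h2 := ((A.hasFDerivAt (x := w)).norm_sq.const_mul (2⁻¹ : ℝ)).neg.exp
    exact h2
  have hd' : ∀ w, fderiv ℝ (gaussWeight A) w v = -(gaussWeight A w * inner ℝ (A v) (A w)) :=
    fun w => by
      rw [(hd w).fderiv]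
      simp [real_inner_comm]
  have hin : HasTemperateGrowth fun w => inner ℝ (A v) (A w) :=
    ((innerSL ℝ (A v)).comp A).hasTemperateGrowth
  have hTd : Differentiable ℝ T := hT.1.differentiable (by simp)
  have h := integral_mul_fderiv_eq_neg_fderiv_mul_of_integrable (μ := volume) (f := T)
    (g := gaussWeight A) (v := v) ?_ ?_ ?_ (fun w _ => hTd w) (fun w _ => (hd w).differentiableAt)
  · simp only [hd', mul_neg, integral_neg, neg_inj] at h
    calc _ = ∫ w, T w * (gaussWeight A w * inner ℝ (A v) (A w)) := by
          congr 1; ext w; ring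
      _ = _ := by rw [h]; congr 1; ext w; ring
  · have := integrable_gaussWeight_mul hc hA
      (T := fun w => fderiv ℝ T w v)
      ((ContinuousLinearMap.apply ℝ ℝ v).hasTemperateGrowth.comp hT.fderiv)
    exact this.congr (ae_of_all _ fun w => by ring)
  · have := integrable_gaussWeight_mul hc hA (hin.mul hT).neg
    refine this.congr (ae_of_all _ fun w => ?_)
    simp only [hd', Pi.neg_apply, Pi.mul_apply]
    ring
  · exact (integrable_gaussWeight_mul hc hA hT).congr (ae_of_all _ fun w => by ring)

/-- Integrating by parts with `T = w_j` and `v = e_k` shows that the Gram matrix times the matrix of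
second moments is the total mass times the identity. -/
lemma integral_gaussWeight_mul_coord_mul_coord (i j : Fin d) :
    ∫ w, gaussWeight A w * (w i * w j) = (gramMatrix A)⁻¹ i j * ∫ w, gaussWeight A w := by
  set Z := ∫ w, gaussWeight A w
  set S : Matrix (Fin d) (Fin d) ℝ := Matrix.of fun i j => ∫ w, gaussWeight A w * (w i * w j)
  have hS : gramMatrix A * S = Z • 1 := by
    ext k j
    have h1 := integral_gaussWeight_mul_inner hc hA (hasTemperateGrowth_coord j)
      (EuclideanSpace.single k 1)
    have h2 : ∀ w, fderiv ℝ (fun w : EuclideanSpace ℝ (Fin d) => w j) w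
        (EuclideanSpace.single k 1) = (1 : Matrix (Fin d) (Fin d) ℝ) k j := fun w => by
      have : fderiv ℝ (fun w : EuclideanSpace ℝ (Fin d) => w j) w =
          EuclideanSpace.proj (𝕜 := ℝ) j :=
        (EuclideanSpace.proj (𝕜 := ℝ) j).hasFDerivAt.fderiv
      rw [this]
      simp [Matrix.one_apply, eq_comm]
    simp only [h2, integral_mul_const] at h1
    rw [Matrix.smul_apply, smul_eq_mul, ← h1, Matrix.mul_apply]
    simp only [S, Matrix.of_apply, gramMatrix, ← integral_const_mul]
    rw [← integral_finsetSum]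
    · congr 1; ext w
      conv_rhs => rw [clm_eq_sum A w, inner_sum]
      simp only [inner_smul_right, Finset.sum_mul, Finset.mul_sum]
      exact Finset.sum_congr rfl fun l _ => by ring
    · intro l _
      exact (integrable_gaussWeight_mul hc hA
        ((hasTemperateGrowth_coord l).mul (hasTemperateGrowth_coord j))).const_mul _
  have hZ : Z ≠ 0 := (integral_gaussWeight_pos hc hA).ne'
  have h3 : (gramMatrix A)⁻¹ = Z⁻¹ • S := by
    refine Matrix.inv_eq_right_inv ?_
    rw [Matrix.mul_smul, hS, smul_smul, inv_mul_cancel₀ hZ, one_smul]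
  rw [h3]
  simp only [Matrix.smul_apply, S, Matrix.of_apply, smul_eq_mul]
  field_simp

lemma isUnit_det_gramMatrix : IsUnit (gramMatrix A).det := by
  rw [isUnit_iff_ne_zero]
  intro h0
  obtain ⟨v, hv, hv0⟩ := Matrix.exists_mulVec_eq_zero_iff.2 h0
  set w : EuclideanSpace ℝ (Fin d) := WithLp.toLp 2 v
  have h1 : ‖A w‖ ^ 2 = v ⬝ᵥ gramMatrix A *ᵥ v := by
    rw [← real_inner_self_eq_norm_sq]
    conv_lhs => rw [clm_eq_sum A w]
    simp only [sum_inner, inner_sum, inner_smul_left, inner_smul_right, dotProduct,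
      Matrix.mulVec, gramMatrix, Matrix.of_apply, Finset.mul_sum]
    refine Finset.sum_congr rfl fun i _ => Finset.sum_congr rfl fun j _ => ?_
    rw [real_inner_comm]
    simp [w, mul_comm]
  rw [hv0, dotProduct_zero] at h1
  have h2 : ‖A w‖ = 0 := by simpa using h1
  have h3 := hA w
  rw [h2] at h3
  have h4 : ‖w‖ = 0 := by nlinarith [norm_nonneg w]
  have h5 : w = 0 := norm_eq_zero.1 h4
  apply hv
  have := congrArg WithLp.ofLp h5
  simpa [w] using this

/-- The second order coefficient of the heat-type integrals, in coordinates. Here `A` and `B` are the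
first and second derivatives of an immersion, `Γ` its Christoffel symbols, `J` and `β` the volume
density and its derivative, and `α`, `H` the first and second derivatives of a function. -/
lemma integral_gaussWeight_eq_trace
    (B : EuclideanSpace ℝ (Fin d) →L[ℝ] EuclideanSpace ℝ (Fin d) →L[ℝ] V)
    (Γ : Fin d → Fin d → Fin d → ℝ) (hΓ : ∀ k i j, Γ k i j = Γ k j i)
    (hB : ∀ l i j, inner ℝ (A (EuclideanSpace.single l 1))
      (B (EuclideanSpace.single i 1) (EuclideanSpace.single j 1)) =
        ∑ k, gramMatrix A l k * Γ k i j)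
    (J : ℝ) (β : EuclideanSpace ℝ (Fin d) →L[ℝ] ℝ)
    (hβ : ∀ i, β (EuclideanSpace.single i 1) = J * ∑ k, Γ k k i)
    (α : EuclideanSpace ℝ (Fin d) →L[ℝ] ℝ)
    (H : EuclideanSpace ℝ (Fin d) →L[ℝ] EuclideanSpace ℝ (Fin d) →L[ℝ] ℝ) :
    ∫ w, gaussWeight A w * (2⁻¹ * (J * H w w + 2 * (β w * α w)) -
        J * α w * (2⁻¹ * inner ℝ (A w) (B w w))) =
      2⁻¹ * J * (∑ i, ∑ j, (gramMatrix A)⁻¹ i j * (H (EuclideanSpace.single i 1)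
        (EuclideanSpace.single j 1) - ∑ k, Γ k i j * α (EuclideanSpace.single k 1))) *
        ∫ w, gaussWeight A w := by
  set e : Fin d → EuclideanSpace ℝ (Fin d) := fun i => EuclideanSpace.single i 1
  set γ : Fin d → EuclideanSpace ℝ (Fin d) → ℝ := fun k w => ∑ i, ∑ j, Γ k i j * (w i * w j)
  have hγt : ∀ k, HasTemperateGrowth (γ k) := fun k =>
    HasTemperateGrowth.sum fun i _ => HasTemperateGrowth.sum fun j _ =>
      (HasTemperateGrowth.const _).mul ((hasTemperateGrowth_coord i).mul (hasTemperateGrowth_coord j))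
  have hαt : HasTemperateGrowth α := α.hasTemperateGrowth
  have hγd : ∀ k w v, fderiv ℝ (γ k) w v = ∑ i, ∑ j, Γ k i j * (w i * v j + w j * v i) := by
    intro k w v
    have hp : ∀ i : Fin d, HasFDerivAt (fun w : EuclideanSpace ℝ (Fin d) => w i)
        (EuclideanSpace.proj (𝕜 := ℝ) i) w := fun i =>
      (EuclideanSpace.proj (𝕜 := ℝ) i).hasFDerivAt
    have h : HasFDerivAt (γ k) (∑ i, ∑ j, Γ k i j • (w i • EuclideanSpace.proj (𝕜 := ℝ) j +
        w j • EuclideanSpace.proj (𝕜 := ℝ) i)) w :=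
      HasFDerivAt.fun_sum fun i _ => HasFDerivAt.fun_sum fun j _ =>
        ((hp i).mul (hp j)).const_mul (Γ k i j)
    rw [h.fderiv]
    simp [mul_add]
  have hprod : ∀ w k, fderiv ℝ (fun w => α w * γ k w) w (e k) =
      α (e k) * γ k w + α w * ∑ i, (Γ k i k * w i + Γ k k i * w i) := by
    intro w k
    have h := α.hasFDerivAt.mul ((hγt k).1.differentiable (by simp) w).hasFDerivAt
    rw [show fderiv ℝ (fun w => α w * γ k w) w = _ from HasFDerivAt.fderiv h]
    simp only [_root_.add_apply, _root_.smul_apply, hγd, smul_eq_mul]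
    have : ∑ i, ∑ j, Γ k i j * (w i * e k j + w j * e k i) =
        ∑ i, (Γ k i k * w i + Γ k k i * w i) := by
      simp only [mul_add, Finset.sum_add_distrib]
      congr 1
      · refine Finset.sum_congr rfl fun i _ => ?_
        simp [e]
      · rw [Finset.sum_comm]
        refine Finset.sum_congr rfl fun i _ => ?_
        simp [e]
    rw [this]
    ring
  -- Expressing `B w w` through Christoffel symbols writes the quartic term as a sum of factors `⟨A
  -- e_k, A w⟩`, ready for integration by parts.
  have hinner : ∀ w, inner ℝ (A w) (B w w) = ∑ k, inner ℝ (A (e k)) (A w) * γ k w := by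
    intro w
    have hBw : ∀ l, inner ℝ (A (e l)) (B w w) = ∑ k, gramMatrix A l k * γ k w := by
      intro l
      have : B w w = ∑ i, ∑ j, (w i * w j) • B (e i) (e j) := by
        rw [clm_eq_sum B w, _root_.sum_apply]
        refine Finset.sum_congr rfl fun i _ => ?_
        rw [_root_.smul_apply, clm_eq_sum (B _) w, Finset.smul_sum]
        simp [smul_smul, e]
      rw [this]
      simp only [inner_sum, inner_smul_right]
      simp only [e, hB, γ, Finset.mul_sum]
      rw [Finset.sum_comm' (t' := Finset.univ) (s' := fun _ => Finset.univ) (by simp)]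
      rw [Finset.sum_congr rfl fun j _ => Finset.sum_comm]
      rw [Finset.sum_comm]
      refine Finset.sum_congr rfl fun k _ => ?_
      rw [Finset.sum_comm]
      refine Finset.sum_congr rfl fun i _ => Finset.sum_congr rfl fun j _ => by ring
    conv_lhs => rw [clm_eq_sum A w]
    simp only [sum_inner, inner_smul_left]
    simp only [show ∀ l, EuclideanSpace.single l (1 : ℝ) = e l from fun l => rfl, hBw]
    conv_rhs => enter [2, k]; rw [clm_eq_sum A w, inner_sum, Finset.sum_mul]
    rw [Finset.sum_comm]
    refine Finset.sum_congr rfl fun l _ => ?_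
    rw [Finset.mul_sum]
    refine Finset.sum_congr rfl fun k _ => ?_
    simp only [inner_smul_right, gramMatrix, Matrix.of_apply, real_inner_comm, e]
    simp
    ring
  have hin : ∀ k, HasTemperateGrowth fun w => inner ℝ (A (e k)) (A w) := fun k =>
    ((innerSL ℝ (A (e k))).comp A).hasTemperateGrowth
  -- integration by parts of the cubic-times-linear term
  have hibp : ∫ w, gaussWeight A w * (α w * inner ℝ (A w) (B w w)) =
      ∫ w, gaussWeight A w * (∑ k, (α (e k) * γ k w + α w * ∑ i, (Γ k i k * w i + Γ k k i * w i))) := by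
    have h1 : ∀ w, gaussWeight A w * (α w * inner ℝ (A w) (B w w)) =
        ∑ k, gaussWeight A w * (inner ℝ (A (e k)) (A w) * (α w * γ k w)) := fun w => by
      rw [hinner, Finset.mul_sum, Finset.mul_sum]
      exact Finset.sum_congr rfl fun k _ => by ring
    have h2 : ∀ w, gaussWeight A w * (∑ k, (α (e k) * γ k w +
        α w * ∑ i, (Γ k i k * w i + Γ k k i * w i))) =
        ∑ k, gaussWeight A w * fderiv ℝ (fun w => α w * γ k w) w (e k) := fun w => by
      rw [Finset.mul_sum]
      exact Finset.sum_congr rfl fun k _ => by rw [hprod]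
    simp only [h1, h2]
    rw [integral_finsetSum, integral_finsetSum]
    · exact Finset.sum_congr rfl fun k _ =>
        integral_gaussWeight_mul_inner hc hA (hαt.mul (hγt k)) (e k)
    · intro k _
      exact integrable_gaussWeight_mul hc hA
        ((ContinuousLinearMap.apply ℝ ℝ (e k)).hasTemperateGrowth.comp (hαt.mul (hγt k)).fderiv)
    · intro k _
      exact integrable_gaussWeight_mul hc hA ((hin k).mul (hαt.mul (hγt k)))
  -- The right-hand sum is the divergence of the vector field `γ`. Hence the term `β α` from the
  -- volume density cancels the divergence term left by the integration by parts, and only `H(w, w)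
  -- - α(γ(w))` survives.
  have hβw : ∀ w, 2 * β w = J * ∑ k, ∑ i, (Γ k i k * w i + Γ k k i * w i) := by
    intro w
    rw [clm_eq_sum β w]
    simp only [hβ, smul_eq_mul]
    rw [Finset.sum_comm, Finset.mul_sum, Finset.mul_sum]
    refine Finset.sum_congr rfl fun i _ => ?_
    rw [Finset.mul_sum, Finset.mul_sum, Finset.mul_sum, Finset.mul_sum]
    refine Finset.sum_congr rfl fun k _ => ?_
    rw [hΓ k i k]
    ring
  have hHt : HasTemperateGrowth fun w => H w w := H.bilinear_hasTemperateGrowth .id' .id'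
  have hBt : HasTemperateGrowth fun w => inner ℝ (A w) (B w w) := by
    simp only [hinner]
    exact HasTemperateGrowth.sum fun k _ => (hin k).mul (hγt k)
  have hβt : HasTemperateGrowth β := β.hasTemperateGrowth
  have hHw : ∀ w, H w w = ∑ i, ∑ j, H (e i) (e j) * (w i * w j) := by
    intro w
    rw [clm_eq_sum H w, _root_.sum_apply]
    refine Finset.sum_congr rfl fun i _ => ?_
    rw [_root_.smul_apply, clm_eq_sum (H _) w, Finset.smul_sum]
    refine Finset.sum_congr rfl fun j _ => ?_
    simp only [smul_eq_mul, e]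
    ring
  have hquad : ∀ w, H w w - ∑ k, α (e k) * γ k w =
      ∑ i, ∑ j, (H (e i) (e j) - ∑ k, Γ k i j * α (e k)) * (w i * w j) := by
    intro w
    rw [hHw]
    simp only [sub_mul, Finset.sum_sub_distrib, γ, Finset.sum_mul, Finset.mul_sum]
    congr 1
    rw [Finset.sum_comm]
    refine Finset.sum_congr rfl fun i _ => ?_
    rw [Finset.sum_comm]
    refine Finset.sum_congr rfl fun j _ => Finset.sum_congr rfl fun k _ => by ring
  have hquadt : HasTemperateGrowth fun w => H w w - ∑ k, α (e k) * γ k w :=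
    hHt.sub (HasTemperateGrowth.sum fun k _ => (HasTemperateGrowth.const _).mul (hγt k))
  calc _ = ∫ w, (gaussWeight A w * (2⁻¹ * (J * H w w + 2 * (β w * α w))) -
        2⁻¹ * J * (gaussWeight A w * (α w * inner ℝ (A w) (B w w)))) := by
        congr 1; ext w; ring
    _ = (∫ w, gaussWeight A w * (2⁻¹ * (J * H w w + 2 * (β w * α w)))) -
        2⁻¹ * J * ∫ w, gaussWeight A w * (∑ k, (α (e k) * γ k w +
          α w * ∑ i, (Γ k i k * w i + Γ k k i * w i))) := by
        rw [integral_sub, integral_const_mul, hibp]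
        · exact integrable_gaussWeight_mul hc hA ((HasTemperateGrowth.const _).mul
            (((HasTemperateGrowth.const _).mul hHt).add
              ((HasTemperateGrowth.const _).mul (hβt.mul hαt))))
        · exact (integrable_gaussWeight_mul hc hA (hαt.mul hBt)).const_mul _
    _ = ∫ w, 2⁻¹ * J * (gaussWeight A w * (H w w - ∑ k, α (e k) * γ k w)) := by
        rw [← integral_const_mul, ← integral_sub]
        · congr 1; ext w
          rw [Finset.sum_add_distrib, ← Finset.mul_sum]
          linear_combination gaussWeight A w * 2⁻¹ * α w * hβw w
        · exact integrable_gaussWeight_mul hc hA ((HasTemperateGrowth.const _).mul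
            (((HasTemperateGrowth.const _).mul hHt).add
              ((HasTemperateGrowth.const _).mul (hβt.mul hαt))))
        · refine (integrable_gaussWeight_mul hc hA (HasTemperateGrowth.sum fun k _ =>
            ((HasTemperateGrowth.const _).mul (hγt k)).add (hαt.mul
              (HasTemperateGrowth.sum fun i _ =>
                ((HasTemperateGrowth.const _).mul (hasTemperateGrowth_coord i)).add
                ((HasTemperateGrowth.const _).mul (hasTemperateGrowth_coord i)))))).const_mul _
    _ = _ := by
        rw [integral_const_mul, mul_assoc (2⁻¹ * J)]
        congr 1
        simp only [hquad, Finset.mul_sum, Finset.sum_mul]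
        have hint : ∀ i j, Integrable fun w => gaussWeight A w *
            ((H (e i) (e j) - ∑ k, Γ k i j * α (e k)) * (w i * w j)) := fun i j =>
          integrable_gaussWeight_mul hc hA ((HasTemperateGrowth.const _).mul
            ((hasTemperateGrowth_coord i).mul (hasTemperateGrowth_coord j)))
        rw [integral_finsetSum _ fun i _ => integrable_finsetSum _ fun j _ => hint i j]
        refine Finset.sum_congr rfl fun i _ => ?_
        rw [integral_finsetSum _ fun j _ => hint i j]
        refine Finset.sum_congr rfl fun j _ => ?_
        have hcomm : ∀ w, gaussWeight A w *
            ((H (e i) (e j) - ∑ k, Γ k i j * α (e k)) * (w i * w j)) =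
            (H (e i) (e j) - ∑ k, Γ k i j * α (e k)) * (gaussWeight A w * (w i * w j)) :=
          fun w => by ring
        simp only [hcomm]
        rw [integral_const_mul, integral_gaussWeight_mul_coord_mul_coord hc hA]
        ring

end GaussianMoments

/-! ### Extending a local immersion -/

/-- An immersion defined near `u₀` agrees near `u₀` with a global map of temperate growth which is
bi-Lipschitz from below. -/
lemma exists_extension_of_immersion {E V : Type} [NormedAddCommGroup E] [InnerProductSpace ℝ E]
    [FiniteDimensional ℝ E] [NormedAddCommGroup V] [NormedSpace ℝ V] {Φ : E → V} {u₀ : E}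
    (hΦ : ∀ᶠ u in 𝓝 u₀, ContDiffAt ℝ ∞ Φ u) (hinj : Injective (fderiv ℝ Φ u₀)) :
    ∃ (Ψ : E → V) (c : ℝ), HasTemperateGrowth Ψ ∧ 0 < c ∧
      (∀ u v, c * ‖v - u‖ ≤ ‖Ψ v - Ψ u‖) ∧ Ψ =ᶠ[𝓝 u₀] Φ := by
  set A := fderiv ℝ Φ u₀
  obtain ⟨c₀, hc₀, hA⟩ : ∃ c₀ : ℝ, 0 < c₀ ∧ ∀ w, c₀ * ‖w‖ ≤ ‖A w‖ := by
    obtain ⟨K, hK, hanti⟩ := (A : E →ₗ[ℝ] V).exists_antilipschitzWith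
      (LinearMap.ker_eq_bot.2 hinj)
    refine ⟨(K : ℝ)⁻¹, by positivity, fun w => ?_⟩
    have := hanti.le_mul_dist w 0
    rw [dist_zero_right, map_zero, dist_zero_right] at this
    rw [inv_mul_le_iff₀ (by positivity)]
    exact this
  let b : ContDiffBump (0 : E) := ⟨1, 2, one_pos, one_lt_two⟩
  have hb : ContDiff ℝ ∞ b := b.contDiff
  obtain ⟨C₁, hC₁⟩ : ∃ C₁, ∀ x, ‖fderiv ℝ b x‖ ≤ C₁ :=
    (hb.continuous_fderiv (by simp)).bounded_above_of_compact_support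
      (b.hasCompactSupport.fderiv (𝕜 := ℝ))
  have hC₁0 : 0 ≤ C₁ := (norm_nonneg _).trans (hC₁ 0)
  -- The remainder `r` of the affine approximation, cut off at scale `δ`, has derivative at most `ε
  -- + (C₁ / δ) (ε · 2 δ) = ε (1 + 2 C₁)`. The scale drops out, and `ε` is chosen to make this `c₀ /
  -- 2`.
  set ε := c₀ / (2 * (1 + 2 * C₁))
  have hε : 0 < ε := by positivity
  set r : E → V := fun v => Φ v - Φ u₀ - A (v - u₀)
  have hev : ∀ᶠ v in 𝓝 u₀, ContDiffAt ℝ ∞ Φ v ∧ ‖fderiv ℝ Φ v - A‖ ≤ ε := by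
    refine hΦ.and ?_
    have hc : ContinuousAt (fderiv ℝ Φ) u₀ :=
      (hΦ.self_of_nhds.fderiv_right (m := 0) (by simp)).continuousAt
    have := hc.eventually (Metric.closedBall_mem_nhds (fderiv ℝ Φ u₀) hε)
    filter_upwards [this] with v hv
    simpa [dist_eq_norm] using hv
  obtain ⟨δ', hδ', hball⟩ := Metric.eventually_nhds_iff_ball.1 hev
  -- The cut-off is supported in the ball of radius `2 δ < δ'`, inside the region where `Φ` is
  -- controlled.
  set δ := δ' / 3
  have hδ : 0 < δ := by positivity
  have hδδ' : 2 * δ < δ' := by simp only [δ]; linarith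
  have hrd : ∀ v ∈ Metric.ball u₀ δ', HasFDerivAt r (fderiv ℝ Φ v - A) v := fun v hv => by
    have h1 := ((hball v hv).1.differentiableAt (by simp)).hasFDerivAt
    have h2 : HasFDerivAt (fun v => A (v - u₀)) A v :=
      A.hasFDerivAt.comp v ((hasFDerivAt_id v).sub_const u₀)
    exact (h1.sub_const _).sub h2
  have hr0 : r u₀ = 0 := by simp [r]
  have hrle : ∀ v ∈ Metric.ball u₀ δ', ‖r v‖ ≤ ε * ‖v - u₀‖ := fun v hv => by
    have := (convex_ball u₀ δ').norm_image_sub_le_of_norm_hasFDerivWithin_le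
      (fun x hx => (hrd x hx).hasFDerivWithinAt) (fun x hx => (hball x hx).2)
      (Metric.mem_ball_self hδ') hv
    simpa [hr0] using this
  set S : E → E := fun v => δ⁻¹ • (v - u₀)
  have hSd : ∀ v, HasFDerivAt S (δ⁻¹ • ContinuousLinearMap.id ℝ E) v := fun v =>
    ((hasFDerivAt_id v).sub_const u₀).const_smul δ⁻¹
  have hSs : ContDiff ℝ ∞ S := by fun_prop
  set ψ : E → V := fun v => b (S v) • r v
  have hzero : ∀ v, 2 * δ ≤ ‖v - u₀‖ → b (S v) = 0 := fun v hv => by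
    refine b.zero_of_le_dist ?_
    simp only [S, dist_zero_right, norm_smul, norm_inv, Real.norm_of_nonneg hδ.le]
    rw [le_inv_mul_iff₀ hδ]
    simpa [b, mul_comm] using hv
  have hψzero : ∀ v, 2 * δ ≤ ‖v - u₀‖ → ψ v = 0 := fun v hv => by simp [ψ, hzero v hv]
  have hψout : ∀ v, 2 * δ < ‖v - u₀‖ → ψ =ᶠ[𝓝 v] fun _ => 0 := fun v hv => by
    have hop : IsOpen {v : E | 2 * δ < ‖v - u₀‖} :=
      isOpen_lt continuous_const (by fun_prop)
    filter_upwards [hop.mem_nhds hv] with x hx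
    exact hψzero x (le_of_lt hx)
  have hψs : ContDiff ℝ ∞ ψ := by
    refine contDiff_iff_contDiffAt.2 fun v => ?_
    by_cases hv : v ∈ Metric.ball u₀ δ'
    · have h1 := (hball v hv).1
      exact (hb.comp hSs).contDiffAt.smul ((h1.sub contDiffAt_const).sub
        (A.contDiff.comp (contDiff_id.sub contDiff_const)).contDiffAt)
    · rw [Metric.mem_ball, dist_eq_norm, not_lt] at hv
      exact contDiffAt_const.congr_of_eventuallyEq (hψout v (by linarith))
  have hψc : HasCompactSupport ψ := by
    refine HasCompactSupport.of_support_subset_isCompact (isCompact_closedBall u₀ (2 * δ)) ?_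
    intro v hv
    by_contra h
    rw [Metric.mem_closedBall, dist_eq_norm, not_le] at h
    exact hv (hψzero v h.le)
  have hψd : ∀ v, ‖fderiv ℝ ψ v‖ ≤ c₀ / 2 := fun v => by
    by_cases hv : ‖v - u₀‖ ≤ 2 * δ
    · have hvb : v ∈ Metric.ball u₀ δ' := by
        rw [Metric.mem_ball, dist_eq_norm]; linarith
      have h1 : HasFDerivAt (fun v => b (S v))
          ((fderiv ℝ b (S v)).comp (δ⁻¹ • ContinuousLinearMap.id ℝ E)) v :=
        ((hb.differentiable (by simp) (S v)).hasFDerivAt).comp v (hSd v)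
      have h2 : HasFDerivAt ψ _ v := h1.smul (hrd v hvb)
      rw [h2.fderiv]
      have e1 : ‖(fderiv ℝ b (S v)).comp (δ⁻¹ • ContinuousLinearMap.id ℝ E)‖ ≤ C₁ * δ⁻¹ := by
        refine (ContinuousLinearMap.opNorm_comp_le _ _).trans ?_
        gcongr
        · exact hC₁ _
        · rw [norm_smul, norm_inv, Real.norm_of_nonneg hδ.le]
          exact mul_le_of_le_one_right (by positivity) ContinuousLinearMap.norm_id_le
      have e2 : ‖b (S v)‖ ≤ 1 := by
        rw [Real.norm_of_nonneg b.nonneg]; exact b.le_one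
      calc _ ≤ ‖b (S v)‖ * ‖fderiv ℝ Φ v - A‖ +
            ‖(fderiv ℝ b (S v)).comp (δ⁻¹ • ContinuousLinearMap.id ℝ E)‖ * ‖r v‖ := by
            refine (norm_add_le _ _).trans ?_
            rw [norm_smul, ContinuousLinearMap.norm_smulRight_apply]
        _ ≤ 1 * ε + C₁ * δ⁻¹ * (ε * (2 * δ)) := by
            gcongr
            · exact (hball v hvb).2
            · exact (hrle v hvb).trans (by gcongr)
        _ = ε * (1 + 2 * C₁) := by field_simp
        _ = c₀ / 2 := by simp only [ε]; field_simp
    · rw [(hψout v (not_le.1 hv)).fderiv_eq]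
      simp only [fderiv_fun_const, Pi.zero_apply, norm_zero]
      positivity
  -- An affine map expanding by at least `c₀`, perturbed by a map `ψ` with Lipschitz constant `c₀ /
  -- 2`.
  refine ⟨fun v => (Φ u₀ - A u₀) + A v + ψ v, c₀ / 2, ?_, by positivity, fun u v => ?_, ?_⟩
  · exact ((HasTemperateGrowth.const _).add A.hasTemperateGrowth).add (hψc.hasTemperateGrowth hψs)
  · have h1 : ‖ψ v - ψ u‖ ≤ c₀ / 2 * ‖v - u‖ :=
      convex_univ.norm_image_sub_le_of_norm_fderiv_le
        (fun x _ => hψs.differentiable (by simp) x) (fun x _ => hψd x) (mem_univ u) (mem_univ v)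
    have h2 := hA (v - u)
    have h3 : A (v - u) = ((Φ u₀ - A u₀) + A v + ψ v - ((Φ u₀ - A u₀) + A u + ψ u)) -
        (ψ v - ψ u) := by rw [map_sub]; abel
    have h4 := norm_sub_le ((Φ u₀ - A u₀) + A v + ψ v - ((Φ u₀ - A u₀) + A u + ψ u)) (ψ v - ψ u)
    rw [← h3] at h4
    linarith
  · have h1 : ∀ᶠ v in 𝓝 u₀, b (S v) = 1 := by
      have hS0 : S u₀ = 0 := by simp [S]
      have h2 : b =ᶠ[𝓝 (S u₀)] 1 := by rw [hS0]; exact b.eventuallyEq_one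
      exact hSs.continuous.continuousAt.eventually h2
    filter_upwards [h1] with v hv
    simp only [ψ, hv, one_smul, r, map_sub]
    abel

/-! ### The metric, its volume density and its Christoffel symbols in a parametrization -/

section Metric

variable {d : ℕ}

/-- The derivative of the determinant at the identity matrix is the trace. -/
lemma hasFDerivAt_det_of_eq_one {X : Type} [NormedAddCommGroup X] [NormedSpace ℝ X]
    {Y : X → Matrix (Fin d) (Fin d) ℝ} {Y' : Fin d → Fin d → X →L[ℝ] ℝ} {x : X} (hx : Y x = 1)
    (hY : ∀ i j, HasFDerivAt (fun x => Y x i j) (Y' i j) x) :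
    HasFDerivAt (fun x => (Y x).det) (∑ i, Y' i i) x := by
  have h : HasFDerivAt (fun x => (Y x).det) (∑ σ : Equiv.Perm (Fin d),
      ((Equiv.Perm.sign σ : ℤ) : ℝ) • ∑ i, (∏ j ∈ Finset.univ.erase i, Y x (σ j) j) •
        Y' (σ i) i) x := by
    simp only [Matrix.det_apply']
    refine HasFDerivAt.fun_sum fun σ _ => HasFDerivAt.const_mul ?_ _
    exact HasFDerivAt.finsetProd fun i _ => hY (σ i) i
  refine h.congr_fderiv ?_
  rw [Finset.sum_eq_single (1 : Equiv.Perm (Fin d))]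
  · simp only [Equiv.Perm.sign_one, Units.val_one, Int.cast_one, one_smul, Equiv.Perm.coe_one,
      id_eq, hx, Matrix.one_apply_eq, Finset.prod_const_one]
  · intro σ _ hσ
    rw [Finset.sum_eq_zero, smul_zero]
    intro i _
    -- A permutation other than the identity moves at least two points, so a vanishing off-diagonal
    -- entry remains after the factor `i` has been differentiated.
    obtain ⟨j, hj, hij⟩ : ∃ j, σ j ≠ j ∧ j ≠ i := by
      by_contra! hcon
      apply hσ
      ext j : 1
      by_contra hne
      have hji : j = i := hcon j hne
      subst hji
      have h2 : σ (σ j) ≠ σ j := fun h => hne (σ.injective h)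
      exact hne (hcon _ h2)
    rw [Finset.prod_eq_zero (Finset.mem_erase.2 ⟨hij, Finset.mem_univ j⟩), zero_smul]
    rw [hx, Matrix.one_apply_ne hj]
  · simp

/-- Jacobi's formula: multiplying by the constant matrix `(Y x)⁻¹` reduces to the derivative at the
identity. -/
lemma hasFDerivAt_det {X : Type} [NormedAddCommGroup X] [NormedSpace ℝ X]
    {Y : X → Matrix (Fin d) (Fin d) ℝ} {Y' : Fin d → Fin d → X →L[ℝ] ℝ} {x : X}
    (hx : IsUnit (Y x).det) (hY : ∀ i j, HasFDerivAt (fun x => Y x i j) (Y' i j) x) :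
    HasFDerivAt (fun x => (Y x).det)
      ((Y x).det • ∑ i, ∑ j, (Y x)⁻¹ i j • Y' j i) x := by
  have h1 : HasFDerivAt (fun z => ((Y x)⁻¹ * Y z).det) (∑ i, ∑ j, (Y x)⁻¹ i j • Y' j i) x := by
    refine hasFDerivAt_det_of_eq_one (Y := fun z => (Y x)⁻¹ * Y z)
      (Y' := fun i k => ∑ j, (Y x)⁻¹ i j • Y' j k) (Matrix.nonsing_inv_mul _ hx) fun i k => ?_
    simp only [Matrix.mul_apply]
    exact HasFDerivAt.fun_sum fun j _ => (hY j k).const_mul _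
  have h2 : (fun z => (Y z).det) = fun z => (Y x).det * ((Y x)⁻¹ * Y z).det := by
    funext z
    rw [Matrix.det_mul, ← mul_assoc, ← Matrix.det_mul, Matrix.mul_nonsing_inv _ hx, Matrix.det_one,
      one_mul]
  rw [h2]
  exact h1.const_mul _

variable {V : Type} [NormedAddCommGroup V] [InnerProductSpace ℝ V]

lemma gramMatrix_comm (A : EuclideanSpace ℝ (Fin d) →L[ℝ] V) (i j : Fin d) :
    gramMatrix A i j = gramMatrix A j i := real_inner_comm _ _

lemma gramMatrix_inv_comm (A : EuclideanSpace ℝ (Fin d) →L[ℝ] V) (i j : Fin d) :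
    (gramMatrix A)⁻¹ i j = (gramMatrix A)⁻¹ j i := by
  have h : (gramMatrix A)ᵀ = gramMatrix A := by
    ext i j; exact gramMatrix_comm A j i
  conv_rhs => rw [← h, ← Matrix.transpose_nonsing_inv, Matrix.transpose_apply]

lemma exists_mul_norm_le_of_injective {A : EuclideanSpace ℝ (Fin d) →L[ℝ] V} (hA : Injective A) :
    ∃ c : ℝ, 0 < c ∧ ∀ w, c * ‖w‖ ≤ ‖A w‖ := by
  obtain ⟨K, hK, hanti⟩ := (A : EuclideanSpace ℝ (Fin d) →ₗ[ℝ] V).exists_antilipschitzWith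
    (LinearMap.ker_eq_bot.2 hA)
  refine ⟨(K : ℝ)⁻¹, by positivity, fun w => ?_⟩
  have := hanti.le_mul_dist w 0
  rw [dist_zero_right, map_zero, dist_zero_right] at this
  rw [inv_mul_le_iff₀ (by positivity)]
  exact this

lemma det_gramMatrix_nonneg (A : EuclideanSpace ℝ (Fin d) →L[ℝ] V) : 0 ≤ (gramMatrix A).det := by
  have : gramMatrix A = Matrix.gram ℝ fun i => A (EuclideanSpace.single i 1) := by
    ext i j; rfl
  rw [this]
  exact (Matrix.posSemidef_gram ℝ _).det_nonneg

lemma det_gramMatrix_pos {A : EuclideanSpace ℝ (Fin d) →L[ℝ] V} (hA : Injective A) :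
    0 < (gramMatrix A).det := by
  obtain ⟨c, hc, hcA⟩ := exists_mul_norm_le_of_injective hA
  exact lt_of_le_of_ne (det_gramMatrix_nonneg A) (isUnit_det_gramMatrix hc hcA).ne_zero.symm

/-- The Riemannian volume density `√(det g)` of a parametrization. -/
noncomputable def volumeDensity (Φ : EuclideanSpace ℝ (Fin d) → V)
    (u : EuclideanSpace ℝ (Fin d)) : ℝ :=
  √(gramMatrix (fderiv ℝ Φ u)).det

/-- The Christoffel symbols of the metric of a parametrization. -/
noncomputable def christoffelOf (Φ : EuclideanSpace ℝ (Fin d) → V) (u : EuclideanSpace ℝ (Fin d))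
    (k i j : Fin d) : ℝ :=
  (1 / 2 : ℝ) * ∑ l, (gramMatrix (fderiv ℝ Φ u))⁻¹ k l *
    (partialDeriv i (fun w => gramMatrix (fderiv ℝ Φ w) j l) u
      + partialDeriv j (fun w => gramMatrix (fderiv ℝ Φ w) i l) u
      - partialDeriv l (fun w => gramMatrix (fderiv ℝ Φ w) i j) u)

variable {Φ : EuclideanSpace ℝ (Fin d) → V} {u : EuclideanSpace ℝ (Fin d)}

lemma christoffelOf_comm (k i j : Fin d) : christoffelOf Φ u k i j = christoffelOf Φ u k j i := by
  simp only [christoffelOf]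
  congr 1
  refine Finset.sum_congr rfl fun l _ => ?_
  have : (fun w => gramMatrix (fderiv ℝ Φ w) i j) = fun w => gramMatrix (fderiv ℝ Φ w) j i :=
    funext fun w => gramMatrix_comm _ _ _
  rw [this]
  ring

variable (hΦ : ContDiffAt ℝ ∞ Φ u)

include hΦ

lemma contDiffAt_gramMatrix (i j : Fin d) :
    ContDiffAt ℝ ∞ (fun w => gramMatrix (fderiv ℝ Φ w) i j) u := by
  have h : ContDiffAt ℝ ∞ (fderiv ℝ Φ) u := hΦ.fderiv_right (by simp)
  exact (h.clm_apply contDiffAt_const).inner ℝ (h.clm_apply contDiffAt_const)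

lemma partialDeriv_gramMatrix (k i j : Fin d) :
    partialDeriv k (fun w => gramMatrix (fderiv ℝ Φ w) i j) u =
      inner ℝ (fderiv ℝ Φ u (EuclideanSpace.single i 1))
        (fderiv ℝ (fderiv ℝ Φ) u (EuclideanSpace.single k 1) (EuclideanSpace.single j 1)) +
      inner ℝ (fderiv ℝ (fderiv ℝ Φ) u (EuclideanSpace.single k 1) (EuclideanSpace.single i 1))
        (fderiv ℝ Φ u (EuclideanSpace.single j 1)) := by
  have h : HasFDerivAt (fderiv ℝ Φ) (fderiv ℝ (fderiv ℝ Φ) u) u :=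
    ((hΦ.fderiv_right (m := ∞) (by simp)).differentiableAt (by simp)).hasFDerivAt
  have h1 : ∀ i : Fin d, HasFDerivAt (fun w => fderiv ℝ Φ w (EuclideanSpace.single i 1))
      ((fderiv ℝ (fderiv ℝ Φ) u).flip (EuclideanSpace.single i 1)) u := fun i => by
    refine (h.clm_apply (hasFDerivAt_const (EuclideanSpace.single i (1 : ℝ)) u)).congr_fderiv ?_
    ext; simp
  have h2 := (h1 i).inner ℝ (h1 j)
  rw [partialDeriv, show fderiv ℝ (fun w => gramMatrix (fderiv ℝ Φ w) i j) u = _ from h2.fderiv]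
  simp

lemma fderiv_fderiv_comm (v w : EuclideanSpace ℝ (Fin d)) :
    fderiv ℝ (fderiv ℝ Φ) u v w = fderiv ℝ (fderiv ℝ Φ) u w v :=
  (hΦ.of_le (m := 2) (WithTop.coe_le_coe.2 le_top)).isSymmSndFDerivAt (by simp) v w

variable (hinj : Injective (fderiv ℝ Φ u))

include hinj

/-- The product rule for `g_ij = ⟨∂_i Φ, ∂_j Φ⟩` and the symmetry of `D²Φ` give `⟨∂_l Φ, ∂_i ∂_j Φ⟩
= ½ (∂_i g_jl + ∂_j g_il - ∂_l g_ij)`; the factor `g` then cancels the `g⁻¹` in the Christoffel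
symbols. -/
lemma inner_fderiv_fderiv_eq (l i j : Fin d) :
    inner ℝ (fderiv ℝ Φ u (EuclideanSpace.single l 1))
      (fderiv ℝ (fderiv ℝ Φ) u (EuclideanSpace.single i 1) (EuclideanSpace.single j 1)) =
        ∑ k, gramMatrix (fderiv ℝ Φ u) l k * christoffelOf Φ u k i j := by
  set g := gramMatrix (fderiv ℝ Φ u) with hg
  have hunit : IsUnit g.det := isUnit_iff_ne_zero.2 (det_gramMatrix_pos hinj).ne'
  set q : Fin d → ℝ := fun l => partialDeriv i (fun w => gramMatrix (fderiv ℝ Φ w) j l) u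
      + partialDeriv j (fun w => gramMatrix (fderiv ℝ Φ w) i l) u
      - partialDeriv l (fun w => gramMatrix (fderiv ℝ Φ w) i j) u
  have h1 : ∑ k, g l k * christoffelOf Φ u k i j = (1 / 2 : ℝ) * (g *ᵥ (g⁻¹ *ᵥ q)) l := by
    simp only [christoffelOf, Matrix.mulVec, dotProduct, Finset.mul_sum, q, ← hg]
    refine Finset.sum_congr rfl fun k _ => Finset.sum_congr rfl fun m _ => by ring
  rw [h1, Matrix.mulVec_mulVec, Matrix.mul_nonsing_inv _ hunit, Matrix.one_mulVec]
  simp only [q, partialDeriv_gramMatrix hΦ]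
  rw [fderiv_fderiv_comm hΦ (EuclideanSpace.single j 1) (EuclideanSpace.single i 1),
    fderiv_fderiv_comm hΦ (EuclideanSpace.single l 1) (EuclideanSpace.single i 1),
    fderiv_fderiv_comm hΦ (EuclideanSpace.single l 1) (EuclideanSpace.single j 1)]
  rw [real_inner_comm (fderiv ℝ Φ u (EuclideanSpace.single l 1))
      (fderiv ℝ (fderiv ℝ Φ) u (EuclideanSpace.single i 1) (EuclideanSpace.single j 1)),
    real_inner_comm (fderiv ℝ Φ u (EuclideanSpace.single j 1))
      (fderiv ℝ (fderiv ℝ Φ) u (EuclideanSpace.single i 1) (EuclideanSpace.single l 1))]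
  ring

lemma contDiffAt_volumeDensity : ContDiffAt ℝ ∞ (volumeDensity Φ) u := by
  have h : ContDiffAt ℝ ∞ (fun u => (gramMatrix (fderiv ℝ Φ u)).det) u := by
    simp only [Matrix.det_apply']
    exact ContDiffAt.sum fun σ _ => contDiffAt_const.mul
      (contDiffAt_prod fun i _ => contDiffAt_gramMatrix hΦ (σ i) i)
  exact h.sqrt (det_gramMatrix_pos hinj).ne'

omit hΦ in
lemma volumeDensity_pos : 0 < volumeDensity Φ u := Real.sqrt_pos.2 (det_gramMatrix_pos hinj)

/-- By Jacobi's formula the logarithmic derivative of `√det g` is `½ g^kl ∂_i g_kl`. In `Γ^k_ki` the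
two other derivatives of the metric cancel when contracted with the symmetric matrix `g⁻¹`. -/
lemma fderiv_volumeDensity (i : Fin d) :
    fderiv ℝ (volumeDensity Φ) u (EuclideanSpace.single i 1) =
      volumeDensity Φ u * ∑ k, christoffelOf Φ u k k i := by
  have hpos := det_gramMatrix_pos hinj
  have h1 := (hasFDerivAt_det (Y := fun w => gramMatrix (fderiv ℝ Φ w))
    (isUnit_iff_ne_zero.2 hpos.ne') fun i j =>
      ((contDiffAt_gramMatrix hΦ i j).differentiableAt (by simp)).hasFDerivAt).sqrt hpos.ne'
  rw [show fderiv ℝ (volumeDensity Φ) u = _ from h1.fderiv]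
  simp only [_root_.smul_apply, _root_.sum_apply, smul_eq_mul]
  set g := gramMatrix (fderiv ℝ Φ u) with hg
  set D : Fin d → Fin d → Fin d → ℝ := fun k i j =>
    partialDeriv k (fun w => gramMatrix (fderiv ℝ Φ w) i j) u with hD
  have hDs : ∀ k i j, D k i j = D k j i := fun k i j => by
    simp only [hD]
    congr 2
    exact funext fun w => gramMatrix_comm _ _ _
  have h2 : ∑ k, christoffelOf Φ u k k i = (1 / 2 : ℝ) * ∑ k, ∑ l, g⁻¹ k l * D i l k := by
    have h3 : ∑ k, ∑ l, g⁻¹ k l * D k i l = ∑ k, ∑ l, g⁻¹ k l * D l k i := by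
      rw [Finset.sum_comm]
      refine Finset.sum_congr rfl fun l _ => Finset.sum_congr rfl fun k _ => ?_
      rw [hDs, hg, gramMatrix_inv_comm]
    simp only [christoffelOf, ← Finset.mul_sum]
    congr 1
    have h4 : ∀ k l, g⁻¹ k l * (D k i l + D i k l - D l k i) =
        g⁻¹ k l * D k i l + g⁻¹ k l * D i l k - g⁻¹ k l * D l k i := fun k l => by
      rw [hDs i k l]; ring
    calc _ = ∑ k, ∑ l, g⁻¹ k l * (D k i l + D i k l - D l k i) := rfl
      _ = _ := by
        simp only [h4, Finset.sum_sub_distrib, Finset.sum_add_distrib, h3]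
        ring
  rw [h2]
  have h5 : √g.det ≠ 0 := (Real.sqrt_pos.2 hpos).ne'
  have h6 : volumeDensity Φ u = √g.det := rfl
  have h7 : g.det = √g.det * √g.det := (Real.mul_self_sqrt hpos.le).symm
  have h8 : ∑ k, ∑ l, g⁻¹ k l * fderiv ℝ (fun w => gramMatrix (fderiv ℝ Φ w) l k) u
      (EuclideanSpace.single i 1) = ∑ k, ∑ l, g⁻¹ k l * D i l k := rfl
  rw [h6, h8]
  conv_lhs => enter [2, 1]; rw [h7]
  field_simp

end Metric

/-! ### Charts of a smoothly embedded manifold -/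

section Charts

variable {d N : ℕ} {M : Type*} [TopologicalSpace M]
  [ChartedSpace (EuclideanSpace ℝ (Fin d)) M] [IsManifold (𝓡 d) ∞ M]

lemma contDiffAt_comp_chart_symm {G : Type*} [NormedAddCommGroup G] [NormedSpace ℝ G] {a : M → G}
    (ha : ContMDiff (𝓡 d) 𝓘(ℝ, G) ∞ a) (p : M) {u : EuclideanSpace ℝ (Fin d)}
    (hu : u ∈ (chartAt (EuclideanSpace ℝ (Fin d)) p).target) :
    ContDiffAt ℝ ∞ (a ∘ (chartAt (EuclideanSpace ℝ (Fin d)) p).symm) u := by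
  have h1 : ContMDiffOn (𝓡 d) (𝓡 d) ∞ (chartAt (EuclideanSpace ℝ (Fin d)) p).symm
      (chartAt (EuclideanSpace ℝ (Fin d)) p).target := contMDiffOn_chart_symm
  have h2 := ha.comp_contMDiffOn h1
  exact (contMDiffOn_iff_contDiffOn.1 h2).contDiffAt
    ((chartAt (EuclideanSpace ℝ (Fin d)) p).open_target.mem_nhds hu)

omit [IsManifold (𝓡 d) ∞ M] in
/-- A transition map between two charts of the maximal atlas is smooth. -/
lemma contDiffAt_transition {e e' : OpenPartialHomeomorph M (EuclideanSpace ℝ (Fin d))}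
    (he : e ∈ IsManifold.maximalAtlas (𝓡 d) ∞ M) (he' : e' ∈ IsManifold.maximalAtlas (𝓡 d) ∞ M)
    {u : EuclideanSpace ℝ (Fin d)} (hu : u ∈ e.target) (hu' : e.symm u ∈ e'.source) :
    ContDiffAt ℝ ∞ (e' ∘ e.symm) u := by
  have h1 := (contMDiffOn_symm_of_mem_maximalAtlas he u hu).contMDiffAt (e.open_target.mem_nhds hu)
  have h2 := (contMDiffOn_of_mem_maximalAtlas he' _ hu').contMDiffAt (e'.open_source.mem_nhds hu')
  exact contMDiffAt_iff_contDiffAt.1 (h2.comp u h1)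

variable {F : M → EuclideanSpace ℝ (Fin N)}
  (hF : Manifold.IsSmoothEmbedding (𝓡 d) (𝓡 N) ∞ F)

include hF

/-- In the charts of the immersion normal form, `F` is `z ↦ (z, 0)`. Projecting to the first factor
and changing chart gives a differentiable left inverse of the parametrization near `u`, and the
chain rule applies. -/
lemma injective_fderiv_comp_chart_symm (p : M) {u : EuclideanSpace ℝ (Fin d)}
    (hu : u ∈ (chartAt (EuclideanSpace ℝ (Fin d)) p).target) :
    Injective (fderiv ℝ (F ∘ (chartAt (EuclideanSpace ℝ (Fin d)) p).symm) u) := by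
  set e := chartAt (EuclideanSpace ℝ (Fin d)) p
  set x := e.symm u
  have h := hF.isImmersion.isImmersionAt x
  set D := h.domChart
  set C := h.codChart
  have hxD : x ∈ D.source := h.mem_domChart_source
  have hxC : F x ∈ C.source := h.mem_codChart_source
  set L : EuclideanSpace ℝ (Fin N) →L[ℝ] EuclideanSpace ℝ (Fin d) :=
    (ContinuousLinearMap.fst ℝ (EuclideanSpace ℝ (Fin d)) h.complement).comp
      (h.equiv.symm : EuclideanSpace ℝ (Fin N) →L[ℝ] EuclideanSpace ℝ (Fin d) × h.complement)
  have key : ∀ z ∈ D.source, L (C (F z)) = D z := fun z hz => by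
    have hz' : D z ∈ (D.extend (𝓡 d)).target := by simpa using D.map_source hz
    have h1 := h.writtenInCharts hz'
    have h2 : C (F z) = h.equiv (D z, 0) := by
      simpa [D, C, D.left_inv hz] using h1
    simp [L, h2]
  have heD : e ∈ IsManifold.maximalAtlas (𝓡 d) ∞ M := IsManifold.chart_mem_maximalAtlas p
  have hxe : x ∈ e.source := e.map_target hu
  have hT : ContDiffAt ℝ ∞ (e ∘ D.symm) (D x) :=
    contDiffAt_transition h.domChart_mem_maximalAtlas heD (D.map_source hxD)
      (by rw [D.left_inv hxD]; exact hxe)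
  have hC : ContDiffAt ℝ ∞ C (F x) :=
    contMDiffAt_iff_contDiffAt.1 ((contMDiffOn_of_mem_maximalAtlas h.codChart_mem_maximalAtlas _
      hxC).contMDiffAt (C.open_source.mem_nhds hxC))
  set Ξ : EuclideanSpace ℝ (Fin N) → EuclideanSpace ℝ (Fin d) := fun y => (e ∘ D.symm) (L (C y))
  have hΞ : DifferentiableAt ℝ Ξ (F x) := by
    have h1 : DifferentiableAt ℝ (fun y => L (C y)) (F x) :=
      L.differentiableAt.comp _ (hC.differentiableAt (by simp))
    refine DifferentiableAt.comp (F x) (g := e ∘ D.symm) ?_ h1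
    rw [key x hxD]
    exact hT.differentiableAt (by simp)
  have hΦ : DifferentiableAt ℝ (F ∘ e.symm) u :=
    (contDiffAt_comp_chart_symm hF.contMDiff p hu).differentiableAt (by simp)
  have hid : Ξ ∘ (F ∘ e.symm) =ᶠ[𝓝 u] id := by
    have h1 : ∀ᶠ v in 𝓝 u, e.symm v ∈ D.source :=
      (e.continuousAt_symm hu).eventually (D.open_source.mem_nhds hxD)
    filter_upwards [h1, e.open_target.mem_nhds hu] with v hv hve
    simp only [Ξ, comp_apply, id]
    rw [key _ hv, D.left_inv hv, e.right_inv hve]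
  have hcomp := fderiv_comp u (show DifferentiableAt ℝ Ξ ((F ∘ e.symm) u) from hΞ) hΦ
  rw [hid.fderiv_eq, fderiv_id] at hcomp
  intro v w hvw
  have h1 := congrArg (fun T => T v) hcomp
  have h2 := congrArg (fun T => T w) hcomp
  simp only [ContinuousLinearMap.comp_apply, ContinuousLinearMap.id_apply] at h1 h2
  rw [h1, h2, hvw]

/-! ### The Riemannian volume measure -/

/-- The two metrics are related by `Tᵀ g T`, with `T` the Jacobian matrix of the transition map; the
factor `|det T|` is the one in the change of variables formula. -/
lemma det_metricCoeff_eq {p q : M} {u : EuclideanSpace ℝ (Fin d)}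
    (hu : u ∈ (chartAt (EuclideanSpace ℝ (Fin d)) p).target)
    (huq : (chartAt (EuclideanSpace ℝ (Fin d)) p).symm u ∈
      (chartAt (EuclideanSpace ℝ (Fin d)) q).source) :
    √(metricCoeff F p u).det =
      |(fderiv ℝ (chartAt (EuclideanSpace ℝ (Fin d)) q ∘
        (chartAt (EuclideanSpace ℝ (Fin d)) p).symm) u).det| *
      √(metricCoeff F q (chartAt (EuclideanSpace ℝ (Fin d)) q
        ((chartAt (EuclideanSpace ℝ (Fin d)) p).symm u))).det := by
  set e := chartAt (EuclideanSpace ℝ (Fin d)) p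
  set e' := chartAt (EuclideanSpace ℝ (Fin d)) q
  set τ := e' ∘ e.symm
  have hτ : DifferentiableAt ℝ τ u :=
    (contDiffAt_transition (IsManifold.chart_mem_maximalAtlas p)
      (IsManifold.chart_mem_maximalAtlas q) hu huq).differentiableAt (by simp)
  have hu' : τ u ∈ e'.target := e'.map_source huq
  have hΦ : DifferentiableAt ℝ (F ∘ e'.symm) (τ u) :=
    (contDiffAt_comp_chart_symm hF.contMDiff q hu').differentiableAt (by simp)
  have hcomp : F ∘ e.symm =ᶠ[𝓝 u] (F ∘ e'.symm) ∘ τ := by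
    filter_upwards [(e.continuousAt_symm hu).eventually (e'.open_source.mem_nhds huq)] with v hv
    simp only [τ, comp_apply, e'.left_inv hv]
  have hfd : fderiv ℝ (F ∘ e.symm) u = (fderiv ℝ (F ∘ e'.symm) (τ u)).comp (fderiv ℝ τ u) := by
    rw [hcomp.fderiv_eq, fderiv_comp u hΦ hτ]
  set b := (EuclideanSpace.basisFun (Fin d) ℝ).toBasis
  set T := LinearMap.toMatrix b b (fderiv ℝ τ u : EuclideanSpace ℝ (Fin d) →ₗ[ℝ] _)
  have hT : (fderiv ℝ τ u).det = T.det := (LinearMap.det_toMatrix b _).symm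
  have hTcol : ∀ i, fderiv ℝ τ u (EuclideanSpace.single i 1) =
      ∑ k, T k i • EuclideanSpace.single k (1 : ℝ) := fun i => by
    conv_lhs => rw [eq_sum_single (fderiv ℝ τ u (EuclideanSpace.single i 1))]
    refine Finset.sum_congr rfl fun k _ => ?_
    congr 1
  have hg : metricCoeff F p u = Tᵀ * metricCoeff F q (τ u) * T := by
    ext i j
    have h1 : metricCoeff F p u i j = inner ℝ
      (fderiv ℝ (F ∘ e.symm) u (EuclideanSpace.single i 1))
      (fderiv ℝ (F ∘ e.symm) u (EuclideanSpace.single j 1)) := rfl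
    rw [h1, hfd]
    simp only [ContinuousLinearMap.comp_apply, hTcol, map_sum, map_smul, sum_inner, inner_sum,
      inner_smul_left, inner_smul_right, Matrix.mul_apply, Finset.sum_mul, Finset.mul_sum,
      Matrix.transpose_apply]
    refine Finset.sum_congr rfl fun k _ => Finset.sum_congr rfl fun l _ => ?_
    simp only [metricCoeff, partialDeriv, Matrix.of_apply, e', conj_trivial]
    ring
  rw [hg, Matrix.det_mul, Matrix.det_mul, Matrix.det_transpose, hT]
  have h2 : T.det * (metricCoeff F q (τ u)).det * T.det =
      T.det ^ 2 * (metricCoeff F q (τ u)).det := by ring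
  rw [h2, Real.sqrt_mul (sq_nonneg _), Real.sqrt_sq_eq_abs]
  rfl

variable [MeasurableSpace M] [BorelSpace M]

omit hF [IsManifold (𝓡 d) ∞ M] [MeasurableSpace M] [BorelSpace M] in
lemma measurable_volumeDensity (p : M) : Measurable fun u : EuclideanSpace ℝ (Fin d) =>
    ENNReal.ofReal √(metricCoeff F p u).det := by
  have h : ∀ i j, Measurable fun u => metricCoeff F p u i j := fun i j => by
    have := measurable_fderiv ℝ (F ∘ (chartAt (EuclideanSpace ℝ (Fin d)) p).symm)
    exact (this.apply_continuousLinearMap _).inner (this.apply_continuousLinearMap _)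
  refine ENNReal.measurable_ofReal.comp (Real.continuous_sqrt.measurable.comp ?_)
  simp only [Matrix.det_apply']
  exact Finset.measurable_sum _ fun σ _ => (Finset.measurable_prod _ fun i _ => h _ _).const_mul _

omit hF [IsManifold (𝓡 d) ∞ M] in
lemma measurableSet_target_inter_preimage (p : M) {S : Set M}
    (hS : MeasurableSet S) :
    MeasurableSet ((chartAt (EuclideanSpace ℝ (Fin d)) p).target ∩
      (chartAt (EuclideanSpace ℝ (Fin d)) p).symm ⁻¹' S) := by
  set e := chartAt (EuclideanSpace ℝ (Fin d)) p
  have h := (continuousOn_iff_continuous_domRestrict.1 e.continuousOn_symm).measurable hS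
  have h2 := (MeasurableEmbedding.subtype_coe e.open_target.measurableSet).measurableSet_image.2 h
  convert! h2 using 1
  ext x
  simp [Set.domRestrict, and_comm]

omit hF [IsManifold (𝓡 d) ∞ M] in
lemma aemeasurable_chart_symm (p : M) (ν : Measure (EuclideanSpace ℝ (Fin d))) :
    AEMeasurable (chartAt (EuclideanSpace ℝ (Fin d)) p).symm
      (ν.restrict (chartAt (EuclideanSpace ℝ (Fin d)) p).target) :=
  (chartAt (EuclideanSpace ℝ (Fin d)) p).continuousOn_symm.aemeasurable
    (chartAt (EuclideanSpace ℝ (Fin d)) p).open_target.measurableSet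

omit hF [IsManifold (𝓡 d) ∞ M] in
lemma chartVolume_apply (p : M) {S : Set M} (hS : MeasurableSet S) :
    chartVolume d F p S = ∫⁻ u in (chartAt (EuclideanSpace ℝ (Fin d)) p).target ∩
      (chartAt (EuclideanSpace ℝ (Fin d)) p).symm ⁻¹' S, ENNReal.ofReal √(metricCoeff F p u).det := by
  set e := chartAt (EuclideanSpace ℝ (Fin d)) p
  have hm := measurableSet_target_inter_preimage (d := d) p hS
  have h1 := aemeasurable_chart_symm (d := d) p
    ((volume : Measure (EuclideanSpace ℝ (Fin d))).withDensity
        fun u => ENNReal.ofReal √(metricCoeff F p u).det)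
  rw [chartVolume, Measure.map_apply_of_aemeasurable h1 hS,
    Measure.restrict_apply₀' e.open_target.measurableSet.nullMeasurableSet, inter_comm,
    withDensity_apply _ hm]

omit hF [IsManifold (𝓡 d) ∞ M] in
lemma chartVolume_compl_source (p : M) :
    chartVolume d F p (chartAt (EuclideanSpace ℝ (Fin d)) p).sourceᶜ = 0 := by
  set e := chartAt (EuclideanSpace ℝ (Fin d)) p
  rw [chartVolume_apply p e.open_source.measurableSet.compl]
  have : e.target ∩ e.symm ⁻¹' e.sourceᶜ = ∅ := by
    ext u
    simp only [mem_inter_iff, mem_preimage, mem_compl_iff, mem_empty_iff_false, iff_false, not_and,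
      not_not]
    exact fun hu => e.map_target hu
  rw [this]
  simp

lemma chartVolume_eq_of_subset {p q : M} {S : Set M} (hS : MeasurableSet S)
    (hp : S ⊆ (chartAt (EuclideanSpace ℝ (Fin d)) p).source)
    (hq : S ⊆ (chartAt (EuclideanSpace ℝ (Fin d)) q).source) :
    chartVolume d F p S = chartVolume d F q S := by
  rw [chartVolume_apply p hS, chartVolume_apply q hS]
  set e := chartAt (EuclideanSpace ℝ (Fin d)) p
  set e' := chartAt (EuclideanSpace ℝ (Fin d)) q
  have himg : (e' ∘ e.symm) '' (e.target ∩ e.symm ⁻¹' S) = e'.target ∩ e'.symm ⁻¹' S := by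
    ext v
    constructor
    · rintro ⟨u, ⟨hu, huS⟩, rfl⟩
      refine ⟨e'.map_source (hq huS), ?_⟩
      simpa [e'.left_inv (hq huS)] using huS
    · rintro ⟨hv, hvS⟩
      have h1 : e.symm (e (e'.symm v)) = e'.symm v := e.left_inv (hp hvS)
      refine ⟨e (e'.symm v), ⟨e.map_source (hp hvS), ?_⟩, ?_⟩
      · rw [mem_preimage, h1]; exact hvS
      · rw [comp_apply, h1, e'.right_inv hv]
  have hinj : InjOn (e' ∘ e.symm) (e.target ∩ e.symm ⁻¹' S) := by
    intro u hu v hv huv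
    have h1 := e'.injOn (hq hu.2) (hq hv.2) huv
    exact e.symm.injOn hu.1 hv.1 h1
  rw [← himg, lintegral_image_eq_lintegral_abs_det_fderiv_mul volume
    (measurableSet_target_inter_preimage (d := d) p hS)
    (f' := fun u => fderiv ℝ (e' ∘ e.symm) u) (fun u hu => ?_) hinj]
  · refine setLIntegral_congr_fun (measurableSet_target_inter_preimage (d := d) p hS)
      fun u hu => ?_
    rw [det_metricCoeff_eq hF hu.1 (hq hu.2), ENNReal.ofReal_mul (abs_nonneg _)]
    rfl
  · exact ((contDiffAt_transition (IsManifold.chart_mem_maximalAtlas p)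
      (IsManifold.chart_mem_maximalAtlas q) hu.1 (hq hu.2)).differentiableAt
        (by simp)).hasFDerivAt.hasFDerivWithinAt

/-- In the domain of a chart, the Riemannian volume measure is the measure of this chart. -/
lemma riemannianVolume_restrict_source (p : M) :
    (riemannianVolume d F).restrict (chartAt (EuclideanSpace ℝ (Fin d)) p).source =
      chartVolume d F p := by
  set S := (chartAt (EuclideanSpace ℝ (Fin d)) p).source
  have hS : MeasurableSet S := (chartAt (EuclideanSpace ℝ (Fin d)) p).open_source.measurableSet
  set μ := riemannianVolume d F
  -- The measure on the right agrees with that of the chart at `p` on `S` and with `μ` off `S`. It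
  -- dominates every `chartVolume`, hence also their supremum `μ`; this is the only use of
  -- leastness.
  have hle : μ ≤ (chartVolume d F p).restrict S + μ.restrict Sᶜ := by
    refine iSup_le fun q => Measure.le_iff.2 fun A hA => ?_
    have h1 : chartVolume d F q (A ∩ S) ≤ chartVolume d F p (A ∩ S) := by
      set Q := (chartAt (EuclideanSpace ℝ (Fin d)) q).source
      have hQ : MeasurableSet Q := (chartAt (EuclideanSpace ℝ (Fin d)) q).open_source.measurableSet
      calc chartVolume d F q (A ∩ S)
          ≤ chartVolume d F q (A ∩ S ∩ Q) + chartVolume d F q (A ∩ S ∩ Qᶜ) := by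
            rw [← measure_inter_add_sdiff (A ∩ S) hQ, sdiff_eq]
        _ ≤ chartVolume d F q (A ∩ S ∩ Q) + 0 := by
            gcongr
            rw [← chartVolume_compl_source (d := d) (F := F) q]
            exact measure_mono inter_subset_right
        _ = chartVolume d F p (A ∩ S ∩ Q) := by
            rw [add_zero]
            exact chartVolume_eq_of_subset hF ((hA.inter hS).inter hQ) inter_subset_right
              (inter_subset_left.trans inter_subset_right)
        _ ≤ _ := measure_mono inter_subset_left
    have h2 : chartVolume d F q (A ∩ Sᶜ) ≤ μ (A ∩ Sᶜ) :=
      (le_iSup (fun q => chartVolume d F q) q) _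
    rw [Measure.add_apply, Measure.restrict_apply hA, Measure.restrict_apply hA,
      ← measure_inter_add_sdiff A hS, sdiff_eq]
    exact add_le_add h1 h2
  refine le_antisymm (Measure.le_iff.2 fun A hA => ?_) (Measure.le_iff.2 fun A hA => ?_)
  · rw [Measure.restrict_apply hA]
    refine (hle (A ∩ S)).trans ?_
    rw [Measure.add_apply, Measure.restrict_apply (hA.inter hS),
      Measure.restrict_apply (hA.inter hS), inter_assoc A S Sᶜ, inter_compl_self, inter_empty,
      measure_empty, add_zero]
    exact measure_mono (inter_subset_left.trans inter_subset_left)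
  · rw [Measure.restrict_apply hA]
    calc chartVolume d F p A ≤ chartVolume d F p (A ∩ S) + chartVolume d F p (A ∩ Sᶜ) := by
          rw [← measure_inter_add_sdiff A hS, sdiff_eq]
      _ ≤ chartVolume d F p (A ∩ S) + 0 := by
          gcongr
          rw [← chartVolume_compl_source (d := d) (F := F) p]
          exact measure_mono inter_subset_right
      _ ≤ _ := by
          rw [add_zero]
          exact (le_iSup (fun q => chartVolume d F q) p) _

/-- The density is continuous, so it is integrable on a closed ball in the target of a chart; hence
the measure is locally finite, and compactness concludes. -/
lemma isFiniteMeasure_riemannianVolume [CompactSpace M] :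
    IsFiniteMeasure (riemannianVolume d F) := by
  have : IsLocallyFiniteMeasure (riemannianVolume d F) := by
    refine ⟨fun p => ?_⟩
    set e := chartAt (EuclideanSpace ℝ (Fin d)) p
    have hp : p ∈ e.source := mem_chart_source _ p
    obtain ⟨r, hr, hball⟩ := Metric.nhds_basis_closedBall.mem_iff.1
      (e.open_target.mem_nhds (e.map_source hp))
    set O := e.source ∩ e ⁻¹' Metric.ball (e p) r
    have hO : IsOpen O := e.isOpen_inter_preimage Metric.isOpen_ball
    refine ⟨O, hO.mem_nhds ⟨hp, Metric.mem_ball_self hr⟩, ?_⟩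
    have h1 : riemannianVolume d F O = chartVolume d F p O := by
      rw [← riemannianVolume_restrict_source hF p, Measure.restrict_apply hO.measurableSet,
        inter_eq_left.2 inter_subset_left]
    rw [h1, chartVolume_apply p hO.measurableSet]
    have hsub : e.target ∩ e.symm ⁻¹' O ⊆ Metric.closedBall (e p) r := by
      rintro u ⟨hu, huO⟩
      have := huO.2
      rw [mem_preimage, e.right_inv hu] at this
      exact Metric.ball_subset_closedBall this
    have hcont : ContinuousOn (fun u => √(metricCoeff F p u).det) (Metric.closedBall (e p) r) := by
      intro u hu
      have hu' := hball hu
      exact (contDiffAt_volumeDensity (contDiffAt_comp_chart_symm hF.contMDiff p hu')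
        (injective_fderiv_comp_chart_symm hF p hu')).continuousAt.continuousWithinAt
    refine (lintegral_mono_set hsub).trans_lt ?_
    exact (hcont.integrableOn_compact (isCompact_closedBall _ _)).lintegral_lt_top
  infer_instance

/-- Integrals over the domain of a chart, in coordinates. -/
lemma setIntegral_source_eq (p : M) {h : M → ℝ} (hh : Measurable h) :
    ∫ z in (chartAt (EuclideanSpace ℝ (Fin d)) p).source, h z ∂riemannianVolume d F =
      ∫ u in (chartAt (EuclideanSpace ℝ (Fin d)) p).target,
        volumeDensity (F ∘ (chartAt (EuclideanSpace ℝ (Fin d)) p).symm) u *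
          h ((chartAt (EuclideanSpace ℝ (Fin d)) p).symm u) := by
  rw [riemannianVolume_restrict_source hF, chartVolume,
    integral_map (aemeasurable_chart_symm p _) hh.aestronglyMeasurable,
    restrict_withDensity (chartAt (EuclideanSpace ℝ (Fin d)) p).open_target.measurableSet,
    integral_withDensity_eq_integral_toReal_smul (measurable_volumeDensity p)
      (ae_of_all _ fun _ => ENNReal.ofReal_lt_top)]
  refine integral_congr_ae (ae_of_all _ fun u => ?_)
  simp only [ENNReal.toReal_ofReal (Real.sqrt_nonneg _), smul_eq_mul]
  rfl

end Charts

/-! ### Expansion of the approximate Laplacian for small times -/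

/-- Localization errors are thus negligible against any power of `√t`, including the normalization
`√t ^ d`. -/
lemma tendsto_exp_neg_div_sqrt_pow {δ : ℝ} (hδ : 0 < δ) (k : ℕ) :
    Tendsto (fun t : ℝ => Real.exp (-(δ / t)) / √t ^ k) (𝓝[>] 0) (𝓝 0) := by
  have h1 : Tendsto (fun t : ℝ => δ / t) (𝓝[>] 0) atTop := by
    simpa [div_eq_mul_inv] using tendsto_inv_nhdsGT_zero.const_mul_atTop hδ
  have h2 := ((Real.tendsto_pow_mul_exp_neg_atTop_nhds_zero k).comp h1).const_mul (δ ^ k)⁻¹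
  rw [mul_zero] at h2
  refine squeeze_zero' (Eventually.of_forall fun t => by positivity) ?_ h2
  have h3 : ∀ᶠ t : ℝ in 𝓝[>] 0, t < 1 := nhdsWithin_le_nhds (gt_mem_nhds one_pos)
  filter_upwards [self_mem_nhdsWithin, h3] with t ht ht1
  have ht : 0 < t := ht
  have h4 : t ≤ √t := Real.le_sqrt_of_sq_le (by nlinarith)
  have h5 : (δ ^ k)⁻¹ * ((fun x => x ^ k * Real.exp (-x)) ∘ fun t => δ / t) t =
      Real.exp (-(δ / t)) / t ^ k := by
    simp only [comp_apply, div_pow]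
    field_simp
  rw [h5]
  gcongr

/-- Meant for the cut-off of a chart extended by zero to `M`: only its measurability is needed, not
its continuity. -/
lemma measurable_indicator_of_continuousOn {X : Type*} [TopologicalSpace X] [MeasurableSpace X]
    [OpensMeasurableSpace X] {s : Set X} (hs : IsOpen s) {f : X → ℝ} (hf : ContinuousOn f s) :
    Measurable (s.indicator f) := by
  classical
  have h : Measurable (s.piecewise f 0) := hf.measurable_piecewise continuousOn_const hs.measurableSet
  rwa [piecewise_eq_indicator] at h

section LocalHeatLinear

variable {E V : Type} [NormedAddCommGroup E] [InnerProductSpace ℝ E] [FiniteDimensional ℝ E]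
  [MeasurableSpace E] [BorelSpace E]
  [NormedAddCommGroup V] [InnerProductSpace ℝ V] [CompleteSpace V]

lemma localHeat_sub_const_mul {Ψ : E → V} (hΨ : HasTemperateGrowth Ψ) {c : ℝ} (hc : 0 < c)
    (hcΨ : ∀ u v, c * ‖v - u‖ ≤ ‖Ψ v - Ψ u‖) {f g : E → ℝ} (hf : HasTemperateGrowth f)
    (hg : HasTemperateGrowth g) (k : ℝ) (p : E × ℝ) :
    localHeat Ψ (fun v => f v - k * g v) p = localHeat Ψ f p - k * localHeat Ψ g p := by
  have hint : ∀ {f : E → ℝ}, HasTemperateGrowth f →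
      Integrable fun w => Real.exp (-phase Ψ (p, w)) • f (p.1 + p.2 • w) := fun {f} hf => by
    have h1 : HasTemperateGrowth fun x : (E × ℝ) × E => f (x.1.1 + x.1.2 • x.2) :=
      hf.comp ((hasTemperateGrowth_fst.comp hasTemperateGrowth_fst).add
        ((hasTemperateGrowth_snd.comp hasTemperateGrowth_fst).smul hasTemperateGrowth_snd))
    exact (integrableGrowth_exp_neg_smul (hasTemperateGrowth_phase hΨ) h1
      (c := 2⁻¹ * c ^ 2) (by positivity) (mul_norm_sq_le_phase hΨ hc hcΨ)).integrable p
  simp only [localHeat]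
  rw [← integral_const_mul, ← integral_sub (hint hf) ((hint hg).const_mul k)]
  refine integral_congr_ae (ae_of_all _ fun w => ?_)
  simp only [smul_eq_mul]
  ring

end LocalHeatLinear

/-! ### Localization of the heat integrals to one chart. -/

section Expansion

variable {d N : ℕ} {M : Type*} [TopologicalSpace M] [CompactSpace M]
  [ChartedSpace (EuclideanSpace ℝ (Fin d)) M] [IsManifold (𝓡 d) ∞ M]
  [MeasurableSpace M] [BorelSpace M]

/-- The unnormalized heat-type integral `∫ a(z') exp (-‖F z - F z'‖² / 2t) dvol(z')`. -/
noncomputable def heatIntegral (F : M → EuclideanSpace ℝ (Fin N)) (t : ℝ) (a : M → ℝ) (z : M) :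
    ℝ :=
  ∫ z', a z' * Real.exp (-(chordalDist F z z') ^ 2 / (2 * t)) ∂riemannianVolume d F

/-- The density, in the chart at `x₀`, of a function times the volume, cut off by `χ`. -/
noncomputable def localDensity (F : M → EuclideanSpace ℝ (Fin N)) (x₀ : M)
    (χ : EuclideanSpace ℝ (Fin d) → ℝ) (a : M → ℝ) (v : EuclideanSpace ℝ (Fin d)) : ℝ :=
  χ v * (volumeDensity (F ∘ (chartAt (EuclideanSpace ℝ (Fin d)) x₀).symm) v *
    a ((chartAt (EuclideanSpace ℝ (Fin d)) x₀).symm v))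

variable {F : M → EuclideanSpace ℝ (Fin N)}
  (hF : Manifold.IsSmoothEmbedding (𝓡 d) (𝓡 N) ∞ F)

omit [CompactSpace M] [IsManifold (𝓡 d) ∞ M] [MeasurableSpace M] [BorelSpace M]
  [ChartedSpace (EuclideanSpace ℝ (Fin d)) M] in
lemma exists_abs_le_of_continuous [CompactSpace M] {a : M → ℝ} (ha : Continuous a) :
    ∃ C, 0 ≤ C ∧ ∀ z, |a z| ≤ C := by
  obtain ⟨C, hC⟩ := isCompact_univ.exists_bound_of_continuousOn ha.continuousOn
  exact ⟨max C 0, le_max_right _ _, fun z => (hC z (mem_univ z)).trans (le_max_left _ _)⟩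

include hF

omit [CompactSpace M] [IsManifold (𝓡 d) ∞ M] [MeasurableSpace M] [BorelSpace M] in
lemma continuous_heatKernel_right (t : ℝ) (z : M) :
    Continuous fun z' : M => Real.exp (-(chordalDist F z z') ^ 2 / (2 * t)) := by
  have := hF.isEmbedding.continuous
  unfold chordalDist
  fun_prop

omit [CompactSpace M] hF [TopologicalSpace M] [ChartedSpace (EuclideanSpace ℝ (Fin d)) M]
  [IsManifold (𝓡 d) ∞ M] [MeasurableSpace M] [BorelSpace M] in
lemma heatKernel_le_one {t : ℝ} (ht : 0 < t) (z z' : M) :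
    Real.exp (-(chordalDist F z z') ^ 2 / (2 * t)) ≤ 1 := by
  rw [Real.exp_le_one_iff, neg_div]
  have : 0 ≤ chordalDist F z z' ^ 2 / (2 * t) := by positivity
  linarith

/-- Near `x₀`, and up to an exponentially small error, the heat-type integrals are given by the
corresponding integrals over a Euclidean space for a global map `Ψ`. -/
lemma exists_local_model (x₀ : M) :
    ∃ (Ψ : EuclideanSpace ℝ (Fin d) → EuclideanSpace ℝ (Fin N)) (c : ℝ)
      (χ : EuclideanSpace ℝ (Fin d) → ℝ) (δ : ℝ),
      HasTemperateGrowth Ψ ∧ 0 < c ∧ (∀ u v, c * ‖v - u‖ ≤ ‖Ψ v - Ψ u‖) ∧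
      Ψ =ᶠ[𝓝 (chartAt (EuclideanSpace ℝ (Fin d)) x₀ x₀)]
        F ∘ (chartAt (EuclideanSpace ℝ (Fin d)) x₀).symm ∧
      (∀ᶠ v in 𝓝 (chartAt (EuclideanSpace ℝ (Fin d)) x₀ x₀), χ v = 1) ∧
      0 < δ ∧ ∀ a : M → ℝ, ContMDiff (𝓡 d) 𝓘(ℝ, ℝ) ∞ a →
        HasTemperateGrowth (localDensity F x₀ χ a) ∧ ∃ K, ∀ᶠ z in 𝓝 x₀, ∀ t : ℝ, 0 < t →
          |heatIntegral (d := d) F t a z - √t ^ d * localHeat Ψ (localDensity F x₀ χ a)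
            (chartAt (EuclideanSpace ℝ (Fin d)) x₀ z, √t)| ≤ K * Real.exp (-(δ / t)) := by
  set e := chartAt (EuclideanSpace ℝ (Fin d)) x₀
  set u₀ := e x₀
  set Φ := F ∘ e.symm
  have hx₀ : x₀ ∈ e.source := mem_chart_source _ x₀
  have hu₀ : u₀ ∈ e.target := e.map_source hx₀
  have hΦs : ∀ u ∈ e.target, ContDiffAt ℝ ∞ Φ u := fun u hu =>
    contDiffAt_comp_chart_symm hF.contMDiff x₀ hu
  have hΦi : ∀ u ∈ e.target, Injective (fderiv ℝ Φ u) := fun u hu =>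
    injective_fderiv_comp_chart_symm hF x₀ hu
  obtain ⟨Ψ, c, hΨ, hc, hcΨ, hΨΦ⟩ := exists_extension_of_immersion
    (eventually_of_mem (e.open_target.mem_nhds hu₀) hΦs) (hΦi u₀ hu₀)
  obtain ⟨ρ, hρ, hball⟩ := Metric.eventually_nhds_iff_ball.1
    (hΨΦ.and (e.open_target.mem_nhds hu₀))
  have hballt : ∀ v ∈ Metric.ball u₀ ρ, v ∈ e.target := fun v hv => (hball v hv).2
  -- The margin between `ρ / 2` and `ρ` ensures that the cut-off density vanishes near every point
  -- outside the ball of radius `ρ`, hence is smooth everywhere.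
  let χ : ContDiffBump u₀ := ⟨ρ / 3, ρ / 2, by positivity, by linarith⟩
  have hχ0 : ∀ v, v ∉ Metric.ball u₀ ρ → χ v = 0 := fun v hv => by
    refine χ.zero_of_le_dist ?_
    rw [Metric.mem_ball, not_lt] at hv
    show ρ / 2 ≤ dist v u₀
    linarith
  set O := e.source ∩ e ⁻¹' Metric.ball u₀ (ρ / 3)
  have hO : IsOpen O := e.isOpen_inter_preimage Metric.isOpen_ball
  have hxO : x₀ ∈ O := ⟨hx₀, Metric.mem_ball_self (by positivity)⟩
  -- Here the topological embedding is used: points outside `O` have chordal distance at least `2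
  -- δ₀` from `x₀`, hence at least `δ₀` from every `z` within `δ₀` of `x₀`. The discarded kernel is
  -- then at most `exp (-δ₀² / (2 t))`.
  obtain ⟨δ₀, hδ₀, hδO⟩ : ∃ δ₀ > 0, ∀ z, ‖F z - F x₀‖ < 2 * δ₀ → z ∈ O := by
    have h1 := hF.isEmbedding.isInducing.nhds_eq_comap x₀
    have h2 : O ∈ comap F (𝓝 (F x₀)) := h1 ▸ hO.mem_nhds hxO
    obtain ⟨r, hr, hsub⟩ := (Metric.nhds_basis_ball.comap F).mem_iff.1 h2
    refine ⟨r / 2, by positivity, fun z hz => hsub ?_⟩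
    rw [mem_preimage, Metric.mem_ball, dist_eq_norm]
    linarith
  refine ⟨Ψ, c, χ, δ₀ ^ 2 / 2, hΨ, hc, hcΨ, hΨΦ, χ.eventuallyEq_one, by positivity,
    fun a ha => ?_⟩
  set f := localDensity F x₀ χ a
  have hf0 : ∀ v, v ∉ Metric.ball u₀ ρ → f v = 0 := fun v hv => by
    simp only [f, localDensity, hχ0 v hv, zero_mul]
  have hfs : HasTemperateGrowth f := by
    refine HasCompactSupport.hasTemperateGrowth ?_ ?_
    · refine χ.hasCompactSupport.mono fun v hv => ?_
      simp only [f, localDensity, mem_support] at hv ⊢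
      exact left_ne_zero_of_mul hv
    · refine contDiff_iff_contDiffAt.2 fun v => ?_
      by_cases hv : v ∈ Metric.ball u₀ ρ
      · exact χ.contDiff.contDiffAt.mul ((contDiffAt_volumeDensity (hΦs v (hballt v hv))
          (hΦi v (hballt v hv))).mul (contDiffAt_comp_chart_symm ha x₀ (hballt v hv)))
      · rw [Metric.mem_ball, not_lt] at hv
        have h1 : {v | ρ / 2 < dist v u₀} ∈ 𝓝 v :=
          (isOpen_lt continuous_const (by fun_prop)).mem_nhds (by
            show ρ / 2 < dist v u₀
            linarith)
        refine (contDiffAt_const (c := (0 : ℝ))).congr_of_eventuallyEq ?_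
        filter_upwards [h1] with w hw
        have hw : ρ / 2 < dist w u₀ := hw
        have : χ w = 0 := χ.zero_of_le_dist hw.le
        simp only [f, localDensity, this, zero_mul]
  obtain ⟨C, hC0, hC⟩ := exists_abs_le_of_continuous ha.continuous
  have := isFiniteMeasure_riemannianVolume hF
  set μ := riemannianVolume d F
  refine ⟨hfs, C * μ.real univ, ?_⟩
  have hev1 : ∀ᶠ z in 𝓝 x₀, ‖F z - F x₀‖ < δ₀ := by
    have := hF.isEmbedding.continuous.continuousAt.eventually (Metric.ball_mem_nhds (F x₀) hδ₀)
    filter_upwards [this] with z hz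
    simpa [dist_eq_norm] using hz
  filter_upwards [hev1, hO.mem_nhds hxO] with z hz hzO t ht
  have hze : e z ∈ Metric.ball u₀ ρ := Metric.ball_subset_ball (by linarith) hzO.2
  set k : M → ℝ := fun z' => Real.exp (-(chordalDist F z z') ^ 2 / (2 * t))
  have hkc : Continuous k := continuous_heatKernel_right hF t z
  have hk0 : ∀ z', 0 ≤ k z' := fun z' => (Real.exp_pos _).le
  have hk1 : ∀ z', k z' ≤ 1 := heatKernel_le_one ht z
  set η : M → ℝ := e.source.indicator (χ ∘ e)
  have hηm : Measurable η := measurable_indicator_of_continuousOn e.open_source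
    (χ.continuous.comp_continuousOn e.continuousOn)
  have hη01 : ∀ z', 0 ≤ η z' ∧ η z' ≤ 1 := fun z' => by
    by_cases hz' : z' ∈ e.source
    · simp only [η, indicator_of_mem hz', comp_apply]
      exact ⟨χ.nonneg, χ.le_one⟩
    · simp [η, indicator_of_notMem hz']
  have hηO : ∀ z' ∈ O, η z' = 1 := fun z' hz' => by
    simp only [η, indicator_of_mem hz'.1, comp_apply]
    exact χ.one_of_mem_closedBall (Metric.ball_subset_closedBall hz'.2)
  have hint1 : Integrable (fun z' => a z' * k z') μ := by
    refine Integrable.of_bound (ha.continuous.mul hkc).measurable.aestronglyMeasurable C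
      (ae_of_all _ fun z' => ?_)
    rw [norm_mul, Real.norm_of_nonneg (hk0 z')]
    exact (mul_le_mul (hC z') (hk1 z') (hk0 z') hC0).trans (by simp)
  have hint2 : Integrable (fun z' => η z' * (a z' * k z')) μ := by
    refine hint1.norm.mono'
      (hηm.mul (ha.continuous.mul hkc).measurable).aestronglyMeasurable
      (ae_of_all _ fun z' => ?_)
    rw [norm_mul, Real.norm_of_nonneg (hη01 z').1]
    exact mul_le_of_le_one_left (norm_nonneg _) (hη01 z').2
  have hmain : ∫ z', η z' * (a z' * k z') ∂μ =
      √t ^ d * localHeat Ψ f (e z, √t) := by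
    have h1 : ∫ z', η z' * (a z' * k z') ∂μ = ∫ z' in e.source, η z' * (a z' * k z') ∂μ := by
      refine (setIntegral_eq_integral_of_forall_compl_eq_zero fun z' hz' => ?_).symm
      simp only [η, indicator_of_notMem hz', zero_mul]
    have hm : Measurable fun z' => η z' * (a z' * k z') :=
      hηm.mul (ha.continuous.mul hkc).measurable
    rw [h1, setIntegral_source_eq hF x₀ hm]
    have h2 := integral_eq_localHeat hΨ (f := f) (e z) (Real.sqrt_pos.2 ht)
    rw [finrank_euclideanSpace_fin] at h2
    have h3 : ∫ v in e.target, f v * Real.exp (-‖Ψ v - Ψ (e z)‖ ^ 2 / (2 * √t ^ 2)) =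
        ∫ v, f v * Real.exp (-‖Ψ v - Ψ (e z)‖ ^ 2 / (2 * √t ^ 2)) :=
      setIntegral_eq_integral_of_forall_compl_eq_zero fun v hv => by
        rw [hf0 v fun h => hv (hballt v h), zero_mul]
    rw [← h2, ← h3]
    refine setIntegral_congr_fun e.open_target.measurableSet fun v hv => ?_
    by_cases hvb : v ∈ Metric.ball u₀ ρ
    · have h3 : η (e.symm v) = χ v := by
        simp only [η, indicator_of_mem (e.map_target hv), comp_apply, e.right_inv hv]
      have h4 : Ψ v = F (e.symm v) := (hball v hvb).1
      have h5 : Ψ (e z) = F z := by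
        rw [(hball (e z) hze).1]
        exact congrArg F (e.left_inv hzO.1)
      have h6 : k (e.symm v) = Real.exp (-‖Ψ v - Ψ (e z)‖ ^ 2 / (2 * √t ^ 2)) := by
        simp only [k, chordalDist, h4, h5, Real.sq_sqrt ht.le, norm_sub_rev]
      have h7 : f v = χ v * (volumeDensity Φ v * a (e.symm v)) := rfl
      show volumeDensity Φ v * (η (e.symm v) * (a (e.symm v) * k (e.symm v))) = _
      rw [h3, h6, h7]
      ring
    · have h3 : η (e.symm v) = 0 := by
        simp only [η, indicator_of_mem (e.map_target hv), comp_apply, e.right_inv hv, hχ0 v hvb]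
      show volumeDensity Φ v * (η (e.symm v) * (a (e.symm v) * k (e.symm v))) = _
      simp only [h3, hf0 v hvb]
      ring
  have hI : heatIntegral (d := d) F t a z = ∫ z', a z' * k z' ∂μ := rfl
  rw [hI, ← hmain, ← integral_sub hint1 hint2]
  have hbound : ∀ z', ‖a z' * k z' - η z' * (a z' * k z')‖ ≤
      C * Real.exp (-(δ₀ ^ 2 / 2 / t)) := fun z' => by
    have h1 : a z' * k z' - η z' * (a z' * k z') = (1 - η z') * (a z' * k z') := by ring
    rw [h1]
    by_cases hz' : z' ∈ O
    · rw [hηO z' hz']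
      simp only [sub_self, zero_mul, norm_zero]
      positivity
    · have h2 : 2 * δ₀ ≤ ‖F z' - F x₀‖ := by
        by_contra! h
        exact hz' (hδO z' h)
      have h3 : δ₀ ≤ chordalDist F z z' := by
        have h4 := norm_sub_le (F z - F x₀) (F z - F z')
        have h5 : F z - F x₀ - (F z - F z') = F z' - F x₀ := by abel
        rw [h5] at h4
        simp only [chordalDist]
        linarith
      have h4 : k z' ≤ Real.exp (-(δ₀ ^ 2 / 2 / t)) := by
        refine Real.exp_le_exp.2 ?_
        rw [neg_div, neg_le_neg_iff, div_div]
        gcongr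
      rw [norm_mul, norm_mul, Real.norm_of_nonneg (hk0 z')]
      have h5 : ‖1 - η z'‖ ≤ 1 := by
        rw [Real.norm_eq_abs, abs_le]
        constructor <;> linarith [(hη01 z').1, (hη01 z').2]
      calc ‖1 - η z'‖ * (‖a z'‖ * k z') ≤ 1 * (C * Real.exp (-(δ₀ ^ 2 / 2 / t))) := by
            have := hk0 z'
            gcongr
            exact hC z'
        _ = _ := one_mul _
  have := norm_integral_le_of_norm_le_const (μ := μ) (ae_of_all _ hbound)
  rw [Real.norm_eq_abs] at this
  refine this.trans (le_of_eq ?_)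
  ring

end Expansion

/-! ### The second-order coefficient in coordinates. -/

section LocalCoefficient

variable {d : ℕ} {V : Type} [NormedAddCommGroup V] [InnerProductSpace ℝ V] [CompleteSpace V]

/-- The second order coefficient of `localHeat` is given by the Laplace-Beltrami operator in
coordinates. -/
lemma tendsto_localHeat_div_sq_eq_trace {Φ Ψ : EuclideanSpace ℝ (Fin d) → V}
    {u : EuclideanSpace ℝ (Fin d)} (hΦ : ∀ᶠ v in 𝓝 u, ContDiffAt ℝ ∞ Φ v)
    (hinj : ∀ᶠ v in 𝓝 u, Injective (fderiv ℝ Φ v)) (hΨ : HasTemperateGrowth Ψ) {c : ℝ} (hc : 0 < c)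
    (hcΨ : ∀ u v, c * ‖v - u‖ ≤ ‖Ψ v - Ψ u‖) (hΨΦ : Ψ =ᶠ[𝓝 u] Φ)
    {a m : EuclideanSpace ℝ (Fin d) → ℝ} (ha : ∀ᶠ v in 𝓝 u, ContDiffAt ℝ ∞ a v)
    (hm : HasTemperateGrowth m) (hma : m =ᶠ[𝓝 u] fun v => volumeDensity Φ v * (a v - a u)) :
    Tendsto (fun s : ℝ => localHeat Ψ m (u, s) / s ^ 2) (𝓝[≠] 0)
      (𝓝 (2⁻¹ * volumeDensity Φ u * (∑ i, ∑ j, (gramMatrix (fderiv ℝ Φ u))⁻¹ i j *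
        (partialDeriv i (partialDeriv j a) u -
          ∑ k, christoffelOf Φ u k i j * partialDeriv k a u)) *
        ∫ w, gaussWeight (fderiv ℝ Φ u) w)) := by
  have hΦ0 := hΦ.self_of_nhds
  have hinj0 := hinj.self_of_nhds
  have ha0 := ha.self_of_nhds
  set J := volumeDensity Φ with hJ
  have hJs : ∀ᶠ v in 𝓝 u, ContDiffAt ℝ ∞ J v :=
    (hΦ.and hinj).mono fun v hv => contDiffAt_volumeDensity hv.1 hv.2
  have hmu : m u = 0 := by rw [hma.self_of_nhds]; simp
  have hD1 : fderiv ℝ m =ᶠ[𝓝 u] fun v => J v • fderiv ℝ a v + (a v - a u) • fderiv ℝ J v := by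
    filter_upwards [hma.eventually_nhds, hJs, ha] with v hv hJv hav
    rw [Filter.EventuallyEq.fderiv_eq hv]
    exact ((hJv.differentiableAt (by simp)).hasFDerivAt.mul
      ((hav.differentiableAt (by simp)).hasFDerivAt.sub_const _)).fderiv
  have hdm : ∀ w, fderiv ℝ m u w = J u * fderiv ℝ a u w := fun w => by
    rw [hD1.self_of_nhds]; simp
  have hda : HasFDerivAt (fderiv ℝ a) (fderiv ℝ (fderiv ℝ a) u) u :=
    ((ha0.fderiv_right (m := ∞) (by simp)).differentiableAt (by simp)).hasFDerivAt
  have hdJ : HasFDerivAt (fderiv ℝ J) (fderiv ℝ (fderiv ℝ J) u) u :=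
    ((hJs.self_of_nhds.fderiv_right (m := ∞) (by simp)).differentiableAt (by simp)).hasFDerivAt
  have hddm : ∀ w, fderiv ℝ (fderiv ℝ m) u w w =
      J u * fderiv ℝ (fderiv ℝ a) u w w + 2 * (fderiv ℝ J u w * fderiv ℝ a u w) := fun w => by
    have h1 := ((hJs.self_of_nhds.differentiableAt (by simp)).hasFDerivAt.smul hda).add
      (((ha0.differentiableAt (by simp)).hasFDerivAt.sub_const (a u)).smul hdJ)
    rw [Filter.EventuallyEq.fderiv_eq hD1, show fderiv ℝ
      (fun v => J v • fderiv ℝ a v + (a v - a u) • fderiv ℝ J v) u = _ from HasFDerivAt.fderiv h1]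
    simp
    ring
  have hΨ1 : fderiv ℝ Ψ u = fderiv ℝ Φ u := hΨΦ.fderiv_eq
  have hΨ2 : fderiv ℝ (fderiv ℝ Ψ) u = fderiv ℝ (fderiv ℝ Φ) u := hΨΦ.fderiv.fderiv_eq
  obtain ⟨c', hc', hcA⟩ := exists_mul_norm_le_of_injective hinj0
  have hlim := tendsto_localHeat_div_sq hΨ hc hcΨ hm hmu
  have htr := integral_gaussWeight_eq_trace hc' hcA (fderiv ℝ (fderiv ℝ Φ) u)
    (christoffelOf Φ u) christoffelOf_comm (inner_fderiv_fderiv_eq hΦ0 hinj0) (J u)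
    (fderiv ℝ J u) (fderiv_volumeDensity hΦ0 hinj0) (fderiv ℝ a u) (fderiv ℝ (fderiv ℝ a) u)
  have hpd : ∀ i j, partialDeriv i (partialDeriv j a) u =
      fderiv ℝ (fderiv ℝ a) u (EuclideanSpace.single i 1) (EuclideanSpace.single j 1) :=
    fun i j => by
      have h1 := hda.clm_apply (hasFDerivAt_const (EuclideanSpace.single j (1 : ℝ)) u)
      rw [partialDeriv, show fderiv ℝ (partialDeriv j a) u = _ from h1.fderiv]
      simp
  simp only [hpd]
  rw [show (∑ i, ∑ j, (gramMatrix (fderiv ℝ Φ u))⁻¹ i j *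
      (fderiv ℝ (fderiv ℝ a) u (EuclideanSpace.single i 1) (EuclideanSpace.single j 1) -
        ∑ k, christoffelOf Φ u k i j * partialDeriv k a u)) = (∑ i, ∑ j,
      (gramMatrix (fderiv ℝ Φ u))⁻¹ i j * (fderiv ℝ (fderiv ℝ a) u (EuclideanSpace.single i 1)
        (EuclideanSpace.single j 1) - ∑ k, christoffelOf Φ u k i j *
          fderiv ℝ a u (EuclideanSpace.single k 1))) from rfl, ← htr]
  convert hlim using 3
  ext w
  rw [hΨ1, hΨ2, hdm, hddm]
  rfl

end LocalCoefficient

/-! ### The approximate Laplacian up to first order in `t`. -/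

section Expansion

variable {d N : ℕ} {M : Type*} [TopologicalSpace M] [CompactSpace M]
  [ChartedSpace (EuclideanSpace ℝ (Fin d)) M] [IsManifold (𝓡 d) ∞ M]
  [MeasurableSpace M] [BorelSpace M] {F : M → EuclideanSpace ℝ (Fin N)}
  (hF : Manifold.IsSmoothEmbedding (𝓡 d) (𝓡 N) ∞ F)

include hF

lemma integrable_mul_heatKernel {a : M → ℝ} (ha : Measurable a) {C : ℝ} (hC : ∀ z, |a z| ≤ C)
    {t : ℝ} (ht : 0 < t) (z : M) :
    Integrable (fun z' => a z' * Real.exp (-(chordalDist F z z') ^ 2 / (2 * t)))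
      (riemannianVolume d F) := by
  have := isFiniteMeasure_riemannianVolume hF
  refine Integrable.of_bound (ha.mul
    (continuous_heatKernel_right hF t z).measurable).aestronglyMeasurable C
    (ae_of_all _ fun z' => ?_)
  have h0 := (Real.exp_pos (-(chordalDist F z z') ^ 2 / (2 * t))).le
  rw [norm_mul, Real.norm_of_nonneg h0]
  exact (mul_le_mul (hC z') (heatKernel_le_one ht z z') h0
    ((abs_nonneg _).trans (hC z'))).trans (by simp)

lemma approxLaplacian_eq {a : M → ℝ} (ha : Measurable a) {C : ℝ} (hC : ∀ z, |a z| ≤ C)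
    {t : ℝ} (ht : 0 < t) (z : M) :
    approxLaplacian (chordalDist F) (riemannianVolume d F) t a z =
      2 / (t * heatIntegral (d := d) F t (fun _ => 1) z) *
        (heatIntegral (d := d) F t a z - a z * heatIntegral (d := d) F t (fun _ => 1) z) := by
  have h1 := integrable_mul_heatKernel hF ha hC ht z
  have h2 := integrable_mul_heatKernel (d := d) hF (a := fun _ => (1 : ℝ)) measurable_const
    (C := 1) (by simp) ht z
  simp only [one_mul] at h2
  simp only [approxLaplacian, theta, heatIntegral, one_mul]
  rw [← integral_const_mul (a z), ← integral_sub h1 (h2.const_mul _)]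
  simp only [sub_mul]

omit [CompactSpace M] [IsManifold (𝓡 d) ∞ M] [BorelSpace M] hF in
/-- The error made by replacing the heat-type integrals by local ones is negligible. -/
lemma tendsto_heatIntegral_sub_div {x₀ : M} {a : M → ℝ} {W : EuclideanSpace ℝ (Fin d) × ℝ → ℝ}
    {δ K : ℝ} (hδ : 0 < δ) (h : ∀ᶠ z in 𝓝 x₀, ∀ t : ℝ, 0 < t →
      |heatIntegral (d := d) F t a z - √t ^ d * W (chartAt (EuclideanSpace ℝ (Fin d)) x₀ z, √t)| ≤
        K * Real.exp (-(δ / t))) (k : ℕ) :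
    Tendsto (fun q : ℝ × M => (heatIntegral (d := d) F q.1 a q.2 / √q.1 ^ d -
      W (chartAt (EuclideanSpace ℝ (Fin d)) x₀ q.2, √q.1)) / q.1 ^ k)
      (𝓝[>] 0 ×ˢ 𝓝 x₀) (𝓝 0) := by
  have h1 : Tendsto (fun q : ℝ × M => K * (Real.exp (-(δ / q.1)) / √q.1 ^ (d + 2 * k)))
      (𝓝[>] 0 ×ˢ 𝓝 x₀) (𝓝 0) := by
    have := ((tendsto_exp_neg_div_sqrt_pow hδ (d + 2 * k)).const_mul K).comp
      (tendsto_fst (f := 𝓝[>] (0 : ℝ)) (g := 𝓝 x₀))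
    rwa [mul_zero] at this
  refine squeeze_zero_norm' ?_ h1
  filter_upwards [prod_mem_prod self_mem_nhdsWithin h] with q hq
  have ht : 0 < q.1 := hq.1
  have h2 := hq.2 q.1 ht
  have hs : 0 < √q.1 := Real.sqrt_pos.2 ht
  have h3 : √q.1 ^ (d + 2 * k) = √q.1 ^ d * q.1 ^ k := by
    rw [pow_add, pow_mul, Real.sq_sqrt ht.le]
  have h4 : (heatIntegral (d := d) F q.1 a q.2 / √q.1 ^ d -
      W (chartAt (EuclideanSpace ℝ (Fin d)) x₀ q.2, √q.1)) / q.1 ^ k =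
      (heatIntegral (d := d) F q.1 a q.2 -
        √q.1 ^ d * W (chartAt (EuclideanSpace ℝ (Fin d)) x₀ q.2, √q.1)) / √q.1 ^ (d + 2 * k) := by
    rw [h3]; field_simp
  rw [h4, Real.norm_eq_abs, abs_div, abs_of_pos (pow_pos hs _), ← mul_div_assoc]
  gcongr

/-- The first order expansion of the approximate Laplacian, with a locally uniform control of the
remainder. -/
lemma exists_expansion {a : M → ℝ} (ha : ContMDiff (𝓡 d) 𝓘(ℝ, ℝ) ∞ a) (x₀ : M) :
    ∃ h : EuclideanSpace ℝ (Fin d) → ℝ,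
      ContDiffAt ℝ ∞ h (chartAt (EuclideanSpace ℝ (Fin d)) x₀ x₀) ∧
      h (chartAt (EuclideanSpace ℝ (Fin d)) x₀ x₀) = laplaceBeltrami d F a x₀ ∧
      ∃ l, Tendsto (fun q : ℝ × M =>
        (approxLaplacian (chordalDist F) (riemannianVolume d F) q.1 a q.2 -
          h (chartAt (EuclideanSpace ℝ (Fin d)) x₀ q.2)) / q.1) (𝓝[>] 0 ×ˢ 𝓝 x₀) (𝓝 l) := by
  obtain ⟨Ψ, c, χ, δ, hΨ, hc, hcΨ, hΨΦ, hχ, hδ, hloc⟩ := exists_local_model hF x₀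
  set e := chartAt (EuclideanSpace ℝ (Fin d)) x₀
  set u₀ := e x₀
  set Φ := F ∘ e.symm
  have hx₀ : x₀ ∈ e.source := mem_chart_source _ x₀
  have hu₀ : u₀ ∈ e.target := e.map_source hx₀
  have htgt : ∀ᶠ u in 𝓝 u₀, u ∈ e.target := e.open_target.mem_nhds hu₀
  have hΦs : ∀ᶠ u in 𝓝 u₀, ContDiffAt ℝ ∞ Φ u :=
    htgt.mono fun u hu => contDiffAt_comp_chart_symm hF.contMDiff x₀ hu
  have hΦi : ∀ᶠ u in 𝓝 u₀, Injective (fderiv ℝ Φ u) :=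
    htgt.mono fun u hu => injective_fderiv_comp_chart_symm hF x₀ hu
  have has : ∀ᶠ u in 𝓝 u₀, ContDiffAt ℝ ∞ (a ∘ e.symm) u :=
    htgt.mono fun u hu => contDiffAt_comp_chart_symm ha x₀ hu
  obtain ⟨hfa, Ka, hKa⟩ := hloc a ha
  obtain ⟨hf1, K1, hK1⟩ := hloc (fun _ => 1) contMDiff_const
  set fa := localDensity F x₀ χ a
  set f1 := localDensity F x₀ χ (fun _ => (1 : ℝ))
  set Wa := localHeat Ψ fa
  set W1 := localHeat Ψ f1
  have hWa : HasTemperateGrowth Wa := hasTemperateGrowth_localHeat hΨ hc hcΨ hfa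
  have hW1 : HasTemperateGrowth W1 := hasTemperateGrowth_localHeat hΨ hc hcΨ hf1
  have hpr : HasTemperateGrowth fun x : EuclideanSpace ℝ (Fin d) × ℝ => (x.1, (0 : ℝ)) :=
    hasTemperateGrowth_fst.prodMk (.const 0)
  have hf1e : ∀ᶠ v in 𝓝 u₀, f1 v = volumeDensity Φ v := hχ.mono fun v hv => by
    simp only [f1, localDensity, hv, one_mul, mul_one]; rfl
  have hfae : ∀ᶠ v in 𝓝 u₀, fa v = volumeDensity Φ v * a (e.symm v) := hχ.mono fun v hv => by
    simp only [fa, localDensity, hv, one_mul]; rfl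
  have hW0 : ∀ᶠ v in 𝓝 u₀, Wa (v, 0) = a (e.symm v) * W1 (v, 0) := by
    filter_upwards [hf1e, hfae] with v h1 h2
    simp only [Wa, W1, localHeat_zero, h1, h2]
    ring
  set Z := ∫ w, gaussWeight (fderiv ℝ Φ u₀) w
  have hZ : 0 < Z := by
    obtain ⟨c', hc', hcA⟩ := exists_mul_norm_le_of_injective hΦi.self_of_nhds
    exact integral_gaussWeight_pos hc' hcA
  have hJ : 0 < volumeDensity Φ u₀ := volumeDensity_pos hΦi.self_of_nhds
  have hW1u : W1 (u₀, 0) = volumeDensity Φ u₀ * Z := by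
    simp only [W1, localHeat_zero, hf1e.self_of_nhds, hΨΦ.fderiv_eq]
    rfl
  have hW1pos : 0 < W1 (u₀, 0) := by rw [hW1u]; positivity
  -- Two expansions of a quotient, cross-multiplied so as to remain within functions of temperate
  -- growth. Since `Wa(u, 0) = a W1(u, 0)`, they read `W1(u, 0) (Wa - a W1) = s² G` and `G W1(u, 0)
  -- - G(u, 0) W1 = s² G'`, so that `2 (Wa - a W1) / (s² W1) = 2 G(u, 0) / W1(u, 0)² + 2 s² G' / (W1
  -- W1(u, 0)²)`.
  obtain ⟨G, hG, hSG, hGe⟩ := exists_eq_sq_mul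
    (S := fun x => Wa x * W1 (x.1, 0) - Wa (x.1, 0) * W1 x)
    ((hWa.mul (hW1.comp hpr)).sub ((hWa.comp hpr).mul hW1))
    (fun u s => by simp only [Wa, W1, localHeat_neg hΨ]) (fun u => by ring)
  obtain ⟨G', hG', hSG', -⟩ := exists_eq_sq_mul
    (S := fun x => G x * W1 (x.1, 0) - G (x.1, 0) * W1 x)
    ((hG.mul (hW1.comp hpr)).sub ((hG.comp hpr).mul hW1))
    (fun u s => by simp only [W1, localHeat_neg hΨ, hGe]) (fun u => by ring)
  simp only at hSG hSG'
  -- At the centre of the chart, `G(u₀, 0) / W1(u₀, 0)` is the `s²` coefficient of the heat integral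
  -- of `a - a x₀`, already identified with the Laplacian.
  have hG0 : G (u₀, 0) = W1 (u₀, 0) * (2⁻¹ * volumeDensity Φ u₀ *
      laplaceBeltrami d F a x₀ * Z) := by
    have hm : HasTemperateGrowth fun v => fa v - a x₀ * f1 v :=
      hfa.sub ((HasTemperateGrowth.const _).mul hf1)
    have hau : a (e.symm u₀) = a x₀ := by rw [e.left_inv hx₀]
    have hlim := tendsto_localHeat_div_sq_eq_trace hΦs hΦi hΨ hc hcΨ hΨΦ has hm (by
      filter_upwards [hf1e, hfae] with v h1 h2
      rw [h1, h2, comp_apply, comp_apply, hau]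
      ring)
    have h1 : Tendsto (fun s : ℝ => G (u₀, s)) (𝓝[≠] 0) (𝓝 (G (u₀, 0))) := by
      have : Continuous fun s : ℝ => G (u₀, s) := hG.1.continuous.comp (by fun_prop)
      exact this.continuousAt.tendsto.mono_left nhdsWithin_le_nhds
    have h2 := hlim.const_mul (W1 (u₀, 0))
    refine tendsto_nhds_unique h1 (h2.congr' ?_)
    filter_upwards [self_mem_nhdsWithin] with s hs
    have hs : s ≠ 0 := hs
    rw [localHeat_sub_const_mul hΨ hc hcΨ hfa hf1]
    have h3 := hSG u₀ s
    rw [hW0.self_of_nhds, hau] at h3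
    have h4 : G (u₀, s) = (Wa (u₀, s) * W1 (u₀, 0) - a x₀ * W1 (u₀, 0) * W1 (u₀, s)) / s ^ 2 := by
      rw [h3]; field_simp
    rw [h4]
    ring
  refine ⟨fun u => 2 * G (u, 0) / W1 (u, 0) ^ 2, ?_, ?_, 2 * G' (u₀, 0) / W1 (u₀, 0) ^ 3, ?_⟩
  · refine ContDiffAt.div ?_ ?_ (by positivity)
    · exact (contDiff_const.mul (hG.1.comp (by fun_prop))).contDiffAt
    · exact ((hW1.1.comp (by fun_prop : ContDiff ℝ ∞ fun u : EuclideanSpace ℝ (Fin d) =>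
        (u, (0 : ℝ)))).pow 2).contDiffAt
  · simp only [hG0]
    rw [hW1u]
    field_simp
  · set l := 𝓝[>] (0 : ℝ) ×ˢ 𝓝 x₀
    have hpos : ∀ᶠ q : ℝ × M in l, 0 < q.1 := by
      filter_upwards [prod_mem_prod self_mem_nhdsWithin univ_mem] with q hq using hq.1
    have hsrc : ∀ᶠ z in 𝓝 x₀, z ∈ e.source := e.open_source.mem_nhds hx₀
    have hez : Tendsto e (𝓝 x₀) (𝓝 u₀) := e.continuousAt hx₀
    have hu : Tendsto (fun q : ℝ × M => e q.2) l (𝓝 u₀) := hez.comp tendsto_snd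
    have hs : Tendsto (fun q : ℝ × M => √q.1) l (𝓝 0) := by
      have h1 : Tendsto (fun t : ℝ => √t) (𝓝[>] 0) (𝓝 0) := by
        have := Real.continuous_sqrt.tendsto 0
        rw [Real.sqrt_zero] at this
        exact this.mono_left nhdsWithin_le_nhds
      exact h1.comp tendsto_fst
    have hus : Tendsto (fun q : ℝ × M => (e q.2, √q.1)) l (𝓝 (u₀, 0)) := hu.prodMk_nhds hs
    have hu0 : Tendsto (fun q : ℝ × M => (e q.2, (0 : ℝ))) l (𝓝 (u₀, 0)) :=
      hu.prodMk_nhds tendsto_const_nhds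
    have cW1 := (hW1.1.continuous.tendsto (u₀, 0)).comp hus
    have cW10 := (hW1.1.continuous.tendsto (u₀, 0)).comp hu0
    have cG0 := (hG.1.continuous.tendsto (u₀, 0)).comp hu0
    have cG' := (hG'.1.continuous.tendsto (u₀, 0)).comp hus
    have ca : Tendsto (fun q : ℝ × M => a q.2) l (𝓝 (a x₀)) :=
      (ha.continuous.tendsto x₀).comp tendsto_snd
    have ea := tendsto_heatIntegral_sub_div hδ hKa 2
    have e1 := tendsto_heatIntegral_sub_div hδ hK1 2
    have e10 := tendsto_heatIntegral_sub_div hδ hK1 0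
    have e11 := tendsto_heatIntegral_sub_div hδ hK1 1
    set A : ℝ × M → ℝ := fun q => heatIntegral (d := d) F q.1 a q.2 / √q.1 ^ d
    set T : ℝ × M → ℝ := fun q => heatIntegral (d := d) F q.1 (fun _ => 1) q.2 / √q.1 ^ d
    have cT : Tendsto T l (𝓝 (W1 (u₀, 0))) := by
      have := e10.add cW1
      rw [zero_add] at this
      refine this.congr fun q => ?_
      simp only [pow_zero, div_one, comp_apply]
      exact sub_add_cancel _ _
    -- The exact remainder divided by `t`, localization errors included. Replacing `Wa` and `W1` by
    -- the true integrals in the numerator costs errors divided by `t²`; in the denominator, errors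
    -- divided by `t`.
    have hlim : Tendsto (fun q : ℝ × M => 2 * (G' (e q.2, √q.1) +
        ((A q - Wa (e q.2, √q.1)) / q.1 ^ 2 - a q.2 * ((T q - W1 (e q.2, √q.1)) / q.1 ^ 2)) *
          W1 (e q.2, 0) ^ 2 - G (e q.2, 0) * ((T q - W1 (e q.2, √q.1)) / q.1 ^ 1)) /
        (T q * W1 (e q.2, 0) ^ 2)) l (𝓝 (2 * (G' (u₀, 0) + (0 - a x₀ * 0) * W1 (u₀, 0) ^ 2 -
          G (u₀, 0) * 0) / (W1 (u₀, 0) * W1 (u₀, 0) ^ 2))) :=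
      ((((cG'.add ((ea.sub (ca.mul e1)).mul (cW10.pow 2))).sub (cG0.mul e11)).const_mul 2).div
        (cT.mul (cW10.pow 2)) (by positivity))
    have hval : 2 * (G' (u₀, 0) + (0 - a x₀ * 0) * W1 (u₀, 0) ^ 2 -
          G (u₀, 0) * 0) / (W1 (u₀, 0) * W1 (u₀, 0) ^ 2) = 2 * G' (u₀, 0) / W1 (u₀, 0) ^ 3 := by
      ring
    rw [hval] at hlim
    refine hlim.congr' ?_
    obtain ⟨C, -, hC⟩ := exists_abs_le_of_continuous ha.continuous
    have hTpos : ∀ᶠ q in l, 0 < T q := cT.eventually (lt_mem_nhds hW1pos)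
    have hW10pos : ∀ᶠ q : ℝ × M in l, 0 < W1 (e q.2, 0) := cW10.eventually (lt_mem_nhds hW1pos)
    filter_upwards [hpos, hTpos, hW10pos, hu.eventually hW0, tendsto_snd.eventually hsrc]
      with q ht hT hW10 hq0 hqs
    rw [approxLaplacian_eq hF ha.continuous.measurable hC ht]
    have hsd : 0 < √q.1 ^ d := pow_pos (Real.sqrt_pos.2 ht) _
    have hIa : heatIntegral (d := d) F q.1 a q.2 = √q.1 ^ d * A q := by
      simp only [A]; field_simp
    have hI1 : heatIntegral (d := d) F q.1 (fun _ => 1) q.2 = √q.1 ^ d * T q := by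
      simp only [T]; field_simp
    have h1 := hSG (e q.2) (√q.1)
    have h2 := hSG' (e q.2) (√q.1)
    rw [hq0, e.left_inv hqs] at h1
    rw [Real.sq_sqrt ht.le] at h1 h2
    rw [hIa, hI1]
    set t := q.1
    set W := W1 (e q.2, 0)
    set W' := W1 (e q.2, √t)
    set Y := Wa (e q.2, √t)
    set g := G (e q.2, √t)
    set g0 := G (e q.2, 0)
    set g' := G' (e q.2, √t)
    have hg' : g' = (g * W - g0 * W') / t := by rw [h2]; field_simp
    have hg : g = (Y * W - a q.2 * W * W') / t := by rw [h1]; field_simp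
    rw [hg', hg]
    field_simp
    ring

/-- On the diagonal, the normalizing factor of the approximate Laplacian is comparable to `√t ^ d`. -/
lemma exists_mul_sqrt_pow_le_heatIntegral (x₀ : M) :
    ∃ κ > 0, ∀ᶠ t : ℝ in 𝓝[>] 0, κ * √t ^ d ≤ heatIntegral (d := d) F t (fun _ => 1) x₀ := by
  obtain ⟨Ψ, c, χ, δ, hΨ, hc, hcΨ, hΨΦ, hχ, hδ, hloc⟩ := exists_local_model hF x₀
  obtain ⟨hf1, K1, hK1⟩ := hloc (fun _ => 1) contMDiff_const
  set e := chartAt (EuclideanSpace ℝ (Fin d)) x₀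
  set f1 := localDensity F x₀ χ (fun _ => (1 : ℝ))
  have hW1 : HasTemperateGrowth (localHeat Ψ f1) := hasTemperateGrowth_localHeat hΨ hc hcΨ hf1
  have hinj : Injective (fderiv ℝ (F ∘ e.symm) (e x₀)) :=
    injective_fderiv_comp_chart_symm hF x₀ (e.map_source (mem_chart_source _ x₀))
  have hpos : 0 < localHeat Ψ f1 (e x₀, 0) := by
    obtain ⟨c', hc', hcA⟩ := exists_mul_norm_le_of_injective hinj
    have h1 : f1 (e x₀) = volumeDensity (F ∘ e.symm) (e x₀) := by
      simp only [f1, localDensity, hχ.self_of_nhds, one_mul, mul_one]; rfl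
    rw [localHeat_zero, h1, hΨΦ.fderiv_eq]
    exact mul_pos (volumeDensity_pos hinj) (integral_gaussWeight_pos hc' hcA)
  have h1 := (tendsto_heatIntegral_sub_div hδ hK1 0).comp
    (tendsto_id.prodMk (tendsto_const_nhds (x := x₀)))
  have h2 : Tendsto (fun t : ℝ => localHeat Ψ f1 (e x₀, √t)) (𝓝[>] 0)
      (𝓝 (localHeat Ψ f1 (e x₀, 0))) := by
    have h3 : Continuous fun t : ℝ => localHeat Ψ f1 (e x₀, √t) :=
      hW1.1.continuous.comp (by fun_prop)
    have := h3.tendsto 0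
    rw [Real.sqrt_zero] at this
    exact this.mono_left nhdsWithin_le_nhds
  have h3 := h1.add h2
  rw [zero_add] at h3
  refine ⟨localHeat Ψ f1 (e x₀, 0) / 2, by positivity, ?_⟩
  filter_upwards [h3.eventually (lt_mem_nhds (half_lt_self hpos)), self_mem_nhdsWithin]
    with t ht ht0
  have ht0 : 0 < √t ^ d := pow_pos (Real.sqrt_pos.2 ht0) _
  simp only [comp_apply, pow_zero, div_one, id] at ht
  have h4 := ht.trans_eq (sub_add_cancel _ _)
  exact ((lt_div_iff₀ ht0).1 h4).le

end Expansion

/-! ### Iterating the approximate Laplacian -/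

/-- Linearity is needed only once, for `L` applied to `Γ(L, f, f)`. It is a hypothesis at one point
because the operators in question are linear only on suitable functions. -/
lemma Gamma2_self_eq {X : Type*} (L : (X → ℝ) → X → ℝ) (f : X → ℝ) (x : X)
    (hL : L (fun z => (1 / 2 : ℝ) * (L (fun z => f z * f z) z - L f z * f z - f z * L f z)) x =
      (1 / 2 : ℝ) * (L (L fun z => f z * f z) x - L (fun z => L f z * f z) x -
        L (fun z => f z * L f z) x)) :
    Gamma2 L f f x = (1 / 2 : ℝ) * ((1 / 2 : ℝ) * (L (L fun z => f z * f z) x -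
        L (fun z => L f z * f z) x - L (fun z => f z * L f z) x) -
      (1 / 2 : ℝ) * (L (fun z => L f z * f z) x - L (L f) x * f x - L f x * L f x) -
      (1 / 2 : ℝ) * (L (fun z => f z * L f z) x - L f x * L f x - f x * L (L f) x)) := by
  rw [← hL]
  rfl

section Iteration

variable {d N : ℕ} {M : Type*} [TopologicalSpace M] [CompactSpace M]
  [ChartedSpace (EuclideanSpace ℝ (Fin d)) M] [IsManifold (𝓡 d) ∞ M]
  [MeasurableSpace M] [BorelSpace M] {F : M → EuclideanSpace ℝ (Fin N)}
  (hF : Manifold.IsSmoothEmbedding (𝓡 d) (𝓡 N) ∞ F)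

include hF

omit [CompactSpace M] [IsManifold (𝓡 d) ∞ M] [MeasurableSpace M] [BorelSpace M] in
lemma exists_le_chordalDist_of_notMem {x₀ : M} {U : Set M} (hU : U ∈ 𝓝 x₀) :
    ∃ δ > 0, ∀ z, z ∉ U → δ ≤ chordalDist F x₀ z := by
  rw [hF.isEmbedding.isInducing.nhds_eq_comap x₀] at hU
  obtain ⟨r, hr, hsub⟩ := (Metric.nhds_basis_ball.comap F).mem_iff.1 hU
  refine ⟨r, hr, fun z hz => not_lt.1 fun h => hz (hsub ?_)⟩
  rwa [mem_preimage, Metric.mem_ball, dist_comm, dist_eq_norm]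

/-- Averages against the heat kernel at `x₀` of functions converging near `x₀`. -/
lemma tendsto_heatIntegral_div {x₀ : M} {q : ℝ → M → ℝ} (hqm : ∀ t, 0 < t → Measurable (q t))
    {C : ℝ} (hqC : ∀ t, 0 < t → t < 1 → ∀ z, |q t z| ≤ C / t ^ 2) {l : ℝ}
    (hq : Tendsto (fun p : ℝ × M => q p.1 p.2) (𝓝[>] 0 ×ˢ 𝓝 x₀) (𝓝 l)) :
    Tendsto (fun t => heatIntegral (d := d) F t (q t) x₀ /
      heatIntegral (d := d) F t (fun _ => 1) x₀) (𝓝[>] 0) (𝓝 l) := by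
  have := isFiniteMeasure_riemannianVolume hF
  set μ := riemannianVolume d F
  obtain ⟨κ, hκ, hθ⟩ := exists_mul_sqrt_pow_le_heatIntegral hF x₀
  rw [Metric.tendsto_nhds]
  intro ε hε
  have hev : ∀ᶠ p : ℝ × M in 𝓝[>] 0 ×ˢ 𝓝 x₀, |q p.1 p.2 - l| < ε / 2 :=
    (Metric.tendsto_nhds.1 hq _ (half_pos hε)).mono fun p hp => by rwa [Real.dist_eq] at hp
  obtain ⟨P, hP, Q, hQ, hPQ⟩ := eventually_prod_iff.1 hev
  obtain ⟨δ, hδ, hδQ⟩ := exists_le_chordalDist_of_notMem hF hQ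
  have hC : 0 ≤ C := by
    have := (abs_nonneg _).trans (hqC 2⁻¹ (by norm_num) (by norm_num) x₀)
    by_contra! h
    exact absurd this (not_le.2 (div_neg_of_neg_of_pos h (by norm_num)))
  have hlim := (tendsto_exp_neg_div_sqrt_pow (δ := δ ^ 2 / 2) (by positivity) (d + 4)).const_mul
    ((C + |l|) * μ.real univ / κ)
  rw [mul_zero] at hlim
  have hlt1 : ∀ᶠ t : ℝ in 𝓝[>] 0, t < 1 := nhdsWithin_le_nhds (gt_mem_nhds one_pos)
  filter_upwards [hP, hθ, self_mem_nhdsWithin, hlt1, hlim.eventually (gt_mem_nhds (half_pos hε))]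
    with t htP hθt ht ht1 hsmall
  have ht : 0 < t := ht
  have hsd : 0 < √t ^ d := pow_pos (Real.sqrt_pos.2 ht) _
  set θ := heatIntegral (d := d) F t (fun _ => 1) x₀
  have hθpos : 0 < θ := (mul_pos hκ hsd).trans_le hθt
  set k : M → ℝ := fun z => Real.exp (-(chordalDist F x₀ z) ^ 2 / (2 * t))
  have hk0 : ∀ z, 0 < k z := fun z => Real.exp_pos _
  have hk1 : ∀ z, k z ≤ 1 := heatKernel_le_one ht x₀
  have hint1 : Integrable (fun z => q t z * k z) μ :=
    integrable_mul_heatKernel hF (hqm t ht) (hqC t ht ht1) ht x₀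
  have hint2 : Integrable (fun z => 1 * k z) μ :=
    integrable_mul_heatKernel hF measurable_const (C := 1) (by simp) ht x₀
  -- Bounds the integrand away from `x₀`, where only the crude bound on `q` is available.
  set η := (C + |l|) / t ^ 2 * Real.exp (-(δ ^ 2 / 2 / t))
  have hη : 0 ≤ η := by positivity
  have hbd : ∀ z, ‖q t z * k z - l * (1 * k z)‖ ≤ ε / 2 * (1 * k z) + η := fun z => by
    rw [one_mul, ← sub_mul, norm_mul, Real.norm_of_nonneg (hk0 z).le, Real.norm_eq_abs]
    by_cases hz : Q z
    · have := mul_le_mul_of_nonneg_right (hPQ htP hz).le (hk0 z).le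
      simp only at this
      linarith
    · have h1 : k z ≤ Real.exp (-(δ ^ 2 / 2 / t)) := by
        refine Real.exp_le_exp.2 ?_
        rw [neg_div, neg_le_neg_iff, div_div]
        have := hδQ z hz
        gcongr
      have h2 : |q t z - l| ≤ (C + |l|) / t ^ 2 := by
        have h3 : |l| ≤ |l| / t ^ 2 := le_div_self (abs_nonneg _) (by positivity)
          (pow_le_one₀ ht.le ht1.le)
        rw [add_div]
        exact (abs_sub _ _).trans (add_le_add (hqC t ht ht1 z) h3)
      have h3 : |q t z - l| * k z ≤ η := mul_le_mul h2 h1 (hk0 z).le (by positivity)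
      have := (hk0 z).le
      have : 0 ≤ ε / 2 * k z := by positivity
      linarith
  have hmain : |heatIntegral (d := d) F t (q t) x₀ - l * θ| ≤ ε / 2 * θ + η * μ.real univ := by
    have h1 : heatIntegral (d := d) F t (q t) x₀ - l * θ =
        ∫ z, (q t z * k z - l * (1 * k z)) ∂μ := by
      rw [integral_sub hint1 (hint2.const_mul l), integral_const_mul]
      rfl
    rw [h1, ← Real.norm_eq_abs]
    refine (norm_integral_le_of_norm_le ((hint2.const_mul (ε / 2)).add (integrable_const η))
      (ae_of_all _ hbd)).trans (le_of_eq ?_)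
    rw [integral_add' (hint2.const_mul (ε / 2)) (integrable_const η), integral_const_mul,
      integral_const, smul_eq_mul, mul_comm η]
    rfl
  -- The exponent `d + 4` combines `√t ^ d` from the normalization and `t² = √t ^ 4` from the crude
  -- bound.
  have hη2 : η * μ.real univ / θ ≤ (C + |l|) * μ.real univ / κ *
      (Real.exp (-(δ ^ 2 / 2 / t)) / √t ^ (d + 4)) := by
    have h1 : √t ^ (d + 4) = √t ^ d * t ^ 2 := by
      rw [pow_add, show 4 = 2 * 2 from rfl, pow_mul, Real.sq_sqrt ht.le]
    calc η * μ.real univ / θ ≤ η * μ.real univ / (κ * √t ^ d) := by gcongr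
      _ = _ := by rw [h1]; simp only [η]; field_simp
  rw [Real.dist_eq]
  have h1 : heatIntegral (d := d) F t (q t) x₀ / θ - l =
      (heatIntegral (d := d) F t (q t) x₀ - l * θ) / θ := by field_simp
  rw [h1, abs_div, abs_of_pos hθpos]
  calc |heatIntegral (d := d) F t (q t) x₀ - l * θ| / θ
      ≤ (ε / 2 * θ + η * μ.real univ) / θ := by gcongr
    _ = ε / 2 + η * μ.real univ / θ := by field_simp
    _ < ε / 2 + ε / 2 := by linarith
    _ = ε := add_halves ε

lemma continuous_heatIntegral {a : M → ℝ} (ha : Measurable a) {C : ℝ} (hC : ∀ z, |a z| ≤ C)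
    {t : ℝ} (ht : 0 < t) : Continuous (heatIntegral (d := d) F t a) := by
  have := isFiniteMeasure_riemannianVolume hF
  -- Dominated convergence works along countably generated filters; first countability is inherited
  -- from the Euclidean space.
  have := hF.isEmbedding.isInducing.firstCountableTopology
  refine continuous_of_dominated (bound := fun _ => C)
    (fun z => (integrable_mul_heatKernel hF ha hC ht z).aestronglyMeasurable)
    (fun z => ae_of_all _ fun z' => ?_) (integrable_const C) (ae_of_all _ fun z' => ?_)
  · have h0 := (Real.exp_pos (-(chordalDist F z z') ^ 2 / (2 * t))).le
    rw [norm_mul, Real.norm_of_nonneg h0]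
    exact (mul_le_mul (hC z') (heatKernel_le_one ht z z') h0
      ((abs_nonneg _).trans (hC z'))).trans (by simp)
  · have h1 := hF.isEmbedding.continuous
    unfold chordalDist
    fun_prop

lemma measurable_approxLaplacian {a : M → ℝ} (ha : Measurable a) {C : ℝ} (hC : ∀ z, |a z| ≤ C)
    {t : ℝ} (ht : 0 < t) :
    Measurable (approxLaplacian (chordalDist F) (riemannianVolume d F) t a) := by
  have h1 := (continuous_heatIntegral hF ha hC ht).measurable
  have h2 := (continuous_heatIntegral (d := d) hF (a := fun _ => 1) measurable_const (C := 1)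
    (by simp) ht).measurable
  rw [funext fun z => approxLaplacian_eq hF ha hC ht z]
  fun_prop

/-- The operator is `2 / t` times an average minus a value. This crude bound suffices wherever the
kernel is exponentially small. -/
lemma abs_approxLaplacian_le {a : M → ℝ} (ha : Measurable a) {C : ℝ} (hC : ∀ z, |a z| ≤ C)
    {t : ℝ} (ht : 0 < t) (z : M) :
    |approxLaplacian (chordalDist F) (riemannianVolume d F) t a z| ≤ 4 * C / t := by
  rw [approxLaplacian_eq hF ha hC ht]
  set θ := heatIntegral (d := d) F t (fun _ => 1) z
  have hC0 : 0 ≤ C := (abs_nonneg _).trans (hC z)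
  have h1 := integrable_mul_heatKernel hF ha hC ht z
  have h2 := integrable_mul_heatKernel (d := d) hF (a := fun _ => (1 : ℝ)) measurable_const
    (C := 1) (by simp) ht z
  have hθ : 0 ≤ θ := integral_nonneg fun z' => by positivity
  have h3 : |heatIntegral (d := d) F t a z| ≤ C * θ := by
    rw [← Real.norm_eq_abs, show C * θ = ∫ z', C * (1 * Real.exp
      (-(chordalDist F z z') ^ 2 / (2 * t))) ∂riemannianVolume d F from
      (integral_const_mul _ _).symm]
    refine norm_integral_le_of_norm_le (h2.const_mul C) (ae_of_all _ fun z' => ?_)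
    rw [norm_mul, Real.norm_of_nonneg (Real.exp_pos _).le, one_mul, Real.norm_eq_abs]
    have := hC z'
    gcongr
  have h4 : |heatIntegral (d := d) F t a z - a z * θ| ≤ 2 * C * θ := by
    refine (abs_sub _ _).trans ?_
    rw [abs_mul, abs_of_nonneg hθ]
    have := mul_le_mul_of_nonneg_right (hC z) hθ
    linarith
  rw [abs_mul, abs_of_nonneg (by positivity)]
  -- If the normalization vanishes, division by zero makes the operator zero.
  rcases hθ.eq_or_lt with h0 | h0
  · rw [← h0]
    simp only [mul_zero, div_zero, zero_mul]
    positivity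
  · calc 2 / (t * θ) * |heatIntegral (d := d) F t a z - a z * θ|
        ≤ 2 / (t * θ) * (2 * C * θ) := by gcongr
      _ = 4 * C / t := by field_simp; ring

lemma approxLaplacian_half_sub_sub {u v w : M → ℝ} (hu : Measurable u) (hv : Measurable v)
    (hw : Measurable w) {C : ℝ} (huC : ∀ z, |u z| ≤ C) (hvC : ∀ z, |v z| ≤ C)
    (hwC : ∀ z, |w z| ≤ C) {t : ℝ} (ht : 0 < t) (x : M) :
    approxLaplacian (chordalDist F) (riemannianVolume d F) t
        (fun z => (1 / 2 : ℝ) * (u z - v z - w z)) x =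
      (1 / 2 : ℝ) * (approxLaplacian (chordalDist F) (riemannianVolume d F) t u x -
        approxLaplacian (chordalDist F) (riemannianVolume d F) t v x -
        approxLaplacian (chordalDist F) (riemannianVolume d F) t w x) := by
  have hC : ∀ z, |(1 / 2 : ℝ) * (u z - v z - w z)| ≤ 2 * C := fun z => by
    have h1 := abs_le.1 (huC z)
    have h2 := abs_le.1 (hvC z)
    have h3 := abs_le.1 (hwC z)
    rw [abs_le]
    constructor <;> linarith
  rw [approxLaplacian_eq hF (by fun_prop) hC ht, approxLaplacian_eq hF hu huC ht,
    approxLaplacian_eq hF hv hvC ht, approxLaplacian_eq hF hw hwC ht]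
  have h1 := integrable_mul_heatKernel hF hu huC ht x
  have h2 := integrable_mul_heatKernel hF hv hvC ht x
  have h3 := integrable_mul_heatKernel hF hw hwC ht x
  have h4 : heatIntegral (d := d) F t (fun z => (1 / 2 : ℝ) * (u z - v z - w z)) x =
      (1 / 2 : ℝ) * (heatIntegral (d := d) F t u x - heatIntegral (d := d) F t v x -
        heatIntegral (d := d) F t w x) := by
    simp only [heatIntegral]
    rw [← integral_sub h1 h2, ← integral_sub (f := fun z => u z * _ - v z * _) (h1.sub h2) h3,
      ← integral_const_mul]
    congr 1
    ext z
    ring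
  rw [h4]
  ring

-- For each fixed `z` near `x₀` the quotient is eventually bounded by `|l| + 1`, so the difference
-- is `O(t)`.
omit [CompactSpace M] [IsManifold (𝓡 d) ∞ M] [BorelSpace M] hF in
lemma eventually_tendsto_approxLaplacian {a : M → ℝ} {x₀ : M}
    {h : EuclideanSpace ℝ (Fin d) → ℝ} {l : ℝ} (hl : Tendsto (fun q : ℝ × M =>
        (approxLaplacian (chordalDist F) (riemannianVolume d F) q.1 a q.2 -
          h (chartAt (EuclideanSpace ℝ (Fin d)) x₀ q.2)) / q.1) (𝓝[>] 0 ×ˢ 𝓝 x₀) (𝓝 l)) :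
    ∀ᶠ z in 𝓝 x₀, Tendsto
      (fun t => approxLaplacian (chordalDist F) (riemannianVolume d F) t a z) (𝓝[>] 0)
      (𝓝 (h (chartAt (EuclideanSpace ℝ (Fin d)) x₀ z))) := by
  obtain ⟨P, hP, Q, hQ, hPQ⟩ := eventually_prod_iff.1
    (hl.abs.eventually (gt_mem_nhds (lt_add_one |l|)))
  filter_upwards [hQ] with z hz
  rw [tendsto_iff_norm_sub_tendsto_zero]
  have h1 : Tendsto (fun t : ℝ => (|l| + 1) * t) (𝓝[>] 0) (𝓝 0) := by
    have : Continuous fun t : ℝ => (|l| + 1) * t := by fun_prop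
    have := this.tendsto 0
    rw [mul_zero] at this
    exact this.mono_left nhdsWithin_le_nhds
  refine squeeze_zero' (Eventually.of_forall fun t => norm_nonneg _) ?_ h1
  filter_upwards [hP, self_mem_nhdsWithin] with t htP ht
  have ht : 0 < t := ht
  have h2 := (hPQ htP hz).le
  simp only [abs_div, abs_of_pos ht] at h2
  rwa [div_le_iff₀ ht] at h2

lemma tendsto_approxLaplacian {a : M → ℝ} (ha : ContMDiff (𝓡 d) 𝓘(ℝ, ℝ) ∞ a) (x : M) :
    Tendsto (fun t => approxLaplacian (chordalDist F) (riemannianVolume d F) t a x) (𝓝[>] 0)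
      (𝓝 (laplaceBeltrami d F a x)) := by
  obtain ⟨h, -, hx, l, hl⟩ := exists_expansion hF ha x
  rw [← hx]
  exact (eventually_tendsto_approxLaplacian hl).self_of_nhds

/-- At `z` the same quantity converges to the Laplacian computed in the chart at `z` and to `h` read
in the chart at `x₀`. Uniqueness of limits replaces the change of chart computation. -/
lemma laplaceBeltrami_eventuallyEq {a : M → ℝ} (ha : ContMDiff (𝓡 d) 𝓘(ℝ, ℝ) ∞ a) {x₀ : M}
    {h : EuclideanSpace ℝ (Fin d) → ℝ} {l : ℝ} (hl : Tendsto (fun q : ℝ × M =>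
        (approxLaplacian (chordalDist F) (riemannianVolume d F) q.1 a q.2 -
          h (chartAt (EuclideanSpace ℝ (Fin d)) x₀ q.2)) / q.1) (𝓝[>] 0 ×ˢ 𝓝 x₀) (𝓝 l)) :
    laplaceBeltrami d F a =ᶠ[𝓝 x₀] fun z => h (chartAt (EuclideanSpace ℝ (Fin d)) x₀ z) :=
  (eventually_tendsto_approxLaplacian hl).mono fun z hz =>
    tendsto_nhds_unique (tendsto_approxLaplacian hF ha z) hz

lemma exists_tendsto_approxLaplacian_sub_div {a : M → ℝ} (ha : ContMDiff (𝓡 d) 𝓘(ℝ, ℝ) ∞ a)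
    (x₀ : M) :
    ∃ l, Tendsto (fun q : ℝ × M =>
      (approxLaplacian (chordalDist F) (riemannianVolume d F) q.1 a q.2 -
        laplaceBeltrami d F a q.2) / q.1) (𝓝[>] 0 ×ˢ 𝓝 x₀) (𝓝 l) := by
  obtain ⟨h, -, -, l, hl⟩ := exists_expansion hF ha x₀
  refine ⟨l, hl.congr' ?_⟩
  filter_upwards [tendsto_snd.eventually (laplaceBeltrami_eventuallyEq hF ha hl)] with q hq
  rw [hq]

lemma contMDiff_laplaceBeltrami {a : M → ℝ} (ha : ContMDiff (𝓡 d) 𝓘(ℝ, ℝ) ∞ a) :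
    ContMDiff (𝓡 d) 𝓘(ℝ, ℝ) ∞ (laplaceBeltrami d F a) := by
  intro x₀
  obtain ⟨h, hh, -, l, hl⟩ := exists_expansion hF ha x₀
  refine ContMDiffAt.congr_of_eventuallyEq ?_ (laplaceBeltrami_eventuallyEq hF ha hl)
  have h1 : ContMDiffAt (𝓡 d) (𝓡 d) ∞ (chartAt (EuclideanSpace ℝ (Fin d)) x₀) x₀ :=
    (contMDiffOn_chart (I := 𝓡 d) (x := x₀)).contMDiffAt
      ((chartAt (EuclideanSpace ℝ (Fin d)) x₀).open_source.mem_nhds (mem_chart_source _ x₀))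
  exact hh.contMDiffAt.comp x₀ h1

/-- The approximate Laplacian can be iterated. -/
lemma tendsto_approxLaplacian_mul_approxLaplacian {a b : M → ℝ}
    (ha : ContMDiff (𝓡 d) 𝓘(ℝ, ℝ) ∞ a) (hb : ContMDiff (𝓡 d) 𝓘(ℝ, ℝ) ∞ b) (x : M) :
    Tendsto (fun t => approxLaplacian (chordalDist F) (riemannianVolume d F) t
        (fun z => b z * approxLaplacian (chordalDist F) (riemannianVolume d F) t a z) x) (𝓝[>] 0)
      (𝓝 (laplaceBeltrami d F (fun z => b z * laplaceBeltrami d F a z) x)) := by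
  set D := laplaceBeltrami d F a
  have hD : ContMDiff (𝓡 d) 𝓘(ℝ, ℝ) ∞ D := contMDiff_laplaceBeltrami hF ha
  obtain ⟨A, hA0, hA⟩ := exists_abs_le_of_continuous ha.continuous
  obtain ⟨B, hB0, hB⟩ := exists_abs_le_of_continuous hb.continuous
  obtain ⟨K, hK0, hK⟩ := exists_abs_le_of_continuous hD.continuous
  set L := approxLaplacian (chordalDist F) (riemannianVolume d F)
  obtain ⟨l, hl⟩ := exists_tendsto_approxLaplacian_sub_div hF ha x
  -- With `b L_t a = b Δ a + t r_t`, the factor `t` cancels the `1 / t` of the outer operator,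
  -- leaving `2 (average of r_t - r_t(x))`, whose two terms both tend to `b x * l`.
  set r : ℝ → M → ℝ := fun t z => b z * ((L t a z - D z) / t)
  have hrm : ∀ t, 0 < t → Measurable (r t) := fun t ht =>
    hb.continuous.measurable.mul (((measurable_approxLaplacian hF ha.continuous.measurable hA
      ht).sub hD.continuous.measurable).div_const t)
  have hrC : ∀ t, 0 < t → t < 1 → ∀ z, |r t z| ≤ B * (4 * A + K) / t ^ 2 := fun t ht ht1 z => by
    have h1 : |L t a z - D z| ≤ (4 * A + K) / t := by
      rw [add_div]
      exact (abs_sub _ _).trans (add_le_add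
        (abs_approxLaplacian_le hF ha.continuous.measurable hA ht z)
        ((hK z).trans (le_div_self hK0 ht ht1.le)))
    calc |r t z| = |b z| * (|L t a z - D z| / t) := by
          simp only [r, abs_mul, abs_div, abs_of_pos ht]
      _ ≤ B * ((4 * A + K) / t / t) := by
          have := hB z
          gcongr
      _ = B * (4 * A + K) / t ^ 2 := by field_simp
  have hrl : Tendsto (fun p : ℝ × M => r p.1 p.2) (𝓝[>] 0 ×ˢ 𝓝 x) (𝓝 (b x * l)) :=
    ((hb.continuous.tendsto x).comp tendsto_snd).mul hl
  have hrx : Tendsto (fun t => r t x) (𝓝[>] 0) (𝓝 (b x * l)) :=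
    hrl.comp (tendsto_id.prodMk (tendsto_const_nhds (x := x)))
  have havg := tendsto_heatIntegral_div hF hrm hrC hrl
  have hbD := tendsto_approxLaplacian hF (hb.mul hD) x
  have hlim := hbD.add ((havg.sub hrx).const_mul 2)
  rw [sub_self, mul_zero, add_zero] at hlim
  refine hlim.congr' ?_
  obtain ⟨κ, hκ, hθ⟩ := exists_mul_sqrt_pow_le_heatIntegral hF x
  have hlt1 : ∀ᶠ t : ℝ in 𝓝[>] 0, t < 1 := nhdsWithin_le_nhds (gt_mem_nhds one_pos)
  filter_upwards [self_mem_nhdsWithin, hlt1, hθ] with t ht ht1 hθt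
  have ht : 0 < t := ht
  have hθpos : 0 < heatIntegral (d := d) F t (fun _ => 1) x :=
    (mul_pos hκ (pow_pos (Real.sqrt_pos.2 ht) d)).trans_le hθt
  have hbDm : Measurable fun z => b z * D z := (hb.continuous.mul hD.continuous).measurable
  have hbDC : ∀ z, |b z * D z| ≤ B * K := fun z => by
    rw [abs_mul]
    exact mul_le_mul (hB z) (hK z) (abs_nonneg _) hB0
  have hbLm : Measurable fun z => b z * L t a z :=
    hb.continuous.measurable.mul (measurable_approxLaplacian hF ha.continuous.measurable hA ht)
  have hbLC : ∀ z, |b z * L t a z| ≤ B * (4 * A / t) := fun z => by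
    rw [abs_mul]
    exact mul_le_mul (hB z) (abs_approxLaplacian_le hF ha.continuous.measurable hA ht z)
      (abs_nonneg _) hB0
  have hsum : ∀ z, b z * L t a z = b z * D z + t * r t z := fun z => by
    simp only [r]
    field_simp
    ring
  have hI : heatIntegral (d := d) F t (fun z => b z * L t a z) x =
      heatIntegral (d := d) F t (fun z => b z * D z) x + t * heatIntegral (d := d) F t (r t) x := by
    simp only [heatIntegral, ← integral_const_mul]
    rw [← integral_add (integrable_mul_heatKernel hF hbDm hbDC ht x)
      ((integrable_mul_heatKernel hF (hrm t ht) (hrC t ht ht1) ht x).const_mul t)]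
    congr 1
    ext z
    rw [hsum]
    ring
  show L t (fun z => b z * D z) x + _ = L t (fun z => b z * L t a z) x
  rw [show L t (fun z => b z * D z) x = _ from approxLaplacian_eq hF hbDm hbDC ht x,
    show L t (fun z => b z * L t a z) x = _ from approxLaplacian_eq hF hbLm hbLC ht x, hI, hsum x]
  field_simp
  ring

/-- Linearity is inherited from the approximate Laplacians by passing to the limit. -/
lemma laplaceBeltrami_half_sub_sub {u v w : M → ℝ} (hu : ContMDiff (𝓡 d) 𝓘(ℝ, ℝ) ∞ u)
    (hv : ContMDiff (𝓡 d) 𝓘(ℝ, ℝ) ∞ v) (hw : ContMDiff (𝓡 d) 𝓘(ℝ, ℝ) ∞ w) (x : M) :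
    laplaceBeltrami d F (fun z => (1 / 2 : ℝ) * (u z - v z - w z)) x =
      (1 / 2 : ℝ) * (laplaceBeltrami d F u x - laplaceBeltrami d F v x -
        laplaceBeltrami d F w x) := by
  obtain ⟨A, -, hA⟩ := exists_abs_le_of_continuous hu.continuous
  obtain ⟨B, -, hB⟩ := exists_abs_le_of_continuous hv.continuous
  obtain ⟨C, -, hC⟩ := exists_abs_le_of_continuous hw.continuous
  have h1 := tendsto_approxLaplacian hF (contMDiff_const (c := (1 / 2 : ℝ)) |>.mul
    ((hu.sub hv).sub hw)) x
  refine tendsto_nhds_unique h1 ((((tendsto_approxLaplacian hF hu x).sub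
    (tendsto_approxLaplacian hF hv x)).sub (tendsto_approxLaplacian hF hw x)).const_mul
      (1 / 2 : ℝ) |>.congr' ?_)
  filter_upwards [self_mem_nhdsWithin] with t ht
  exact (approxLaplacian_half_sub_sub hF hu.continuous.measurable hv.continuous.measurable
    hw.continuous.measurable (C := max A (max B C)) (fun z => (hA z).trans (by simp))
    (fun z => (hB z).trans (by simp)) (fun z => (hC z).trans (by simp)) ht x).symm

/-- The iterated carré du champ of the approximate Laplacian converges to the one of the
Laplace-Beltrami operator, for all smooth functions. -/
lemma tendsto_Gamma2_approxLaplacian {f : M → ℝ} (hf : ContMDiff (𝓡 d) 𝓘(ℝ, ℝ) ∞ f) (x : M) :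
    Tendsto (fun t => Gamma2 (approxLaplacian (chordalDist F) (riemannianVolume d F) t) f f x)
      (𝓝[>] 0) (𝓝 (Gamma2 (laplaceBeltrami d F) f f x)) := by
  have hff : ContMDiff (𝓡 d) 𝓘(ℝ, ℝ) ∞ fun z => f z * f z := hf.mul hf
  have hD := contMDiff_laplaceBeltrami hF hf
  -- Taking `b = 1` covers the terms `L (L a)`.
  have hone : ContMDiff (𝓡 d) 𝓘(ℝ, ℝ) ∞ fun _ : M => (1 : ℝ) := contMDiff_const
  have h1 := tendsto_approxLaplacian_mul_approxLaplacian hF hff hone x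
  have h2 := tendsto_approxLaplacian_mul_approxLaplacian hF hf hone x
  have h3 := tendsto_approxLaplacian_mul_approxLaplacian hF hf hf x
  have h3' := h3
  have h4 := tendsto_approxLaplacian hF hf x
  simp only [one_mul] at h1 h2
  -- Both `L (f L f)` and `L ((L f) f)` occur in `Γ₂`.
  simp only [mul_comm (f _)] at h3'
  rw [Gamma2_self_eq _ _ _ (laplaceBeltrami_half_sub_sub hF (contMDiff_laplaceBeltrami hF hff)
    (hD.mul hf) (hf.mul hD) x)]
  refine Tendsto.congr' ?_ (((((h1.sub h3').sub h3).const_mul (1 / 2 : ℝ)).sub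
    (((h3'.sub (h2.mul_const (f x))).sub (h4.mul h4)).const_mul (1 / 2 : ℝ)) |>.sub
    (((h3.sub (h4.mul h4)).sub (h2.const_mul (f x))).const_mul (1 / 2 : ℝ))).const_mul
      (1 / 2 : ℝ))
  filter_upwards [self_mem_nhdsWithin] with t ht
  have ht : 0 < t := ht
  obtain ⟨C, hC0, hC⟩ := exists_abs_le_of_continuous hf.continuous
  obtain ⟨C', hC0', hC'⟩ := exists_abs_le_of_continuous hff.continuous
  have hfm := hf.continuous.measurable
  have hLm := measurable_approxLaplacian hF hfm hC ht
  have hLC := abs_approxLaplacian_le hF hfm hC ht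
  refine (Gamma2_self_eq _ _ _ (approxLaplacian_half_sub_sub hF
    (measurable_approxLaplacian hF hff.continuous.measurable hC' ht) (hLm.mul hfm) (hfm.mul hLm)
    (C := max (4 * C' / t) (4 * C / t * C))
    (fun z => (abs_approxLaplacian_le hF hff.continuous.measurable hC' ht z).trans
      (le_max_left _ _)) (fun z => ?_) (fun z => ?_) ht x)).symm
  · rw [Pi.mul_apply, abs_mul]
    exact (mul_le_mul (hLC z) (hC z) (abs_nonneg _) (by positivity)).trans (le_max_right _ _)
  · rw [Pi.mul_apply, mul_comm, abs_mul]
    exact (mul_le_mul (hLC z) (hC z) (abs_nonneg _) (by positivity)).trans (le_max_right _ _)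

omit [CompactSpace M] [IsManifold (𝓡 d) ∞ M] [MeasurableSpace M] [BorelSpace M] in
lemma contMDiff_linearFn (x y : M) : ContMDiff (𝓡 d) 𝓘(ℝ, ℝ) ∞ (linearFn F x y) :=
  (innerSL ℝ (F y - F x)).contDiff.contMDiff.comp hF.contMDiff

end Iteration

end CoarseRicci

theorem corollary1p5 {d N : ℕ} {M : Type*} [TopologicalSpace M] [CompactSpace M]
    [ChartedSpace (EuclideanSpace ℝ (Fin d)) M] [IsManifold (𝓡 d) ∞ M]
    [MeasurableSpace M] [BorelSpace M]
    (F : M → EuclideanSpace ℝ (Fin N)) (hF : Manifold.IsSmoothEmbedding (𝓡 d) (𝓡 N) ∞ F)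
    (x y : M) :
    Tendsto
      (fun t : ℝ =>
        CoarseRicci.Gamma2
          (CoarseRicci.approxLaplacian (CoarseRicci.chordalDist F)
            (CoarseRicci.riemannianVolume d F) t)
          (CoarseRicci.linearFn F x y) (CoarseRicci.linearFn F x y) x)
      (𝓝[>] 0)
      (𝓝 (CoarseRicci.coarseRic F (CoarseRicci.laplaceBeltrami d F) x y)) :=
  CoarseRicci.tendsto_Gamma2_approxLaplacian hF (CoarseRicci.contMDiff_linearFn hF x y) x
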